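/- Let $\tau\in\mathbb H$, $\Lambda=\mathbb Z+\mathbb Z\tau$, $E=\mathbb C/\Lambda$, let $\zeta$ be the Weierstrass zeta function of $\Lambda$ and $\eta(\omega)=\zeta(z+\omega)-\zeta(z)$ for $\omega\in\Lambda$. Let $p_1,\dots,p_r\in\mathbb C$ be pairwise distinct modulo $\Lambda$, and let $n_1,\dots,n_r\in\mathbb C\setminus\{0\}$ with $n:=\sum_i n_i\in\mathbb Z_{\ge 0}$. Let $\mathcal P_n$ be the quotient (with the quotient topology) of $\mathbb C^n\times\mathbb P^1$, $\mathbb P^1=\mathbb C\cup\{\infty\}$, by the equivalence relation generated by permutations of $a_1,\dots,a_n$ and by $(a_1,\dots,a_i,\dots,a_n,h)\sim(a_1,\dots,a_i+\omega,\dots,a_n,h+\eta(\omega))$, $\omega\in\Lambda$, where $\infty+\eta(\omega)=\infty$. The generalized Lamé curve $\mathcal Y=\mathcal Y_{\mathbf n}(\mathbf p;\tau)\subset\mathcal P_n$ is the set of classes $[(\mathbf a,h)]$ with $h\in\mathbb C$ such that the $a_\mu$ are distinct from each other and from the $p_i$ modulo $\Lambda$, $n h=\sum_{\mu=1}^n\sum_{i=1}^r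 n_i\zeta(a_\mu-p_i)$, and $$\sum_{i=1}^r\sum_{\nu\ne\mu} n_i\big(\zeta(a_\mu-a_\nu)-\zeta(a_\mu-p_i)+\zeta(a_\nu-p_i)\big)=0,\qquad \mu=1,\dots,n; \tag{1}$$ (for $n=0$, $h\in\mathbb C$ is free). Let $\overline{\mathcal Y}$ be the closure of $\mathcal Y$ in $\mathcal P_n$. Call $\mathbf k=(k_1,\dots,k_r)\in\mathbb Z_{\ge0}^r$ admissible if $\sum_i k_i=n$ and $k_i\le 2n_i$ whenever $n_i\in\frac12\mathbb N$, and let $x_{\mathbf k}=[(k_1p_1,\dots,k_rp_r),\infty]\in\mathcal P_n$, where $k_ip_i$ means that $p_i$ is repeated $k_i$ times; let $I_j\subset\{1,\dots,n\}$ be the block of $k_j$ indices $\mu$ belonging to $p_j$. Write $L_k^{(\alpha)}(X)=\sum_{m=0}^k\binom{k+\alpha}{k-m}\frac{(-X)^m}{m!}$. **Theorem 3.9.** (i) The points of $\overline{\mathcal Y}\setminus\mathcal Y$ with $h=\infty$ are exactly the points $x_{\mathbf k}$ with $\mathbf k$ admissible. Let now $\mathbf k$ be admissible. (ii) There are $\mathbb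 C^n$-valued $\mathbf a(t)$ and $\mathbb C$-valued $u(t)$, holomorphic near $t=0$, with $a_\mu(0)=p_j$ for $\mu\in I_j$, $u(0)=0$ and $[(\mathbf a(t),1/u(t))]\in\mathcal Y$ for all small $t\neq0$, such that, with $\gamma(t)=[(\mathbf a(t),1/u(t))]$ and $\gamma(0)=x_{\mathbf k}$: - $c:=u'(0)\ne0$, all $a_\mu'(0)\neq 0$, and for every $j$ $$L_{k_j}^{(-2n_j-1)}\Big(-\frac{2X}{c}\Big)=\frac{(2/c)^{k_j}}{k_j!}\prod_{\mu\in I_j}\big(X-a_\mu'(0)\big);\tag{2}$$ - $\gamma$ is injective near $0$, and for every neighbourhood $U$ of $0$ the set $\gamma(U)$ contains a neighbourhood of $x_{\mathbf k}$ in $\overline{\mathcal Y}$ (so $\overline{\mathcal Y}$ has a single branch at $x_{\mathbf k}$); - if $\delta(t)=[(\mathbf b(t),1/v(t))]$, with $(\mathbf b,v)$ holomorphic near $0$, is any arc with $\delta(0)=x_{\mathbf k}$ and $\delta(t)\in\mathcal Y$ for small $t\ne0$, then $\delta=\gamma\circ\varphi$ near $0$ for some holomorphic $\varphi$ with $\varphi(0)=0$,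 and $\varphi'(0)\neq0$ if $(\mathbf b,v)'(0)\ne0$. (iii) The coefficients of such arcs are built inductively. For $m\ge0$ say that $(\alpha_{\mu i})_{1\le i\le m+1}$ solves (1) to order $m$ if the $\alpha_{\mu1}$ are nonzero and distinct within each block, and along $a_\mu(t)=p_j+\sum_{i=1}^{m+1}\alpha_{\mu i}t^i$ $(\mu\in I_j)$ the left-hand sides of (1) are $O(t^m)$ as $t\to0$. Then $(\alpha_{\mu1})$ solves (1) to order $0$ if and only if there is $c\ne0$ such that (2) holds for every $j$ with $\alpha_{\mu1}$ in place of $a'_\mu(0)$. Whenever $(\alpha_{\mu i})_{i\le m+1}$ solves (1) to order $m$, the vectors $(\alpha_{\mu,m+2})_\mu$ that extend it to a solution to order $m+1$ form a set $v_0+\mathbb C\cdot(\alpha_{\mu1})_\mu$ for some $v_0\in\mathbb C^n$. -/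

import Mathlib

open Filter Topology Polynomial

noncomputable section

namespace LameCurve

/-- The period pair `(1, τ)`, so that the lattice is `Λ_τ = ℤ + ℤτ`. -/
def periods (τ : UpperHalfPlane) : PeriodPair where
  ω₁ := 1
  ω₂ := (τ : ℂ)
  indep := by
    rw [LinearIndependent.pair_iff]
    intro s t h
    have him := congrArg Complex.im h
    have hre := congrArg Complex.re h
    simp at him hre
    rcases him with rfl | h0
    · exact ⟨by simpa using hre, rfl⟩
    · exact absurd h0 τ.im_pos.ne'

/-- The Weierstrass zeta function
`ζ(z) = 1/z + ∑_{0 ≠ l ∈ Λ} (1/(z - l) + 1/l + z/l²)`.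
The term `l = 0` of the sum below is `1/z`, because `1/0 = z/0 = 0`.
(The value at a lattice point is a junk value and is never used.) -/
def weierstrassZeta (L : PeriodPair) (z : ℂ) : ℂ :=
  ∑' l : L.lattice, (1 / (z - l) + 1 / (l : ℂ) + z / (l : ℂ) ^ 2)

/-- The quasi-period `η(ω) = ζ(z + ω) - ζ(z)` of a lattice vector `ω`. It does not depend on
`z ∉ Λ`; the half period `z = ω₁/2 ∉ Λ` is used here. -/
def quasiPeriod (L : PeriodPair) (ω : L.lattice) : ℂ :=
  weierstrassZeta L (L.ω₁ / 2 + ω) - weierstrassZeta L (L.ω₁ / 2)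

/-- The relations on `ℂⁿ × ℙ¹` (with `ℙ¹ = ℂ ∪ {∞}`) that generate the equivalence relation
defining the compactified ambient space: permutations of the `a_μ`, and
`(a_1, …, a_i, …, a_n, h) ∼ (a_1, …, a_i + ω, …, a_n, h + η(ω))`, where `∞ + η(ω) = ∞`. -/
inductive AmbientRel (L : PeriodPair) (n : ℕ) :
    (Fin n → ℂ) × OnePoint ℂ → (Fin n → ℂ) × OnePoint ℂ → Prop
  | perm (a : Fin n → ℂ) (h : OnePoint ℂ) (s : Equiv.Perm (Fin n)) :
      AmbientRel L n (a, h) (a ∘ s, h)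
  | shift (a : Fin n → ℂ) (h : OnePoint ℂ) (i : Fin n) (ω : L.lattice) :
      AmbientRel L n (a, h)
        (Function.update a i (a i + ω), OnePoint.map (fun x => x + quasiPeriod L ω) h)

/-- The ambient space `𝒫_n`: the `ℙ¹`-bundle over `Symⁿ E` that compactifies fibrewise the affine
line bundle `Symⁿ ℂ × ℂ / ∼`. It is the quotient of `ℂⁿ × ℙ¹` by the equivalence relation
generated by `AmbientRel`, and it carries the quotient topology. -/
abbrev Ambient (L : PeriodPair) (n : ℕ) : Type := Quot (AmbientRel L n)

/-- The class `[(a, h)]`. -/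
def mk (L : PeriodPair) {n : ℕ} (a : Fin n → ℂ) (h : OnePoint ℂ) : Ambient L n :=
  Quot.mk _ (a, h)

/-- The divisor `h = ∞` of the ambient space. -/
def infinityDivisor (L : PeriodPair) (n : ℕ) : Set (Ambient L n) :=
  {x | ∃ a : Fin n → ℂ, x = mk L a OnePoint.infty}

/-- `ζ_n(a, p) = ∑_μ ∑_i n_i ζ(a_μ - p_i)`. -/
def zetaSum (L : PeriodPair) {r n : ℕ} (p w : Fin r → ℂ) (a : Fin n → ℂ) : ℂ :=
  ∑ μ, ∑ i, w i * weierstrassZeta L (a μ - p i)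

/-- The left-hand side of the `μ`-th defining equation of the generalized Lamé curve,
`∑_i ∑_{ν ≠ μ} n_i (ζ(a_μ - a_ν) - ζ(a_μ - p_i) + ζ(a_ν - p_i))`. -/
def lameEq (L : PeriodPair) {r n : ℕ} (p w : Fin r → ℂ) (a : Fin n → ℂ) (μ : Fin n) : ℂ :=
  ∑ i, ∑ ν ∈ Finset.univ.erase μ, w i *
    (weierstrassZeta L (a μ - a ν) - weierstrassZeta L (a μ - p i)
      + weierstrassZeta L (a ν - p i))

/-- `(a, h)` is a datum of a generalized Hermite--Halphen ansatz: the `a_μ` are distinct from each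
other and from the `p_i` modulo `Λ`, the defining equations hold, and `n h = ζ_n(a, p)`.
For `n = 0` this leaves `h` free. -/
def IsAnsatz (L : PeriodPair) {r n : ℕ} (p w : Fin r → ℂ) (a : Fin n → ℂ) (h : ℂ) : Prop :=
  (∀ μ ν, μ ≠ ν → a μ - a ν ∉ L.lattice) ∧
  (∀ μ i, a μ - p i ∉ L.lattice) ∧
  (∀ μ, lameEq L p w a μ = 0) ∧
  (n : ℂ) * h = zetaSum L p w a

/-- The (open) generalized Lamé curve `𝒴_n(p; τ)`. -/
def curve (L : PeriodPair) {r : ℕ} (n : ℕ) (p w : Fin r → ℂ) : Set (Ambient L n) :=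
  {x | ∃ (a : Fin n → ℂ) (h : ℂ), IsAnsatz L p w a h ∧ x = mk L a (h : OnePoint ℂ)}

/-- The points of the compactified generalized Lamé curve: the closure of `𝒴_n(p; τ)` in the
compact ambient space `𝒫_n`. -/
def compactCurve (L : PeriodPair) {r : ℕ} (n : ℕ) (p w : Fin r → ℂ) : Set (Ambient L n) :=
  closure (curve L n p w)

/-- For `k_1 + ⋯ + k_r = n`, the index map `{1, …, n} → {1, …, r}` which takes the value `1` on the
first `k_1` indices, `2` on the next `k_2` indices, and so on. -/
def block {r n : ℕ} (k : Fin r → ℕ) (hk : ∑ i, k i = n) (μ : Fin n) : Fin r :=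
  (finSigmaFinEquiv.symm (Fin.cast hk.symm μ)).1

/-- A representative in `ℂⁿ` of `[k_1 p_1, …, k_r p_r]`, that is, each `p_i` repeated `k_i` times. -/
def multiPoint {r n : ℕ} (p : Fin r → ℂ) (k : Fin r → ℕ) (hk : ∑ i, k i = n) : Fin n → ℂ :=
  fun μ => p (block k hk μ)

/-- `k_i ≤ 2 n_i` whenever `n_i ∈ ½ℕ`. -/
def Admissible {r : ℕ} (w : Fin r → ℂ) (k : Fin r → ℕ) : Prop :=
  ∀ (i : Fin r) (l : ℕ), 2 * w i = l → k i ≤ l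

/-- The point `1/u` of `ℙ¹`, with `1/0 = ∞`. -/
def invPoint (u : ℂ) : OnePoint ℂ :=
  open Classical in if u = 0 then OnePoint.infty else ((u⁻¹ : ℂ) : OnePoint ℂ)

/-- The point `[(a, 1/u)]` of the ambient space, for `(a, u)` in `ℂⁿ × ℂ`. -/
def arcPoint (L : PeriodPair) {n : ℕ} (x : (Fin n → ℂ) × ℂ) : Ambient L n :=
  mk L x.1 (invPoint x.2)

/-- `c = (a, u)` is a germ at `0` of a holomorphic arc `t ↦ [(a(t), 1/u(t))]` through the point `x₀`
which lies in the open generalized Lamé curve for all small `t ≠ 0`. -/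
def IsArcAt (L : PeriodPair) {r n : ℕ} (p w : Fin r → ℂ) (x₀ : Ambient L n)
    (c : ℂ → (Fin n → ℂ) × ℂ) : Prop :=
  AnalyticAt ℂ c 0 ∧ arcPoint L (c 0) = x₀ ∧
    ∀ᶠ t in 𝓝[≠] (0 : ℂ), arcPoint L (c t) ∈ curve L n p w

/-- The generalized Laguerre polynomial
`L_k^{(α)}(X) = ∑_{m=0}^{k} binom(k + α, k - m) (-X)^m / m!`, where
`binom(k + α, j) = (k + α)(k + α - 1)⋯(k + α - j + 1) / j!`. -/
def laguerre (k : ℕ) (α : ℂ) : ℂ[X] :=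
  ∑ m ∈ Finset.range (k + 1),
    C ((∏ j ∈ Finset.range (k - m), ((k : ℂ) + α - j)) / (Nat.factorial (k - m) : ℂ)
      * ((-1) ^ m / (Nat.factorial m : ℂ))) * X ^ m

/-- For every `j`, the numbers `b_μ` with `μ` in the `j`-th block are the `k_j` roots, with
multiplicities, of `L_{k_j}^{(-2 n_j - 1)}(-2 X / c)`, whose leading coefficient is
`(2/c)^{k_j} / k_j!`. The scaling factor `c` is common to all blocks. -/
def IsLaguerreSystem {r n : ℕ} (w : Fin r → ℂ) (k : Fin r → ℕ) (hk : ∑ i, k i = n) (c : ℂ)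
    (b : Fin n → ℂ) : Prop :=
  ∀ j, (laguerre (k j) (-2 * w j - 1)).comp (C (-2 / c) * X) =
    C ((2 / c) ^ k j / (Nat.factorial (k j) : ℂ)) *
      ∏ μ with block k hk μ = j, (X - C (b μ))

/-- The polynomial arc `a_μ(t) = p_j + ∑_{i=1}^{m} α_{μ i} t^i` (for `μ` in the `j`-th block);
`α i μ` stands for `α_{μ i}`. -/
def truncatedArc {r n : ℕ} (p : Fin r → ℂ) (k : Fin r → ℕ) (hk : ∑ i, k i = n)
    (α : ℕ → Fin n → ℂ) (m : ℕ) (t : ℂ) : Fin n → ℂ :=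
  fun μ => multiPoint p k hk μ + ∑ i ∈ Finset.Icc 1 m, α i μ * t ^ i

/-- The coefficients `α_{μ 1}, …, α_{μ, m+1}` solve the defining equations to order `m`: the
`α_{μ 1}` are nonzero, distinct within each block, and along the polynomial arc of degree `m + 1`
the coefficients of `t^{-1}, …, t^{m-1}` in all the defining equations vanish. -/
def SolvesToOrder (L : PeriodPair) {r n : ℕ} (p w : Fin r → ℂ) (k : Fin r → ℕ)
    (hk : ∑ i, k i = n) (m : ℕ) (α : ℕ → Fin n → ℂ) : Prop :=
  (∀ μ, α 1 μ ≠ 0) ∧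
  (∀ μ ν, μ ≠ ν → block k hk μ = block k hk ν → α 1 μ ≠ α 1 ν) ∧
  ∀ μ, (fun t => lameEq L p w (truncatedArc p k hk α (m + 1) t) μ) =O[𝓝[≠] (0 : ℂ)]
    fun t => t ^ m

end LameCurve

end

/-! Since `∑ w i = n` and ζ is odd, the equations (1) together with the formula for `h` say that all
the sums `∑_i n_i ζ(a_μ - p_i) - ∑_{ν ≠ μ} ζ(a_μ - a_ν)` equal `h` (`isAnsatz_iff`). Near `x_k` put
`u = 1/h` and `a = (k_1 p_1, …, k_r p_r) + u y`. After multiplication by `u` the equations read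
`scaledBethe (u, y) = 1`. They are analytic at `u = 0` wherever the `y_μ` are nonzero and distinct
within each block, and at `u = 0` they decouple into one rational system per block, `n_j / y_μ - ∑_ν
1 / (y_μ - y_ν) = 1`.

The rational system is treated as Stieltjes did. In the basis of polynomials with one root omitted,
a second-order operator applied to the polynomial with roots `y_μ` has the defects of the equations
as coefficients (`laguerreOp_rootPoly`). Solutions are thus root sets of scaled Laguerre
polynomials, and admissibility is what keeps these roots nonzero, hence simple. The same operator
computes the linearized system (`laguerreOp_sum_rootPoly_erase`); it has no kernel in degrees below
`k_j`, so the Jacobian is invertible and the implicit function theorem gives a branch `y = Y(u)`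
(`exists_branch`).

That nothing else tends to `x_k` is a compactness statement: along any ultrafilter of solutions the
rescaled clusters stay bounded and converge to a Laguerre system (`exists_tendsto_of_bethe`), which
is the chosen one up to a permutation, so local uniqueness applies (`eventually_eq_branch`). If `2
n_j = d < k_j`, the recursion for the coefficients of the root polynomial breaks off at degree `d`,
and its lowest coefficients would be negligible against themselves (`false_of_bethe_resonance`).
Points with `h = ∞` lie over the `p_i`, because summing the equations over a cluster away from the
`p_i` cancels all poles.

For (iii), each order is a linear system with this same Jacobian `M`, modulo constant vectors. By
homogeneity `M` sends the leading coefficients to a nonzero constant vector, so the solutions form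
an affine line in that direction. -/

noncomputable section
namespace LameCurve

/-! ### The Weierstrass zeta function: convergence, derivative, quasi-periodicity. -/

section Zeta
variable (L : PeriodPair)

/-- The Weierstrass zeta function without its polar term `1 / z` at the origin. -/
def zetaReg (z : ℂ) : ℂ :=
  ∑' l : L.lattice, if (l : ℂ) = 0 then 0 else (1 / (z - l) + 1 / (l : ℂ) + z / (l : ℂ) ^ 2)

/-- Over a common denominator the summand is `s ^ 2 / (l ^ 2 * (s - l))`, hence of cubic decay in
the lattice vector. -/
lemma zeta_summand_bound (r : ℝ) (hr : 0 < r) (s : ℂ) (hs : ‖s‖ < r) (l : ℂ) (h : 2 * r ≤ ‖l‖) :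
    ‖1 / (s - l) + 1 / l + s / l ^ 2‖ ≤ 2 * r ^ 2 * ‖l‖ ^ (-3 : ℝ) := by
  have hl0 : l ≠ 0 := by rintro rfl; simp at h; linarith
  have hsl : s - l ≠ 0 := by
    intro h0; rw [sub_eq_zero] at h0; subst h0; linarith
  have hlpos : 0 < ‖l‖ := by simpa using hl0
  have e : 1 / (s - l) + 1 / l + s / l ^ 2 = s ^ 2 / (l ^ 2 * (s - l)) := by
    field_simp; ring
  have h2 : ‖l‖ / 2 ≤ ‖s - l‖ := by
    rw [norm_sub_rev]
    exact .trans (by linarith) (norm_sub_norm_le l s)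
  have e3 : ‖l‖ ^ (-3 : ℝ) = (‖l‖ ^ 3)⁻¹ := by norm_cast
  rw [e, e3, norm_div, norm_mul, norm_pow, norm_pow]
  calc ‖s‖ ^ 2 / (‖l‖ ^ 2 * ‖s - l‖) ≤ r ^ 2 / (‖l‖ ^ 2 * (‖l‖ / 2)) := by gcongr
    _ = 2 * r ^ 2 * (‖l‖ ^ 3)⁻¹ := by field_simp

lemma hasSumLocallyUniformly_zetaReg :
    HasSumLocallyUniformly
      (fun (l : L.lattice) (z : ℂ) ↦
        if (l : ℂ) = 0 then 0 else (1 / (z - l) + 1 / (l : ℂ) + z / (l : ℂ) ^ 2))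
      (zetaReg L) := by
  refine L.hasSumLocallyUniformly_aux (u := (2 * · ^ 2 * ‖·‖ ^ (-3 : ℝ))) _
    (fun _ _ ↦ (ZLattice.summable_norm_rpow _ _ (by simp; norm_num)).mul_left _) fun r hr ↦
    Filter.eventually_atTop.mpr ⟨2 * r, ?_⟩
  rintro _ h s hs l rfl
  split_ifs
  · simp only [norm_zero]; positivity
  · exact zeta_summand_bound r hr s hs l h

lemma weierstrassZeta_eq (z : ℂ) : weierstrassZeta L z = 1 / z + zetaReg L z := by
  have h0 : HasSum (fun l : L.lattice ↦ if (l : ℂ) = 0 then 1 / z else 0) (1 / z) := by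
    have := hasSum_ite_eq (0 : L.lattice) (1 / z)
    convert this using 3 with l
    simp
  have h1 := h0.add ((hasSumLocallyUniformly_zetaReg L).hasSum (x := z))
  rw [weierstrassZeta, ← h1.tsum_eq]
  refine tsum_congr fun l ↦ ?_
  split_ifs with hl <;> simp [hl]

lemma zetaReg_zero : zetaReg L 0 = 0 := by
  rw [zetaReg]
  convert tsum_zero with l
  split_ifs with hl
  · rfl
  · simp

lemma weierstrassZeta_neg (z : ℂ) : weierstrassZeta L (-z) = -weierstrassZeta L z := by
  simp only [weierstrassZeta]
  rw [← (Equiv.neg L.lattice).tsum_eq, ← tsum_neg]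
  refine tsum_congr fun l ↦ ?_
  simp only [Equiv.neg_apply, NegMemClass.coe_neg]
  have : -z - -(l : ℂ) = -(z - l) := by ring
  rw [this, one_div, inv_neg, one_div, inv_neg]
  ring

lemma differentiableOn_zetaReg :
    DifferentiableOn ℂ (zetaReg L) ((L.lattice : Set ℂ) \ {0})ᶜ := by
  refine (hasSumLocallyUniformly_zetaReg L).hasSumLocallyUniformlyOn.differentiableOn
    (.of_forall fun s ↦ .fun_sum fun i hi ↦ ?_) L.isOpen_compl_lattice_sdiff
  split_ifs with h
  · simp
  · intro z hz
    have : z - i ≠ 0 := by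
      intro h0
      rw [sub_eq_zero] at h0
      exact hz ⟨h0 ▸ i.2, by simpa [h0] using h⟩
    have : DifferentiableAt ℂ (fun x : ℂ ↦ 1 / (x - i) + 1 / (i : ℂ) + x / (i : ℂ) ^ 2) z := by
      fun_prop (disch := assumption)
    exact this.differentiableWithinAt

lemma analyticAt_zetaReg {z : ℂ} (hz : z ∈ L.lattice → z = 0) : AnalyticAt ℂ (zetaReg L) z :=
  (differentiableOn_zetaReg L).analyticAt (L.isOpen_compl_lattice_sdiff.mem_nhds
    fun h ↦ h.2 (hz h.1))

lemma analyticAt_weierstrassZeta {z : ℂ} (hz : z ∉ L.lattice) :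
    AnalyticAt ℂ (weierstrassZeta L) z := by
  have h0 : z ≠ 0 := fun h ↦ hz (h ▸ L.lattice.zero_mem)
  rw [show weierstrassZeta L = fun z ↦ 1 / z + zetaReg L z from funext (weierstrassZeta_eq L)]
  exact (analyticAt_const.div analyticAt_id h0).add (analyticAt_zetaReg L fun h ↦ absurd h hz)

lemma deriv_zetaReg {z : ℂ} (hz : z ∉ L.lattice) :
    deriv (zetaReg L) z = -L.weierstrassPExcept 0 z := by
  have hsum (s : ℂ) (hs : s ∈ ((L.lattice : Set ℂ) \ {0})ᶜ) (l : L.lattice) (hl : (l : ℂ) ≠ 0) :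
      s - l ≠ 0 := by
    intro h0
    rw [sub_eq_zero] at h0
    exact hs ⟨h0 ▸ l.2, by simpa [h0] using hl⟩
  have key : Set.EqOn (deriv (zetaReg L)) (fun z ↦ -L.weierstrassPExcept 0 z)
      ((L.lattice : Set ℂ) \ {0})ᶜ := by
    refine ((hasSumLocallyUniformly_zetaReg L).tendstoLocallyUniformlyOn.deriv
      (.of_forall fun s ↦ .fun_sum fun i hi ↦ ?_) L.isOpen_compl_lattice_sdiff).unique ?_
    · split_ifs with h
      · simp
      · intro z hz
        have h1 := hsum z hz i h
        have : DifferentiableAt ℂ (fun x : ℂ ↦ 1 / (x - i) + 1 / (i : ℂ) + x / (i : ℂ) ^ 2) z := by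
          fun_prop (disch := assumption)
        exact this.differentiableWithinAt
    · have := ((L.hasSumLocallyUniformly_weierstrassPExcept 0).tendstoLocallyUniformlyOn
        (s := ((L.lattice : Set ℂ) \ {0})ᶜ)).neg
      refine this.congr ?_
      intro s z hz
      simp only [Function.comp_apply, Pi.neg_apply]
      rw [← Finset.sum_neg_distrib]
      refine (HasDerivAt.fun_sum fun i _ ↦ ?_).deriv.symm
      split_ifs with h
      · simpa using hasDerivAt_const z (0 : ℂ)
      · have h1 := hsum z hz i h
        have h2 := (((hasDerivAt_id z).sub_const (i : ℂ)).inv h1).add_const (1 / (i : ℂ)) |>.add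
          ((hasDerivAt_id z).div_const ((i : ℂ) ^ 2))
        convert h2 using 1
        · ext x; simp
        · simp; ring
  exact key fun h ↦ hz h.1

lemma deriv_weierstrassZeta {z : ℂ} (hz : z ∉ L.lattice) :
    deriv (weierstrassZeta L) z = -L.weierstrassP z := by
  have h0 : z ≠ 0 := fun h ↦ hz (h ▸ L.lattice.zero_mem)
  rw [show weierstrassZeta L = fun z ↦ z⁻¹ + zetaReg L z from
    funext fun z ↦ by rw [weierstrassZeta_eq, one_div],
    deriv_fun_add (differentiableAt_inv h0)
      (analyticAt_zetaReg L fun h ↦ absurd h hz).differentiableAt, deriv_zetaReg L hz,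
    ← L.weierstrassPExcept_add 0 z, deriv_inv]
  simp

/-- By periodicity of ℘ the difference has zero derivative off the lattice. The complement of a
countable set in the plane is connected, so the difference is the constant read off at the half
period. -/
lemma weierstrassZeta_add_coe {z : ℂ} (hz : z ∉ L.lattice) (ω : L.lattice) :
    weierstrassZeta L (z + ω) = weierstrassZeta L z + quasiPeriod L ω := by
  have hconn : IsPreconnected ((L.lattice : Set ℂ)ᶜ) := by
    have hc : (L.lattice : Set ℂ).Countable :=
      Set.countable_coe_iff.mp (inferInstanceAs (Countable L.lattice))
    refine (hc.isPathConnected_compl_of_one_lt_rank ?_).isConnected.isPreconnected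
    rw [Complex.rank_real_complex]; norm_num
  have hadd {x : ℂ} (hx : x ∉ L.lattice) : x + ω ∉ L.lattice := fun h ↦
    hx (by simpa using L.lattice.sub_mem h ω.2)
  have hd {x : ℂ} (hx : x ∈ (L.lattice : Set ℂ)ᶜ) : HasDerivAt
      (fun x ↦ weierstrassZeta L (x + ω) - weierstrassZeta L x) 0 x := by
    have h1 := (analyticAt_weierstrassZeta L (hadd hx)).differentiableAt.hasDerivAt
    have h2 := (analyticAt_weierstrassZeta L hx).differentiableAt.hasDerivAt
    have h3 := (h1.comp_add_const x ω).sub h2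
    rwa [deriv_weierstrassZeta L hx, deriv_weierstrassZeta L (hadd hx), L.weierstrassP_add_coe,
      sub_self] at h3
  have := L.isClosed_lattice.isOpen_compl.is_const_of_deriv_eq_zero hconn
    (fun x hx ↦ (hd hx).differentiableAt.differentiableWithinAt) (fun x hx ↦ (hd hx).deriv)
    hz (y := L.ω₁ / 2) L.ω₁_div_two_notMem_lattice
  rw [quasiPeriod, ← this]
  ring

lemma quasiPeriod_add (ω ω' : L.lattice) :
    quasiPeriod L (ω + ω') = quasiPeriod L ω + quasiPeriod L ω' := by
  have h0 := L.ω₁_div_two_notMem_lattice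
  have h1 : L.ω₁ / 2 + ω ∉ L.lattice := fun h ↦ h0 (by simpa using L.lattice.sub_mem h ω.2)
  have e1 := weierstrassZeta_add_coe L h0 (ω + ω')
  have e2 := weierstrassZeta_add_coe L h0 ω
  have e3 := weierstrassZeta_add_coe L h1 ω'
  rw [Submodule.coe_add, ← add_assoc] at e1
  linear_combination e3 + e2 - e1

/-- The quasi-period homomorphism `η : Λ → ℂ`. -/
def quasiPeriodHom : L.lattice →+ ℂ := AddMonoidHom.mk' (quasiPeriod L) (quasiPeriod_add L)

@[simp] lemma quasiPeriodHom_apply (ω : L.lattice) : quasiPeriodHom L ω = quasiPeriod L ω := rfl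

end Zeta

set_option linter.unusedSectionVars false

/-! ### Stieltjes' correspondence between rational Bethe equations and a second-order differential
operator. -/

section RootPolynomial
variable {ι : Type*} [DecidableEq ι]

lemma sum_erase_comm {M : Type*} [AddCommMonoid M] (s : Finset ι) (F : ι → ι → M) :
    ∑ μ ∈ s, ∑ ν ∈ s.erase μ, F μ ν = ∑ μ ∈ s, ∑ ν ∈ s.erase μ, F ν μ := by
  refine Finset.sum_comm' fun x y ↦ ?_
  simp only [Finset.mem_erase]
  tauto

/-- The monic polynomial with the roots `b μ`, `μ ∈ s`. -/
def rootPoly (s : Finset ι) (b : ι → ℂ) : ℂ[X] := ∏ μ ∈ s, (X - C (b μ))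

lemma rootPoly_monic (s : Finset ι) (b : ι → ℂ) : (rootPoly s b).Monic :=
  monic_prod_of_monic _ _ fun _ _ ↦ monic_X_sub_C _

lemma natDegree_rootPoly (s : Finset ι) (b : ι → ℂ) : (rootPoly s b).natDegree = s.card := by
  rw [rootPoly, natDegree_prod_of_monic _ _ fun _ _ ↦ monic_X_sub_C _]
  simp

lemma rootPoly_eq_mul {s : Finset ι} (b : ι → ℂ) {μ : ι} (hμ : μ ∈ s) :
    (X - C (b μ)) * rootPoly (s.erase μ) b = rootPoly s b :=
  Finset.mul_prod_erase s _ hμ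

lemma X_mul_rootPoly_erase {s : Finset ι} (b : ι → ℂ) {μ : ι} (hμ : μ ∈ s) :
    X * rootPoly (s.erase μ) b = rootPoly s b + C (b μ) * rootPoly (s.erase μ) b := by
  rw [← rootPoly_eq_mul b hμ]; ring

lemma derivative_rootPoly (s : Finset ι) (b : ι → ℂ) :
    derivative (rootPoly s b) = ∑ μ ∈ s, rootPoly (s.erase μ) b := by
  rw [rootPoly, derivative_prod_finset]
  simp [rootPoly]

/-- Partial fractions: omitting `μ` or `ν` leaves the common factor times `X - b ν` or `X - b μ`,
and these differ by the constant `b μ - b ν`. -/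
lemma rootPoly_erase_erase {s : Finset ι} {b : ι → ℂ} (hb : Set.InjOn b s) {μ ν : ι}
    (hμ : μ ∈ s) (hν : ν ∈ s.erase μ) :
    rootPoly ((s.erase μ).erase ν) b =
      C (1 / (b μ - b ν)) * (rootPoly (s.erase μ) b - rootPoly (s.erase ν) b) := by
  have hν' := Finset.mem_erase.mp hν
  have hμ' : μ ∈ s.erase ν := Finset.mem_erase.mpr ⟨hν'.1.symm, hμ⟩
  have hne : b μ - b ν ≠ 0 := sub_ne_zero.mpr fun h ↦ hν'.1 (hb hν'.2 hμ h.symm)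
  have e1 := rootPoly_eq_mul b hν
  have e2 := rootPoly_eq_mul b hμ'
  rw [Finset.erase_right_comm] at e2
  rw [← e1, ← e2]
  have : C (1 / (b μ - b ν)) * (C (b μ) - C (b ν)) = 1 := by
    rw [← C_sub, ← C_mul, one_div_mul_cancel hne, C_1]
  linear_combination -rootPoly ((s.erase μ).erase ν) b * this

lemma eval_rootPoly_erase_ne {s : Finset ι} {b : ι → ℂ} {μ ν : ι} (hμ : μ ∈ s) (h : μ ≠ ν) :
    (rootPoly (s.erase ν) b).eval (b μ) = 0 := by
  rw [rootPoly, eval_prod]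
  exact Finset.prod_eq_zero (Finset.mem_erase.mpr ⟨h, hμ⟩) (by simp)

lemma eval_rootPoly_erase_self {s : Finset ι} {b : ι → ℂ} (hb : Set.InjOn b s) {μ : ι}
    (hμ : μ ∈ s) : (rootPoly (s.erase μ) b).eval (b μ) ≠ 0 := by
  rw [rootPoly, eval_prod]
  refine Finset.prod_ne_zero_iff.mpr fun ν hν ↦ ?_
  have hν' := Finset.mem_erase.mp hν
  simpa using sub_ne_zero.mpr fun h ↦ hν'.1 (hb hν'.2 hμ h.symm)

/-- For distinct roots these polynomials are the Lagrange basis up to nonzero factors; evaluation at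
`b μ` isolates one coefficient. -/
lemma eq_zero_of_sum_rootPoly_erase {s : Finset ι} {b v : ι → ℂ} (hb : Set.InjOn b s)
    (h : ∑ μ ∈ s, C (v μ) * rootPoly (s.erase μ) b = 0) {μ : ι} (hμ : μ ∈ s) : v μ = 0 := by
  have := congrArg (eval (b μ)) h
  rw [eval_finsetSum, Finset.sum_eq_single_of_mem μ hμ] at this
  · simpa [eval_rootPoly_erase_self hb hμ] using this
  · intro ν _ hne
    rw [eval_mul, eval_rootPoly_erase_ne hμ hne.symm, mul_zero]

/-- The differential operator `P ↦ X D²P - 2 w DP + 2 κ (X DP - k P)` of confluent hypergeometric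
type; its monic polynomial solutions of degree `k` are scaled Laguerre polynomials. -/
def laguerreOp (w κ : ℂ) (k : ℕ) : ℂ[X] →ₗ[ℂ] ℂ[X] where
  toFun P := X * derivative (derivative P) - C (2 * w) * derivative P
    + C (2 * κ) * (X * derivative P - C (k : ℂ) * P)
  map_add' P Q := by simp only [map_add]; ring
  map_smul' a P := by simp only [smul_eq_C_mul, derivative_C_mul, RingHom.id_apply]; ring

lemma laguerreOp_apply (w κ : ℂ) (k : ℕ) (P : ℂ[X]) :
    laguerreOp w κ k P = X * derivative (derivative P) - C (2 * w) * derivative P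
    + C (2 * κ) * (X * derivative P - C (k : ℂ) * P) := rfl

lemma coeff_X_mul_derivative (P : ℂ[X]) (m : ℕ) :
    (X * derivative P).coeff m = m * P.coeff m := by
  cases m with
  | zero => simp
  | succ m => rw [coeff_X_mul, coeff_derivative]; push_cast; ring

lemma coeff_laguerreOp (w κ : ℂ) (k : ℕ) (P : ℂ[X]) (m : ℕ) :
    (laguerreOp w κ k P).coeff m =
      (m + 1) * (m - 2 * w) * P.coeff (m + 1) + 2 * κ * (m - k) * P.coeff m := by
  rw [laguerreOp_apply, coeff_add, coeff_sub, coeff_X_mul_derivative, coeff_C_mul, coeff_C_mul,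
    coeff_sub, coeff_X_mul_derivative, coeff_C_mul, coeff_derivative]
  ring

/-- The sum `w / b_μ - ∑_{ν ≠ μ} 1 / (b_μ - b_ν)` of the polar parts of the Bethe equations
of a cluster `s`. -/
def bethe (s : Finset ι) (w : ℂ) (b : ι → ℂ) (μ : ι) : ℂ :=
  w / b μ - ∑ ν ∈ s.erase μ, 1 / (b μ - b ν)

/-- The derivative of `bethe` in the direction `v`. -/
def betheDeriv (s : Finset ι) (w : ℂ) (b v : ι → ℂ) (μ : ι) : ℂ :=
  -w / b μ ^ 2 * v μ + ∑ ν ∈ s.erase μ, (v μ - v ν) / (b μ - b ν) ^ 2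

/-- Stieltjes' identity. The second derivative is a sum over ordered pairs of roots; splitting each
term by partial fractions and exchanging the two indices collects the pair interactions. The
coefficients in the Lagrange basis are the defects of the Bethe equations, so the differential
equation holds exactly when all the Bethe sums equal `κ`. -/
lemma laguerreOp_rootPoly {s : Finset ι} {w κ : ℂ} {b : ι → ℂ} (hb : Set.InjOn b s)
    (h0 : ∀ μ ∈ s, b μ ≠ 0) :
    laguerreOp w κ s.card (rootPoly s b) =
      ∑ μ ∈ s, C (-2 * b μ * (bethe s w b μ - κ)) * rootPoly (s.erase μ) b := by
  have e1 : X * derivative (rootPoly s b) - C (s.card : ℂ) * rootPoly s b =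
      ∑ μ ∈ s, C (b μ) * rootPoly (s.erase μ) b := by
    rw [derivative_rootPoly, Finset.mul_sum,
      Finset.sum_congr rfl fun μ hμ ↦ X_mul_rootPoly_erase b hμ, Finset.sum_add_distrib]
    simp
  have e2 : X * derivative (derivative (rootPoly s b)) =
      ∑ μ ∈ s, C (2 * b μ * ∑ ν ∈ s.erase μ, 1 / (b μ - b ν)) * rootPoly (s.erase μ) b := by
    have h1 : X * derivative (derivative (rootPoly s b)) = ∑ μ ∈ s, ∑ ν ∈ s.erase μ,
        (C (1 / (b μ - b ν) * b μ) * rootPoly (s.erase μ) b -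
          C (1 / (b μ - b ν) * b ν) * rootPoly (s.erase ν) b) := by
      rw [derivative_rootPoly, derivative_sum, Finset.mul_sum]
      refine Finset.sum_congr rfl fun μ hμ ↦ ?_
      rw [derivative_rootPoly, Finset.mul_sum]
      refine Finset.sum_congr rfl fun ν hν ↦ ?_
      rw [rootPoly_erase_erase hb hμ hν]
      have a1 := X_mul_rootPoly_erase b hμ
      have a2 := X_mul_rootPoly_erase b (Finset.mem_of_mem_erase hν)
      simp only [C_mul]
      linear_combination C (1 / (b μ - b ν)) * (a1 - a2)
    rw [h1]
    simp only [Finset.sum_sub_distrib]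
    rw [sum_erase_comm s fun μ ν ↦ C (1 / (b μ - b ν) * b ν) * rootPoly (s.erase ν) b,
      ← Finset.sum_sub_distrib]
    refine Finset.sum_congr rfl fun μ hμ ↦ ?_
    rw [← Finset.sum_sub_distrib, Finset.mul_sum, map_sum, Finset.sum_mul]
    refine Finset.sum_congr rfl fun ν hν ↦ ?_
    rw [← sub_mul, ← C_sub]
    congr 2
    rw [← neg_sub (b μ) (b ν), one_div_neg_eq_neg_one_div]
    ring
  rw [laguerreOp_apply, e1, e2, derivative_rootPoly, Finset.mul_sum, Finset.mul_sum,
    ← Finset.sum_sub_distrib, ← Finset.sum_add_distrib]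
  refine Finset.sum_congr rfl fun μ hμ ↦ ?_
  rw [← mul_assoc, ← C_mul, ← sub_mul, ← add_mul, ← C_sub, ← C_add]
  congr 2
  have := h0 μ hμ
  rw [bethe]
  field_simp
  ring

lemma bethe_erase {s : Finset ι} {w : ℂ} {b : ι → ℂ} {μ ν : ι} (hμ : μ ∈ s)
    (hν : ν ∈ s.erase μ) : bethe (s.erase μ) w b ν = bethe s w b ν + 1 / (b ν - b μ) := by
  have hν' := Finset.mem_erase.mp hν
  have hμ' : μ ∈ s.erase ν := Finset.mem_erase.mpr ⟨hν'.1.symm, hμ⟩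
  rw [bethe, bethe, ← Finset.add_sum_erase _ _ hμ', Finset.erase_right_comm]
  ring

/-- The argument on the left is, up to sign, the derivative of the root polynomial in the direction
`v`, so this is the derivative of `laguerreOp_rootPoly` at a solution. It is proved algebraically,
by applying that identity to the clusters with one point removed. -/
lemma laguerreOp_sum_rootPoly_erase {s : Finset ι} {w κ : ℂ} {b v : ι → ℂ} (hb : Set.InjOn b s)
    (h0 : ∀ μ ∈ s, b μ ≠ 0) (hκ : ∀ μ ∈ s, bethe s w b μ = κ) :
    laguerreOp w κ s.card (∑ μ ∈ s, C (v μ) * rootPoly (s.erase μ) b) =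
      ∑ μ ∈ s, C (2 * b μ * betheDeriv s w b v μ) * rootPoly (s.erase μ) b := by
  have e (μ : ι) (hμ : μ ∈ s) : laguerreOp w κ s.card (rootPoly (s.erase μ) b) =
      ∑ ν ∈ s.erase μ, C (2 * b ν / (b μ - b ν) ^ 2) *
        (rootPoly (s.erase μ) b - rootPoly (s.erase ν) b) -
      C (2 * κ) * rootPoly (s.erase μ) b := by
    have h1 := laguerreOp_rootPoly (w := w) (κ := κ) (hb.mono (Finset.erase_subset μ s))
      fun ν hν ↦ h0 ν (Finset.mem_of_mem_erase hν)
    -- The operator for `s.card`, not `s.card - 1`, acts on a polynomial of degree one less; the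
    -- mismatch is the term `2 κ`.
    have h2 : laguerreOp w κ s.card (rootPoly (s.erase μ) b) =
        laguerreOp w κ (s.erase μ).card (rootPoly (s.erase μ) b) -
          C (2 * κ) * rootPoly (s.erase μ) b := by
      rw [laguerreOp_apply, laguerreOp_apply, Finset.card_erase_of_mem hμ,
        Nat.cast_sub (Finset.card_pos.mpr ⟨μ, hμ⟩)]
      simp only [Nat.cast_one, C_sub, C_1]
      ring
    rw [h2, h1]
    congr 1
    refine Finset.sum_congr rfl fun ν hν ↦ ?_
    have hν' := Finset.mem_erase.mp hν
    have hne : b μ - b ν ≠ 0 := sub_ne_zero.mpr fun h ↦ hν'.1 (hb hν'.2 hμ h.symm)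
    rw [bethe_erase hμ hν, hκ ν hν'.2, rootPoly_erase_erase hb hμ hν, ← mul_assoc, ← C_mul]
    congr 2
    rw [← neg_sub (b μ) (b ν)]
    field_simp
    ring
  have hlin (μ : ι) (P : ℂ[X]) : laguerreOp w κ s.card (C (v μ) * P) =
      C (v μ) * laguerreOp w κ s.card P := by
    rw [← smul_eq_C_mul, map_smul, smul_eq_C_mul]
  rw [map_sum, Finset.sum_congr rfl fun μ hμ ↦ by rw [hlin, e μ hμ]]
  have h3 : ∑ μ ∈ s, C (v μ) * (∑ ν ∈ s.erase μ, C (2 * b ν / (b μ - b ν) ^ 2) *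
        (rootPoly (s.erase μ) b - rootPoly (s.erase ν) b) -
      C (2 * κ) * rootPoly (s.erase μ) b) =
      ∑ μ ∈ s, (∑ ν ∈ s.erase μ, C (v μ * (2 * b ν / (b μ - b ν) ^ 2)) * rootPoly (s.erase μ) b
        - C (v μ * (2 * κ)) * rootPoly (s.erase μ) b) -
      ∑ μ ∈ s, ∑ ν ∈ s.erase μ, C (v μ * (2 * b ν / (b μ - b ν) ^ 2)) *
        rootPoly (s.erase ν) b := by
    rw [← Finset.sum_sub_distrib]
    refine Finset.sum_congr rfl fun μ hμ ↦ ?_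
    rw [mul_sub, Finset.mul_sum, sub_right_comm, ← Finset.sum_sub_distrib]
    congr 1
    · refine Finset.sum_congr rfl fun ν hν ↦ ?_
      rw [C_mul]; ring
    · rw [C_mul (a := v μ), mul_assoc]
  rw [h3, sum_erase_comm s fun μ ν ↦ C (v μ * (2 * b ν / (b μ - b ν) ^ 2)) *
        rootPoly (s.erase ν) b, ← Finset.sum_sub_distrib]
  refine Finset.sum_congr rfl fun μ hμ ↦ ?_
  rw [← Finset.sum_mul, ← Finset.sum_mul, ← sub_mul, ← sub_mul, ← map_sum, ← map_sum, ← C_sub,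
    ← C_sub]
  congr 2
  have hμ0 := h0 μ hμ
  have hκ' := hκ μ hμ
  rw [bethe] at hκ'
  rw [← hκ', betheDeriv]
  have hw : v μ * (2 * (w / b μ - ∑ ν ∈ s.erase μ, 1 / (b μ - b ν))) =
      2 * (w / b μ) * v μ - ∑ ν ∈ s.erase μ, 2 * v μ / (b μ - b ν) := by
    rw [mul_sub, mul_sub, Finset.mul_sum, Finset.mul_sum]
    congr 1
    · ring
    · exact Finset.sum_congr rfl fun ν _ ↦ by ring
  have hM : 2 * b μ * (-w / b μ ^ 2 * v μ + ∑ ν ∈ s.erase μ, (v μ - v ν) / (b μ - b ν) ^ 2) =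
      ∑ ν ∈ s.erase μ, 2 * b μ * (v μ - v ν) / (b μ - b ν) ^ 2 - 2 * (w / b μ) * v μ := by
    rw [mul_add, Finset.mul_sum]
    rw [add_comm, sub_eq_add_neg]
    congr 1
    · exact Finset.sum_congr rfl fun ν _ ↦ by ring
    · field_simp
  rw [hw, hM]
  have : ∑ ν ∈ s.erase μ, v μ * (2 * b ν / (b μ - b ν) ^ 2) + 
      ∑ ν ∈ s.erase μ, 2 * v μ / (b μ - b ν) - 
      ∑ ν ∈ s.erase μ, v ν * (2 * b μ / (b ν - b μ) ^ 2) = 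
      ∑ ν ∈ s.erase μ, 2 * b μ * (v μ - v ν) / (b μ - b ν) ^ 2 := by
    rw [← Finset.sum_add_distrib, ← Finset.sum_sub_distrib]
    refine Finset.sum_congr rfl fun ν hν ↦ ?_
    have hν' := Finset.mem_erase.mp hν
    have hne : b μ - b ν ≠ 0 := sub_ne_zero.mpr fun h ↦ hν'.1 (hb hν'.2 hμ h.symm)
    rw [← neg_sub (b μ) (b ν)]
    field_simp
    ring
  linear_combination this

/-- In the two-term recursion for the coefficients the factor `2 * κ * (m - k)` is nonzero for `m <
k`, so each coefficient is determined by the one above it. -/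
lemma eq_zero_of_laguerreOp_eq_zero {w κ : ℂ} {k : ℕ} (hκ : κ ≠ 0) {P : ℂ[X]}
    (hP : laguerreOp w κ k P = 0) (hdeg : P.natDegree ≤ k) (hk : P.coeff k = 0) : P = 0 := by
  have key (j : ℕ) (hj : j ≤ k) : P.coeff (k - j) = 0 := by
    induction j with
    | zero => exact hk
    | succ j ih =>
      have h1 := congrArg (coeff · (k - (j + 1))) hP
      simp only [coeff_laguerreOp, coeff_zero] at h1
      rw [show k - (j + 1) + 1 = k - j by omega, ih (by omega), mul_zero, zero_add] at h1
      have h2 : ((k - (j + 1) : ℕ) : ℂ) - k ≠ 0 := by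
        rw [sub_ne_zero]
        exact_mod_cast (by omega : k - (j + 1) ≠ k)
      simpa [hκ, h2] using h1
  ext m
  rcases le_or_gt m k with hm | hm
  · simpa [Nat.sub_sub_self hm] using key (k - m) (by omega)
  · simpa using coeff_eq_zero_of_natDegree_lt (hdeg.trans_lt hm)

lemma natDegree_sum_rootPoly_erase_lt {s : Finset ι} (hs : s.Nonempty) (b v : ι → ℂ) :
    (∑ μ ∈ s, C (v μ) * rootPoly (s.erase μ) b).natDegree < s.card := by
  have hc := hs.card_pos
  refine (natDegree_sum_le_of_forall_le (n := s.card - 1) _ _ fun μ hμ ↦ ?_).trans_lt (by omega)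
  refine (natDegree_C_mul_le _ _).trans ?_
  rw [natDegree_rootPoly, Finset.card_erase_of_mem hμ]

/-- A null direction gives a tangent polynomial in the kernel of the operator, of degree below the
number of roots; such a polynomial vanishes. -/
lemma betheDeriv_injective {s : Finset ι} {w κ : ℂ} {b v : ι → ℂ} (hb : Set.InjOn b s)
    (h0 : ∀ μ ∈ s, b μ ≠ 0) (hκ0 : κ ≠ 0) (hκ : ∀ μ ∈ s, bethe s w b μ = κ)
    (hv : ∀ μ ∈ s, betheDeriv s w b v μ = 0) : ∀ μ ∈ s, v μ = 0 := by
  intro μ hμ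
  refine eq_zero_of_sum_rootPoly_erase hb ?_ hμ
  have hlt := natDegree_sum_rootPoly_erase_lt ⟨μ, hμ⟩ b v
  refine eq_zero_of_laguerreOp_eq_zero hκ0 (w := w) (k := s.card) ?_ hlt.le
    (coeff_eq_zero_of_natDegree_lt hlt)
  rw [laguerreOp_sum_rootPoly_erase hb h0 hκ]
  exact Finset.sum_eq_zero fun ν hν ↦ by rw [hv ν hν]; simp

/-- Euler's identity for a function homogeneous of degree `-1`. -/
lemma betheDeriv_self {s : Finset ι} {w : ℂ} {b : ι → ℂ} (hb : Set.InjOn b s)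
    {μ : ι} (hμ : μ ∈ s) (h0 : b μ ≠ 0) : betheDeriv s w b b μ = -bethe s w b μ := by
  rw [betheDeriv, bethe, neg_sub, sub_eq_add_neg, add_comm]
  congr 1
  · refine Finset.sum_congr rfl fun ν hν ↦ ?_
    have hν' := Finset.mem_erase.mp hν
    have hne : b μ - b ν ≠ 0 := sub_ne_zero.mpr fun h ↦ hν'.1 (hb hν'.2 hμ h.symm)
    field_simp
  · field_simp

lemma bethe_eq_of_laguerreOp_eq_zero {s : Finset ι} {w κ : ℂ} {b : ι → ℂ} (hb : Set.InjOn b s)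
    (h0 : ∀ μ ∈ s, b μ ≠ 0) (h : laguerreOp w κ s.card (rootPoly s b) = 0) :
    ∀ μ ∈ s, bethe s w b μ = κ := by
  intro μ hμ
  rw [laguerreOp_rootPoly hb h0] at h
  have := eq_zero_of_sum_rootPoly_erase (v := fun μ ↦ -2 * b μ * (bethe s w b μ - κ)) hb h hμ
  simpa [h0 μ hμ, sub_eq_zero] using this

lemma laguerreOp_eq_zero_of_bethe_eq {s : Finset ι} {w κ : ℂ} {b : ι → ℂ} (hb : Set.InjOn b s)
    (h0 : ∀ μ ∈ s, b μ ≠ 0) (h : ∀ μ ∈ s, bethe s w b μ = κ) :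
    laguerreOp w κ s.card (rootPoly s b) = 0 := by
  rw [laguerreOp_rootPoly hb h0]
  exact Finset.sum_eq_zero fun ν hν ↦ by rw [h ν hν]; simp

/-- At a double root different from `0` the leading coefficient `X` of the equation is invertible.
The differentiated equations then force every derivative to vanish there, which is impossible for a
nonzero polynomial. -/
lemma injOn_of_laguerreOp_eq_zero {s : Finset ι} {w κ : ℂ} {b : ι → ℂ}
    (h0 : ∀ μ ∈ s, b μ ≠ 0) (h : laguerreOp w κ s.card (rootPoly s b) = 0) : Set.InjOn b s := by
  intro μ hμ ν hν hμν
  by_contra hne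
  set P := rootPoly s b with hP
  set k := s.card
  have hP0 : P ≠ 0 := (rootPoly_monic s b).ne_zero
  have hode (m : ℕ) : X * derivative^[m + 2] P + (C (m - 2 * w) + C (2 * κ) * X) *
      derivative^[m + 1] P + C (2 * κ * (m - k)) * derivative^[m] P = 0 := by
    induction m with
    | zero =>
      rw [← h, laguerreOp_apply]
      simp only [Function.iterate_succ, Function.iterate_zero, Function.comp_apply, id,
        C_mul, C_sub, CharP.cast_eq_zero, C_0]
      ring
    | succ m ih =>
      have := congrArg derivative ih
      simp only [derivative_add, derivative_mul, derivative_C, derivative_X, derivative_zero,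
        ← Function.iterate_succ_apply' derivative] at this
      rw [← this]
      simp only [Nat.succ_eq_add_one, C_mul, C_sub, Nat.cast_add, Nat.cast_one, C_add, C_1]
      ring
  have hroot (m : ℕ) : (derivative^[m] P).IsRoot (b μ) ∧ (derivative^[m + 1] P).IsRoot (b μ) := by
    induction m with
    | zero =>
      constructor
      · simp only [Function.iterate_zero, id, IsRoot.def, hP, rootPoly, eval_prod]
        exact Finset.prod_eq_zero hμ (by simp)
      · simp only [Function.iterate_succ, Function.iterate_zero, Function.comp_apply, id,
          IsRoot.def, hP, derivative_rootPoly, eval_finsetSum]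
        refine Finset.sum_eq_zero fun ρ _ ↦ ?_
        by_cases hρ : μ = ρ
        · subst hρ
          rw [hμν]
          exact eval_rootPoly_erase_ne hν (Ne.symm hne)
        · exact eval_rootPoly_erase_ne hμ hρ
    | succ m ih =>
      refine ⟨ih.2, ?_⟩
      have := congrArg (eval (b μ)) (hode m)
      simp only [eval_add, eval_mul, eval_X, ih.1.eq_zero, ih.2.eq_zero, mul_zero, add_zero,
        eval_zero, mul_eq_zero, h0 μ hμ, false_or] at this
      exact this
  have h1 := (lt_rootMultiplicity_iff_isRoot_iterate_derivative (n := P.natDegree) hP0).mpr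
    fun m _ ↦ (hroot m).1
  have h2 : P.rootMultiplicity (b μ) ≤ P.natDegree := by
    rw [← count_roots]
    exact (Multiset.count_le_card _ _).trans (card_roots' P)
  omega

/-- Admissibility says that `m - 2 * w` never vanishes for `m < k`, so the recursion carries
nonvanishing from the top coefficient down to the constant one. -/
lemma coeff_ne_zero_of_laguerreOp_eq_zero {w κ : ℂ} {k : ℕ}
    (hadm : ∀ l : ℕ, 2 * w = l → k ≤ l) {P : ℂ[X]} (h : laguerreOp w κ k P = 0)
    (hk : P.coeff k ≠ 0) : P.coeff 0 ≠ 0 := by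
  have key (j : ℕ) (hj : j ≤ k) : P.coeff (k - j) ≠ 0 := by
    induction j with
    | zero => exact hk
    | succ j ih =>
      have h1 := congrArg (coeff · (k - (j + 1))) h
      simp only [coeff_laguerreOp, coeff_zero] at h1
      rw [show k - (j + 1) + 1 = k - j by omega] at h1
      intro h2
      rw [h2, mul_zero, add_zero] at h1
      have h3 : ((k - (j + 1) : ℕ) : ℂ) + 1 ≠ 0 := Nat.cast_add_one_ne_zero _
      have h4 : ((k - (j + 1) : ℕ) : ℂ) - 2 * w ≠ 0 := by
        intro h5
        have := hadm (k - (j + 1)) (sub_eq_zero.mp h5).symm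
        omega
      exact ih (by omega) (by simpa [h3, h4] using h1)
  simpa using key k le_rfl

lemma root_ne_zero_of_laguerreOp_eq_zero {s : Finset ι} {w κ : ℂ} {b : ι → ℂ}
    (hadm : ∀ l : ℕ, 2 * w = l → s.card ≤ l)
    (h : laguerreOp w κ s.card (rootPoly s b) = 0) : ∀ μ ∈ s, b μ ≠ 0 := by
  intro μ hμ h0
  refine coeff_ne_zero_of_laguerreOp_eq_zero hadm h ?_ ?_
  · rw [← natDegree_rootPoly s b, coeff_natDegree, (rootPoly_monic s b).leadingCoeff]
    exact one_ne_zero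
  · rw [coeff_zero_eq_eval_zero, rootPoly, eval_prod]
    exact Finset.prod_eq_zero hμ (by simp [h0])

/-- For `κ = 0` the coefficient of degree `s.card - 1` would give `2 * w = s.card - 1`, which
admissibility excludes. -/
lemma bethe_ne_zero {s : Finset ι} (hs : s.Nonempty) {w κ : ℂ} {b : ι → ℂ}
    (hadm : ∀ l : ℕ, 2 * w = l → s.card ≤ l) (hb : Set.InjOn b s)
    (h0 : ∀ μ ∈ s, b μ ≠ 0) (h : ∀ μ ∈ s, bethe s w b μ = κ) : κ ≠ 0 := by
  rintro rfl
  have hc := hs.card_pos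
  have h1 := congrArg (coeff · (s.card - 1)) (laguerreOp_eq_zero_of_bethe_eq hb h0 h)
  simp only [coeff_laguerreOp, coeff_zero] at h1
  rw [Nat.sub_add_cancel hc, ← natDegree_rootPoly s b, coeff_natDegree,
    (rootPoly_monic s b).leadingCoeff, natDegree_rootPoly] at h1
  have h3 : ((s.card - 1 : ℕ) : ℂ) + 1 ≠ 0 := Nat.cast_add_one_ne_zero _
  have h4 : ((s.card - 1 : ℕ) : ℂ) - 2 * w = 0 := by simpa [h3] using h1
  have := hadm _ (sub_eq_zero.mp h4).symm
  omega

end RootPolynomial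

/-! ### Scaled Laguerre polynomials as solutions of the differential equation. -/

section Laguerre

/-- The scaled Laguerre polynomial `L_k^{(-2w-1)}(-2X/c)`. -/
def scaledLaguerre (w c : ℂ) (k : ℕ) : ℂ[X] :=
  (laguerre k (-2 * w - 1)).comp (C (-2 / c) * X)

lemma coeff_laguerre (k : ℕ) (α : ℂ) (m : ℕ) : (laguerre k α).coeff m =
    if m ≤ k then (∏ j ∈ Finset.range (k - m), ((k : ℂ) + α - j)) / (Nat.factorial (k - m) : ℂ)
      * ((-1) ^ m / (Nat.factorial m : ℂ)) else 0 := by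
  rw [laguerre, finsetSum_coeff]
  simp only [coeff_C_mul, coeff_X_pow]
  simp

lemma coeff_scaledLaguerre {w c : ℂ} {k m : ℕ} (hm : m ≤ k) : (scaledLaguerre w c k).coeff m =
    (∏ j ∈ Finset.range (k - m), ((k : ℂ) + (-2 * w - 1) - j)) / (Nat.factorial (k - m) : ℂ) *
      ((2 / c) ^ m / (Nat.factorial m : ℂ)) := by
  rw [scaledLaguerre, comp_C_mul_X_coeff, coeff_laguerre, if_pos hm]
  have : ((-1 : ℂ)) ^ m * (-2 / c) ^ m = (2 / c) ^ m := by rw [← mul_pow]; congr 1; ring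
  rw [← this]
  ring

lemma natDegree_scaledLaguerre_le (w c : ℂ) (k : ℕ) : (scaledLaguerre w c k).natDegree ≤ k := by
  rw [natDegree_le_iff_coeff_eq_zero]
  intro m hm
  rw [scaledLaguerre, comp_C_mul_X_coeff, coeff_laguerre, if_neg (by omega), zero_mul]

lemma coeff_scaledLaguerre_top (w c : ℂ) (k : ℕ) :
    (scaledLaguerre w c k).coeff k = (2 / c) ^ k / (Nat.factorial k : ℂ) := by
  rw [coeff_scaledLaguerre le_rfl]; simp

lemma laguerreOp_scaledLaguerre (w c : ℂ) (k : ℕ) :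
    laguerreOp w (1 / c) k (scaledLaguerre w c k) = 0 := by
  ext m
  rw [coeff_laguerreOp, coeff_zero]
  rcases lt_trichotomy m k with hm | rfl | hm
  · obtain ⟨d, rfl⟩ : ∃ d, k = m + 1 + d := ⟨k - m - 1, by omega⟩
    rw [coeff_scaledLaguerre (by omega), coeff_scaledLaguerre (by omega)]
    rw [show m + 1 + d - m = d + 1 by omega, show m + 1 + d - (m + 1) = d by omega,
      Finset.prod_range_succ, Nat.factorial_succ, Nat.factorial_succ]
    have h1 : (Nat.factorial m : ℂ) ≠ 0 := by exact_mod_cast Nat.factorial_ne_zero _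
    have h2 : (Nat.factorial d : ℂ) ≠ 0 := by exact_mod_cast Nat.factorial_ne_zero _
    have h3 : (m : ℂ) + 1 ≠ 0 := Nat.cast_add_one_ne_zero _
    have h4 : (d : ℂ) + 1 ≠ 0 := Nat.cast_add_one_ne_zero _
    -- With `2 / c` as an indeterminate, no case distinction on `c = 0` is needed.
    obtain ⟨z, hz⟩ : ∃ z, z = 2 / c := ⟨_, rfl⟩
    rw [show 1 / c = z / 2 by rw [hz]; ring, ← hz]
    push_cast
    field_simp
    ring
  · rw [coeff_eq_zero_of_natDegree_lt ((natDegree_scaledLaguerre_le w c m).trans_lt m.lt_succ_self)]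
    ring
  · rw [coeff_eq_zero_of_natDegree_lt ((natDegree_scaledLaguerre_le w c k).trans_lt hm),
      coeff_eq_zero_of_natDegree_lt ((natDegree_scaledLaguerre_le w c k).trans_lt (by omega))]
    ring

/-- A solution of degree at most `k` is determined by its coefficient of degree `k`, so comparing
leading coefficients suffices. -/
lemma scaledLaguerre_eq_iff {w c : ℂ} (hc : c ≠ 0) {k : ℕ} {P : ℂ[X]} (hP : P.Monic)
    (hdeg : P.natDegree = k) :
    scaledLaguerre w c k = C ((2 / c) ^ k / (Nat.factorial k : ℂ)) * P ↔
      laguerreOp w (1 / c) k P = 0 := by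
  have hlead : (2 / c) ^ k / (Nat.factorial k : ℂ) ≠ 0 :=
    div_ne_zero (pow_ne_zero _ (div_ne_zero two_ne_zero hc))
      (by exact_mod_cast Nat.factorial_ne_zero _)
  have hlin (a : ℂ) (Q : ℂ[X]) : laguerreOp w (1 / c) k (C a * Q) =
      C a * laguerreOp w (1 / c) k Q := by
    rw [← smul_eq_C_mul, map_smul, smul_eq_C_mul]
  constructor
  · intro h
    have := laguerreOp_scaledLaguerre w c k
    rw [h, hlin] at this
    simpa [hlead] using this
  · intro h
    rw [← sub_eq_zero]
    refine eq_zero_of_laguerreOp_eq_zero (w := w) (k := k) (one_div_ne_zero hc) ?_ ?_ ?_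
    · rw [map_sub, hlin, h, laguerreOp_scaledLaguerre, mul_zero, sub_zero]
    · exact (natDegree_sub_le _ _).trans (max_le (natDegree_scaledLaguerre_le _ _ _)
        ((natDegree_C_mul_le _ _).trans hdeg.le))
    · rw [coeff_sub, coeff_scaledLaguerre_top, coeff_C_mul]
      have : P.coeff k = 1 := by rw [← hdeg, coeff_natDegree, hP.leadingCoeff]
      rw [this, mul_one, sub_self]

end Laguerre

/-! ### Laguerre systems of all blocks together. -/

section Blocks
variable {r n : ℕ} {w : Fin r → ℂ} {k : Fin r → ℕ} {hk : ∑ i, k i = n}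

/-- The indices which belong to the `j`-th block. -/
def blockSet (k : Fin r → ℕ) (hk : ∑ i, k i = n) (j : Fin r) : Finset (Fin n) :=
  Finset.univ.filter fun μ ↦ block k hk μ = j

@[simp] lemma mem_blockSet {j : Fin r} {μ : Fin n} : μ ∈ blockSet k hk j ↔ block k hk μ = j := by
  simp [blockSet]

lemma card_blockSet (j : Fin r) : (blockSet k hk j).card = k j := by
  subst hk
  have h := Finset.card_bij (s := (Finset.univ : Finset (Fin (k j))))
    (t := blockSet k rfl j) (fun i _ ↦ finSigmaFinEquiv ⟨j, i⟩) ?_ ?_ ?_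
  · simpa using h.symm
  · intro i _
    simp [block]
  · intro i _ i' _ h
    simpa using h
  · intro μ hμ
    have hμ' : (finSigmaFinEquiv.symm μ).1 = j := by simpa [block] using hμ
    obtain ⟨⟨j', i⟩, rfl⟩ := finSigmaFinEquiv.surjective μ
    simp only [Equiv.symm_apply_apply] at hμ'
    subst hμ'
    exact ⟨i, Finset.mem_univ _, rfl⟩

lemma exists_rootPoly_eq {ι : Type*} [DecidableEq ι] (s : Finset ι) {P : ℂ[X]} (hP : P.Monic)
    (hdeg : P.natDegree = s.card) : ∃ b : ι → ℂ, rootPoly s b = P := by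
  induction s using Finset.induction_on generalizing P with
  | empty =>
    refine ⟨0, ?_⟩
    rw [rootPoly, Finset.prod_empty, hP.natDegree_eq_zero.mp (by simpa using hdeg)]
  | insert a s ha ih =>
    rw [Finset.card_insert_of_notMem ha] at hdeg
    obtain ⟨x, hx⟩ := IsAlgClosed.exists_root P (by
      rw [Polynomial.degree_eq_natDegree hP.ne_zero, hdeg]
      exact_mod_cast Nat.succ_ne_zero s.card)
    obtain ⟨Q, rfl⟩ := dvd_iff_isRoot.mpr hx
    have hQ : Q.Monic := (monic_X_sub_C x).of_mul_monic_left hP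
    obtain ⟨b, rfl⟩ := ih hQ (by
      rw [(monic_X_sub_C x).natDegree_mul hQ, natDegree_X_sub_C] at hdeg
      omega)
    refine ⟨Function.update b a x, ?_⟩
    rw [rootPoly, Finset.prod_insert ha, Function.update_self]
    congr 1
    exact Finset.prod_congr rfl fun μ hμ ↦ by
      rw [Function.update_of_ne (by rintro rfl; exact ha hμ)]

lemma isLaguerreSystem_iff {c : ℂ} (hc : c ≠ 0) {b : Fin n → ℂ} :
    IsLaguerreSystem w k hk c b ↔
      ∀ j, laguerreOp (w j) (1 / c) (k j) (rootPoly (blockSet k hk j) b) = 0 := by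
  refine forall_congr' fun j ↦ ?_
  rw [← scaledLaguerre_eq_iff hc (rootPoly_monic _ _) ((natDegree_rootPoly _ _).trans
    (card_blockSet j))]
  rfl

/-- The polar part of the Bethe equation with index `μ` of the arc `p + t b`. -/
def blockBethe (w : Fin r → ℂ) (k : Fin r → ℕ) (hk : ∑ i, k i = n) (b : Fin n → ℂ)
    (μ : Fin n) : ℂ :=
  bethe (blockSet k hk (block k hk μ)) (w (block k hk μ)) b μ

lemma injOn_blockSet {b : Fin n → ℂ}
    (hb : ∀ μ ν, μ ≠ ν → block k hk μ = block k hk ν → b μ ≠ b ν) (j : Fin r) :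
    Set.InjOn b (blockSet k hk j) := by
  intro μ hμ ν hν h
  by_contra hne
  simp only [Finset.mem_coe, mem_blockSet] at hμ hν
  exact hb μ ν hne (hμ.trans hν.symm) h

/-- Admissibility makes the Laguerre roots nonzero, and nonzero roots are simple; only then does the
polynomial equation translate back into Bethe equations. -/
lemma isLaguerreSystem_iff_blockBethe (hadm : Admissible w k) {c : ℂ} (hc : c ≠ 0)
    {b : Fin n → ℂ} :
    IsLaguerreSystem w k hk c b ↔ (∀ μ, b μ ≠ 0) ∧
      (∀ μ ν, μ ≠ ν → block k hk μ = block k hk ν → b μ ≠ b ν) ∧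
      ∀ μ, blockBethe w k hk b μ = 1 / c := by
  rw [isLaguerreSystem_iff hc]
  constructor
  · intro h
    have h' (j : Fin r) : laguerreOp (w j) (1 / c) (blockSet k hk j).card
        (rootPoly (blockSet k hk j) b) = 0 := by rw [card_blockSet]; exact h j
    have h0 (j : Fin r) := root_ne_zero_of_laguerreOp_eq_zero
      (by rw [card_blockSet]; exact hadm j) (h' j)
    have hi (j : Fin r) := injOn_of_laguerreOp_eq_zero (h0 j) (h' j)
    refine ⟨fun μ ↦ h0 _ μ (mem_blockSet.mpr rfl), fun μ ν hne hbl heq ↦ hne ?_, fun μ ↦ ?_⟩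
    · exact hi (block k hk ν) (by simpa using hbl) (by simp) heq
    · exact bethe_eq_of_laguerreOp_eq_zero (hi _) (h0 _) (h' _) μ (mem_blockSet.mpr rfl)
  · rintro ⟨h0, hi, h⟩ j
    have := laguerreOp_eq_zero_of_bethe_eq (w := w j) (injOn_blockSet hi j) (fun μ _ ↦ h0 μ)
      (κ := 1 / c) fun μ hμ ↦ by
        have hj := mem_blockSet.mp hμ
        subst hj
        exact h μ
    rwa [card_blockSet] at this

lemma exists_isLaguerreSystem (w : Fin r → ℂ) (k : Fin r → ℕ) (hk : ∑ i, k i = n) :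
    ∃ b : Fin n → ℂ, IsLaguerreSystem w k hk 1 b := by
  have h1 (j : Fin r) : ∃ b : Fin n → ℂ,
      laguerreOp (w j) (1 / 1) (k j) (rootPoly (blockSet k hk j) b) = 0 := by
    set a : ℂ := (2 / 1) ^ k j / (Nat.factorial (k j) : ℂ) with ha
    have ha0 : a ≠ 0 := div_ne_zero (by norm_num) (by exact_mod_cast Nat.factorial_ne_zero _)
    have hle := natDegree_scaledLaguerre_le (w j) 1 (k j)
    have htop := coeff_scaledLaguerre_top (w j) 1 (k j)
    have hmon : (C a⁻¹ * scaledLaguerre (w j) 1 (k j)).Monic :=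
      monic_of_natDegree_le_of_coeff_eq_one (k j) ((natDegree_C_mul_le _ _).trans hle)
        (by rw [coeff_C_mul, htop, inv_mul_cancel₀ ha0])
    have hdeg : (C a⁻¹ * scaledLaguerre (w j) 1 (k j)).natDegree = k j := by
      refine natDegree_eq_of_le_of_coeff_ne_zero ((natDegree_C_mul_le _ _).trans hle) ?_
      rw [coeff_C_mul, htop, inv_mul_cancel₀ ha0]
      exact one_ne_zero
    obtain ⟨b, hb⟩ := exists_rootPoly_eq (blockSet k hk j) hmon (hdeg.trans (card_blockSet j).symm)
    refine ⟨b, ?_⟩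
    rw [hb, ← scaledLaguerre_eq_iff one_ne_zero hmon hdeg, ← ha, ← mul_assoc, ← C_mul,
      mul_inv_cancel₀ ha0, C_1, one_mul]
  choose b hb using h1
  -- Each block has its own family of roots; the diagonal choice glues them.
  refine ⟨fun μ ↦ b (block k hk μ) μ, (isLaguerreSystem_iff one_ne_zero).mpr fun j ↦ ?_⟩
  rw [← hb j]
  congr 1
  refine Finset.prod_congr rfl fun μ hμ ↦ ?_
  simp only [mem_blockSet.mp hμ]

/-- Both systems have the same root polynomial in each block, so every `b' μ` occurs as some `b ν`
in its block. Distinctness of the `b' μ` makes this matching injective. -/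
lemma exists_perm_of_isLaguerreSystem (hadm : Admissible w k) {c : ℂ} (hc : c ≠ 0)
    {b b' : Fin n → ℂ} (hb : IsLaguerreSystem w k hk c b) (hb' : IsLaguerreSystem w k hk c b') :
    ∃ σ : Equiv.Perm (Fin n), b' = b ∘ σ ∧ ∀ μ, block k hk (σ μ) = block k hk μ := by
  obtain ⟨-, hi', -⟩ := (isLaguerreSystem_iff_blockBethe hadm hc).mp hb'
  have hlead (j : Fin r) : C ((2 / c) ^ k j / (Nat.factorial (k j) : ℂ)) ≠ 0 := by
    rw [Ne, C_eq_zero]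
    exact div_ne_zero (pow_ne_zero _ (div_ne_zero two_ne_zero hc))
      (by exact_mod_cast Nat.factorial_ne_zero _)
  have hP (j : Fin r) : rootPoly (blockSet k hk j) b' = rootPoly (blockSet k hk j) b :=
    mul_left_cancel₀ (hlead j) ((hb' j).symm.trans (hb j))
  have hex (μ : Fin n) : ∃ ν, block k hk ν = block k hk μ ∧ b ν = b' μ := by
    have h1 : (rootPoly (blockSet k hk (block k hk μ)) b').eval (b' μ) = 0 := by
      rw [rootPoly, eval_prod]
      exact Finset.prod_eq_zero (mem_blockSet.mpr (rfl : block k hk μ = _)) (by simp)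
    rw [hP, rootPoly, eval_prod, Finset.prod_eq_zero_iff] at h1
    obtain ⟨ν, hν, h2⟩ := h1
    refine ⟨ν, mem_blockSet.mp hν, ?_⟩
    simp only [eval_sub, eval_X, eval_C] at h2
    exact (sub_eq_zero.mp h2).symm
  choose σ hσ using hex
  have hinj : Function.Injective σ := by
    intro μ ν h
    by_contra hne
    refine hi' μ ν hne ?_ ?_
    · rw [← (hσ μ).1, h, (hσ ν).1]
    · rw [← (hσ μ).2, h, (hσ ν).2]
  refine ⟨Equiv.ofBijective σ (Finite.injective_iff_bijective.mp hinj), ?_, fun μ ↦ (hσ μ).1⟩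
  ext μ
  exact (hσ μ).2.symm

end Blocks

/-! ### Limits of solutions of the rational equations; exclusion of the resonant case. -/

section Compactness
variable {ι Ω : Type*} [DecidableEq ι]

lemma tendsto_eval_rootPoly {l : Filter Ω} {s : Finset ι} {y : Ω → ι → ℂ} {z : ι → ℂ}
    (h : ∀ μ ∈ s, Tendsto (fun x ↦ y x μ) l (𝓝 (z μ))) (t : ℂ) :
    Tendsto (fun x ↦ (rootPoly s (y x)).eval t) l (𝓝 ((rootPoly s z).eval t)) := by
  simp only [rootPoly, eval_prod, eval_sub, eval_X, eval_C]
  exact tendsto_finsetProd _ fun μ hμ ↦ tendsto_const_nhds.sub (h μ hμ)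

lemma tendsto_eval_derivative_rootPoly {l : Filter Ω} {s : Finset ι} {y : Ω → ι → ℂ} {z : ι → ℂ}
    (h : ∀ μ ∈ s, Tendsto (fun x ↦ y x μ) l (𝓝 (z μ))) (t : ℂ) :
    Tendsto (fun x ↦ (derivative (rootPoly s (y x))).eval t) l
      (𝓝 ((derivative (rootPoly s z)).eval t)) := by
  simp only [derivative_rootPoly, eval_finsetSum]
  exact tendsto_finsetSum _ fun μ _ ↦
    tendsto_eval_rootPoly (fun ν hν ↦ h ν (Finset.mem_of_mem_erase hν)) t

lemma tendsto_eval_laguerreOp_rootPoly {l : Filter Ω} {s : Finset ι} {y : Ω → ι → ℂ} {z : ι → ℂ}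
    (h : ∀ μ ∈ s, Tendsto (fun x ↦ y x μ) l (𝓝 (z μ))) (w κ : ℂ) (k : ℕ) (t : ℂ) :
    Tendsto (fun x ↦ (laguerreOp w κ k (rootPoly s (y x))).eval t) l
      (𝓝 ((laguerreOp w κ k (rootPoly s z)).eval t)) := by
  have h1 : Tendsto (fun x ↦ (derivative (derivative (rootPoly s (y x)))).eval t) l
      (𝓝 ((derivative (derivative (rootPoly s z))).eval t)) := by
    simp only [derivative_rootPoly s, derivative_sum, eval_finsetSum]
    exact tendsto_finsetSum _ fun μ _ ↦
      tendsto_eval_derivative_rootPoly (fun ν hν ↦ h ν (Finset.mem_of_mem_erase hν)) t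
  have h2 := tendsto_eval_derivative_rootPoly h t
  have h3 := tendsto_eval_rootPoly h t
  simp only [laguerreOp_apply, eval_add, eval_sub, eval_mul, eval_X, eval_C]
  exact ((h1.const_mul _).sub (h2.const_mul _)).add
    (((h2.const_mul _).sub (h3.const_mul _)).const_mul _)

/-- Stieltjes' identity is affine in `κ`, and the difference of the operators for `1` and `0` is its
`κ`-part. In this homogenized form it survives in the limit even if the limiting roots collide or
vanish, and even if `θ'` is `0`. -/
lemma laguerreOp_limit {l : Filter Ω} [l.NeBot] {s : Finset ι} {w : ℂ} {y : Ω → ι → ℂ}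
    {θ : Ω → ℂ} {z : ι → ℂ} {θ' : ℂ}
    (hinj : ∀ᶠ x in l, Set.InjOn (y x) s) (h0 : ∀ᶠ x in l, ∀ μ ∈ s, y x μ ≠ 0)
    (hz : ∀ μ ∈ s, Tendsto (fun x ↦ y x μ) l (𝓝 (z μ))) (hθ : Tendsto θ l (𝓝 θ'))
    (hβ : ∀ μ ∈ s, Tendsto (fun x ↦ θ x * bethe s w (y x) μ) l (𝓝 1)) :
    C θ' * laguerreOp w 0 s.card (rootPoly s z) +
      (laguerreOp w 1 s.card (rootPoly s z) - laguerreOp w 0 s.card (rootPoly s z)) = 0 := by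
  refine Polynomial.funext fun t ↦ ?_
  have hl := (hθ.mul (tendsto_eval_laguerreOp_rootPoly hz w 0 s.card t)).add
    ((tendsto_eval_laguerreOp_rootPoly hz w 1 s.card t).sub
      (tendsto_eval_laguerreOp_rootPoly hz w 0 s.card t))
  have hr : Tendsto (fun x ↦ ∑ μ ∈ s, -2 * y x μ * (θ x * bethe s w (y x) μ - 1) *
      (rootPoly (s.erase μ) (y x)).eval t) l
      (𝓝 (∑ μ ∈ s, -2 * z μ * (1 - 1) * (rootPoly (s.erase μ) z).eval t)) := by
    refine tendsto_finsetSum _ fun μ hμ ↦ ?_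
    exact (((hz μ hμ).const_mul _).mul ((hβ μ hμ).sub tendsto_const_nhds)).mul
      (tendsto_eval_rootPoly (fun ν hν ↦ hz ν (Finset.mem_of_mem_erase hν)) t)
  simp only [sub_self, mul_zero, zero_mul, Finset.sum_const_zero] at hr
  have := tendsto_nhds_unique_of_eventuallyEq hl hr (by
    filter_upwards [hinj, h0] with x hx hx0
    rw [laguerreOp_rootPoly hx hx0, laguerreOp_rootPoly hx hx0]
    simp only [eval_finsetSum, eval_mul, eval_C]
    rw [Finset.mul_sum, ← Finset.sum_sub_distrib, ← Finset.sum_add_distrib]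
    exact Finset.sum_congr rfl fun μ _ ↦ by ring)
  simpa using this

lemma ultrafilter_exists_tendsto (U : Ultrafilter Ω) {f : Ω → ℂ} {K : ℝ}
    (h : ∀ᶠ x in (U : Filter Ω), ‖f x‖ ≤ K) : ∃ z, Tendsto f U (𝓝 z) := by
  obtain ⟨z, -, hz⟩ := (isCompact_closedBall (0 : ℂ) K).ultrafilter_le_nhds (U.map f) (by
    rw [le_principal_iff, Ultrafilter.coe_map, mem_map]
    filter_upwards [h] with x hx
    simpa using hx)
  exact ⟨z, hz⟩

/-- Along an ultrafilter on which the Bethe sums of a cluster tend to `1`, the cluster converges,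
and its limit consists of the roots of a Laguerre polynomial. -/
lemma exists_tendsto_of_bethe (U : Ultrafilter Ω) {s : Finset ι} {w : ℂ} {y : Ω → ι → ℂ}
    (hinj : ∀ᶠ x in (U : Filter Ω), Set.InjOn (y x) s)
    (h0 : ∀ᶠ x in (U : Filter Ω), ∀ μ ∈ s, y x μ ≠ 0)
    (hβ : ∀ μ ∈ s, Tendsto (fun x ↦ bethe s w (y x) μ) U (𝓝 1)) :
    ∃ z : ι → ℂ, (∀ μ ∈ s, Tendsto (fun x ↦ y x μ) U (𝓝 (z μ))) ∧
      laguerreOp w 1 s.card (rootPoly s z) = 0 := by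
  -- Dividing by `R` makes the norms of `1 / R` and of the rescaled points add up to `1`, so that
  -- their limits cannot all vanish.
  set R : Ω → ℝ := fun x ↦ 1 + ∑ μ ∈ s, ‖y x μ‖ with hR
  have hR1 (x : Ω) : 1 ≤ R x := le_add_of_nonneg_right (Finset.sum_nonneg fun _ _ ↦ norm_nonneg _)
  have hR0 (x : Ω) : (0 : ℝ) < R x := one_pos.trans_le (hR1 x)
  have hRC (x : Ω) : (R x : ℂ) ≠ 0 := by exact_mod_cast (hR0 x).ne'
  have hnR (x : Ω) : ‖(R x : ℂ)‖ = R x := by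
    rw [Complex.norm_real, Real.norm_of_nonneg (hR0 x).le]
  have hθb (x : Ω) : ‖(R x : ℂ)⁻¹‖ ≤ 1 := by
    rw [norm_inv, hnR]
    exact inv_le_one_of_one_le₀ (hR1 x)
  obtain ⟨θ, hθ⟩ := ultrafilter_exists_tendsto U (.of_forall hθb)
  have hzb (x : Ω) (μ : ι) (hμ : μ ∈ s) : ‖(R x : ℂ)⁻¹ * y x μ‖ ≤ 1 := by
    rw [norm_mul, norm_inv, hnR, inv_mul_le_one₀ (hR0 x)]
    exact (Finset.single_le_sum (f := fun μ ↦ ‖y x μ‖) (fun _ _ ↦ norm_nonneg _) hμ).trans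
      (le_add_of_nonneg_left zero_le_one)
  have hex (μ : ι) : ∃ z, μ ∈ s → Tendsto (fun x ↦ (R x : ℂ)⁻¹ * y x μ) U (𝓝 z) := by
    by_cases hμ : μ ∈ s
    · obtain ⟨z, hz⟩ := ultrafilter_exists_tendsto U (.of_forall fun x ↦ hzb x μ hμ)
      exact ⟨z, fun _ ↦ hz⟩
    · exact ⟨0, fun h ↦ absurd h hμ⟩
  choose z hz using hex
  have hscale (x : Ω) (μ : ι) : (R x : ℂ)⁻¹ * bethe s w (fun μ ↦ (R x : ℂ)⁻¹ * y x μ) μ =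
      bethe s w (y x) μ := by
    rw [bethe, bethe, mul_sub, Finset.mul_sum]
    congr 1
    · have := hRC x
      rw [mul_comm (R x : ℂ)⁻¹ (y x μ), ← div_div, mul_comm, div_inv_eq_mul, mul_assoc,
        mul_inv_cancel₀ this, mul_one]
    · refine Finset.sum_congr rfl fun ν _ ↦ ?_
      rw [← mul_sub, one_div, mul_inv, inv_inv, ← mul_assoc, inv_mul_cancel₀ (hRC x), one_mul,
        one_div]
  have hlim := laguerreOp_limit (l := (U : Filter Ω)) (s := s) (w := w)
    (y := fun x μ ↦ (R x : ℂ)⁻¹ * y x μ) (z := z) (θ := fun x ↦ (R x : ℂ)⁻¹) (θ' := θ)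
    (by
      filter_upwards [hinj] with x hx μ hμ ν hν h
      exact hx hμ hν (mul_left_cancel₀ (inv_ne_zero (hRC x)) h))
    (by
      filter_upwards [h0] with x hx μ hμ
      exact mul_ne_zero (inv_ne_zero (hRC x)) (hx μ hμ)) hz hθ
    (by simpa only [hscale] using hβ)
  have hsum : ‖θ‖ + ∑ μ ∈ s, ‖z μ‖ = 1 := by
    have h1 : Tendsto (fun x ↦ ‖(R x : ℂ)⁻¹‖ + ∑ μ ∈ s, ‖(R x : ℂ)⁻¹ * y x μ‖) U
        (𝓝 (‖θ‖ + ∑ μ ∈ s, ‖z μ‖)) :=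
      hθ.norm.add (tendsto_finsetSum _ fun μ hμ ↦ (hz μ hμ).norm)
    refine tendsto_nhds_unique h1 (tendsto_const_nhds.congr fun x ↦ ?_)
    simp only [norm_mul, norm_inv, hnR]
    rw [← Finset.mul_sum]
    have : R x ≠ 0 := (hR0 x).ne'
    field_simp
    exact hR ▸ rfl
  -- If the cluster escaped to infinity, the limit equation would reduce to `X P' = k P`. Then `P =
  -- X ^ k` and all `z μ` vanish, against the normalization.
  have hθ0 : θ ≠ 0 := by
    rintro rfl
    rw [C_0, zero_mul, zero_add] at hlim
    have hP : rootPoly s z = X ^ s.card := by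
      ext m
      rw [coeff_X_pow]
      split_ifs with hm
      · rw [hm, ← natDegree_rootPoly s z, coeff_natDegree, (rootPoly_monic s z).leadingCoeff]
      · have h1 := congrArg (coeff · m) hlim
        simp only [coeff_sub, coeff_laguerreOp, coeff_zero] at h1
        have h2 : (m : ℂ) - s.card ≠ 0 := by
          rw [sub_ne_zero]; exact_mod_cast hm
        have h3 : 2 * ((m : ℂ) - s.card) * (rootPoly s z).coeff m = 0 := by
          linear_combination h1
        simpa [h2] using h3
    have hz0 : ∑ μ ∈ s, ‖z μ‖ = 0 := by
      refine Finset.sum_eq_zero fun μ hμ ↦ ?_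
      have h1 : (rootPoly s z).eval (z μ) = 0 := by
        rw [rootPoly, eval_prod]
        exact Finset.prod_eq_zero hμ (by simp)
      rw [hP, eval_pow, eval_X] at h1
      rw [eq_zero_of_pow_eq_zero h1, norm_zero]
    rw [hz0, norm_zero, add_zero] at hsum
    exact zero_ne_one hsum
  have hy (μ : ι) (hμ : μ ∈ s) : Tendsto (fun x ↦ y x μ) U (𝓝 (θ⁻¹ * z μ)) := by
    refine ((hθ.inv₀ hθ0).mul (hz μ hμ)).congr fun x ↦ ?_
    rw [inv_inv, ← mul_assoc, mul_inv_cancel₀ (hRC x), one_mul]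
  refine ⟨fun μ ↦ θ⁻¹ * z μ, hy, ?_⟩
  have := laguerreOp_limit (θ := fun _ ↦ 1) hinj h0 hy tendsto_const_nhds (by simpa using hβ)
  simpa using this

/-- Modulo `X - C (b μ)` the constant `b μ ^ j` is `X ^ j`. This trades powers of a root for a shift
in degree plus multiples of the full root polynomial, whose low coefficients are under control. -/
lemma C_pow_mul_rootPoly_erase {s : Finset ι} (b : ι → ℂ) {μ : ι} (hμ : μ ∈ s) (j : ℕ) :
    C (b μ ^ j) * rootPoly (s.erase μ) b = X ^ j * rootPoly (s.erase μ) b -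
      ∑ i ∈ Finset.range j, C (b μ ^ (j - 1 - i)) * (X ^ i * rootPoly s b) := by
  have h := geom_sum₂_mul X (C (b μ)) j
  have h1 : ∑ i ∈ Finset.range j, C (b μ ^ (j - 1 - i)) * (X ^ i * rootPoly s b) =
      (∑ i ∈ Finset.range j, X ^ i * C (b μ) ^ (j - 1 - i)) * rootPoly s b := by
    rw [Finset.sum_mul]
    exact Finset.sum_congr rfl fun i _ ↦ by rw [C_pow]; ring
  rw [h1, ← rootPoly_eq_mul b hμ, C_pow]
  linear_combination rootPoly (s.erase μ) b * h

/-- If `2 w = d` is a natural number smaller than the number of points of the cluster, then the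
Bethe sums of bounded clusters cannot approach `1` through functions which are small and analytic
near `0`. -/
lemma false_of_bethe_resonance {l : Filter Ω} [l.NeBot] {s : Finset ι} {w : ℂ} {d : ℕ}
    (hd : 2 * w = d) (hds : d < s.card) {y : Ω → ι → ℂ}
    (hinj : ∀ᶠ x in l, Set.InjOn (y x) s) (h0 : ∀ᶠ x in l, ∀ μ ∈ s, y x μ ≠ 0)
    (hy : ∀ μ ∈ s, (fun x ↦ y x μ) =O[l] fun _ ↦ (1 : ℝ))
    {ε : ℕ → Ω → ℂ} (hε : ∀ i < d, Tendsto (ε i) l (𝓝 0))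
    {ρ : ι → Ω → ℂ} (hρ : ∀ μ ∈ s, Tendsto (ρ μ) l (𝓝 0))
    (hβ : ∀ᶠ x in l, ∀ μ ∈ s, bethe s w (y x) μ =
      1 - ∑ i ∈ Finset.range d, ε i x * y x μ ^ i - ρ μ x * y x μ ^ d) : False := by
  -- `N` measures the coefficients of degree at most `d`; the aim is the contradiction `N = o(N)`.
  set N : Ω → ℝ := fun x ↦ ∑ i ∈ Finset.range (d + 1), ‖(rootPoly s (y x)).coeff i‖ with hN
  have hc (i : ℕ) (hi : i ≤ d) : (fun x ↦ (rootPoly s (y x)).coeff i) =O[l] N := by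
    refine Asymptotics.isBigO_of_le _ fun x ↦ ?_
    refine (Finset.single_le_sum (f := fun i ↦ ‖(rootPoly s (y x)).coeff i‖)
      (fun _ _ ↦ norm_nonneg _) (Finset.mem_range.mpr (Nat.lt_succ_of_le hi))).trans ?_
    exact le_abs_self _
  have hcX (i m : ℕ) (hm : m ≤ d) : (fun x ↦ (X ^ i * rootPoly s (y x)).coeff m) =O[l] N := by
    simp only [coeff_X_pow_mul']
    split_ifs
    · exact hc _ (by omega)
    · exact Asymptotics.isBigO_zero _ _
  have hgeom (j m : ℕ) (hm : m ≤ d) (μ : ι) (hμ : μ ∈ s) : (fun x ↦ (∑ i ∈ Finset.range j,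
      C (y x μ ^ (j - 1 - i)) * (X ^ i * rootPoly s (y x))).coeff m) =O[l] N := by
    simp only [finsetSum_coeff, coeff_C_mul]
    refine Asymptotics.IsBigO.fun_sum fun i _ ↦ ?_
    simpa using ((hy μ hμ).pow (j - 1 - i)).mul (hcX i m hm)
  have hsum (j m : ℕ) (hm : m ≤ d) : (fun x ↦ (∑ μ ∈ s, C (y x μ ^ (j + 1)) *
      rootPoly (s.erase μ) (y x)).coeff m) =O[l] N := by
    -- Since `ε i` does not depend on `μ`, only the sum over the cluster occurs. It produces the
    -- derivative, whose low coefficients are again those of the root polynomial.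
    have e (x : Ω) : ∑ μ ∈ s, C (y x μ ^ (j + 1)) * rootPoly (s.erase μ) (y x) =
        X ^ (j + 1) * derivative (rootPoly s (y x)) - ∑ μ ∈ s, ∑ i ∈ Finset.range (j + 1),
          C (y x μ ^ (j + 1 - 1 - i)) * (X ^ i * rootPoly s (y x)) := by
      rw [derivative_rootPoly, Finset.mul_sum, ← Finset.sum_sub_distrib]
      exact Finset.sum_congr rfl fun μ hμ ↦ C_pow_mul_rootPoly_erase _ hμ _
    simp only [e, coeff_sub]
    refine Asymptotics.IsBigO.sub ?_ ?_
    · simp only [coeff_X_pow_mul', coeff_derivative]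
      split_ifs with hj
      · simp only [mul_comm _ (((m - (j + 1) : ℕ) : ℂ) + 1)]
        exact (hc _ (by omega)).const_mul_left _
      · exact Asymptotics.isBigO_zero _ _
    · simp only [finsetSum_coeff s]
      exact Asymptotics.IsBigO.fun_sum fun μ hμ ↦ hgeom (j + 1) m hm μ hμ
  have hrem (m : ℕ) (hm : m ≤ d) (μ : ι) (hμ : μ ∈ s) :
      (fun x ↦ (C (y x μ ^ (d + 1)) * rootPoly (s.erase μ) (y x)).coeff m) =O[l] N := by
    simp only [C_pow_mul_rootPoly_erase _ hμ, coeff_sub]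
    refine Asymptotics.IsBigO.sub ?_ (hgeom (d + 1) m hm μ hμ)
    -- The remainder depends on `μ`, but after multiplication by the extra factor `y x μ` its power
    -- is `d + 1`, and `X ^ (d + 1)` contributes nothing in degrees up to `d`.
    simp only [coeff_X_pow_mul', if_neg (show ¬ d + 1 ≤ m by omega)]
    exact Asymptotics.isBigO_zero _ _
  have hT (m : ℕ) (hm : m ≤ d) :
      (fun x ↦ (laguerreOp w 1 s.card (rootPoly s (y x))).coeff m) =o[l] N := by
    have h1 : (fun x ↦ (laguerreOp w 1 s.card (rootPoly s (y x))).coeff m) =ᶠ[l] fun x ↦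
        ∑ i ∈ Finset.range d, 2 * (ε i x * (∑ μ ∈ s, C (y x μ ^ (i + 1)) *
          rootPoly (s.erase μ) (y x)).coeff m) +
        ∑ μ ∈ s, 2 * (ρ μ x * (C (y x μ ^ (d + 1)) * rootPoly (s.erase μ) (y x)).coeff m) := by
      filter_upwards [hinj, h0, hβ] with x hx hx0 hxβ
      rw [laguerreOp_rootPoly hx hx0]
      simp only [finsetSum_coeff, coeff_C_mul]
      simp only [Finset.mul_sum]
      rw [Finset.sum_comm, ← Finset.sum_add_distrib]
      refine Finset.sum_congr rfl fun μ hμ ↦ ?_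
      rw [hxβ μ hμ, show -2 * y x μ * (1 - ∑ i ∈ Finset.range d, ε i x * y x μ ^ i -
        ρ μ x * y x μ ^ d - 1) = ∑ i ∈ Finset.range d, 2 * y x μ * (ε i x * y x μ ^ i) +
          2 * ρ μ x * y x μ ^ (d + 1) by rw [← Finset.mul_sum]; ring, add_mul, Finset.sum_mul]
      congr 1
      · exact Finset.sum_congr rfl fun i _ ↦ by ring
      · ring
    refine h1.trans_isLittleO (.add (.fun_sum fun i hi ↦ ?_) (.fun_sum fun μ hμ ↦ ?_))
    · have := ((Asymptotics.isLittleO_one_iff ℝ).mpr (hε i (Finset.mem_range.mp hi))).mul_isBigO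
        (hsum i m hm)
      simpa using this.const_mul_left 2
    · have := ((Asymptotics.isLittleO_one_iff ℝ).mpr (hρ μ hμ)).mul_isBigO (hrem m hm μ hμ)
      simpa using this.const_mul_left 2
  have hne (m : ℕ) (hm : m ≤ d) : 2 * ((m : ℂ) - s.card) ≠ 0 := by
    refine mul_ne_zero two_ne_zero (sub_ne_zero.mpr ?_)
    exact_mod_cast (by omega : m ≠ s.card)
  -- In degree `d` the factor `d - 2 * w` vanishes and removes the uncontrolled coefficient of
  -- degree `d + 1`; the recursion then descends to degree `0`.
  have hsmall (j : ℕ) (hj : j ≤ d) : (fun x ↦ (rootPoly s (y x)).coeff (d - j)) =o[l] N := by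
    induction j with
    | zero =>
      have h1 := hT d le_rfl
      simp only [coeff_laguerreOp, hd, sub_self, mul_zero, zero_mul, zero_add, mul_one] at h1
      exact (Asymptotics.isLittleO_const_mul_left_iff (hne d le_rfl)).mp h1
    | succ j ih =>
      have h1 := hT (d - (j + 1)) (by omega)
      simp only [coeff_laguerreOp, mul_one] at h1
      rw [show d - (j + 1) + 1 = d - j by omega] at h1
      have h2 := h1.sub ((ih (by omega)).const_mul_left
        ((((d - (j + 1) : ℕ) : ℂ) + 1) * (((d - (j + 1) : ℕ) : ℂ) - 2 * w)))
      simp only [add_sub_cancel_left] at h2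
      exact (Asymptotics.isLittleO_const_mul_left_iff (hne _ (by omega))).mp h2
  have hNN : N =o[l] N := by
    refine .fun_sum fun i hi ↦ ?_
    have hi' : i ≤ d := Nat.lt_succ_iff.mp (Finset.mem_range.mp hi)
    have := hsmall (d - i) (by omega)
    rw [Nat.sub_sub_self hi'] at this
    exact this.norm_left
  -- The constant coefficient is nonzero because no root is `0`, so `N` never vanishes.
  refine Asymptotics.isLittleO_irrefl (Eventually.frequently ?_) hNN
  filter_upwards [h0] with x hx
  refine (lt_of_lt_of_le (norm_pos_iff.mpr ?_) (Finset.single_le_sum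
    (f := fun i ↦ ‖(rootPoly s (y x)).coeff i‖) (fun _ _ ↦ norm_nonneg _)
    (Finset.mem_range.mpr d.succ_pos))).ne'
  rw [coeff_zero_eq_eval_zero, rootPoly, eval_prod]
  exact Finset.prod_ne_zero_iff.mpr fun μ hμ ↦ by simpa using hx μ hμ

/-- Taylor expansion with bounds which only depend on a bound of the function. -/
lemma exists_taylor_bound {ρ : ℝ} (hρ : 0 < ρ) {K : ℝ} (d : ℕ) :
    ∃ K' : ℝ, ∀ f : ℂ → ℂ, DifferentiableOn ℂ f (Metric.ball 0 ρ) →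
      (∀ x ∈ Metric.ball (0 : ℂ) ρ, ‖f x‖ ≤ K) →
      ∃ (c : ℕ → ℂ) (g : ℂ → ℂ), (∀ i < d, ‖c i‖ ≤ K') ∧
        (∀ x ∈ Metric.ball (0 : ℂ) ρ, ‖g x‖ ≤ K') ∧
        ∀ x, f x = ∑ i ∈ Finset.range d, c i * x ^ i + g x * x ^ d := by
  induction d generalizing K with
  | zero => exact ⟨K, fun f _ hf ↦ ⟨0, f, by simp, hf, by simp⟩⟩
  | succ d ih =>
    -- `2 * K + 1` bounds the oscillation of `f`, and the Schwarz lemma bounds its difference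
    -- quotient at `0` by this over `ρ`.
    obtain ⟨K', hK'⟩ := ih (K := (2 * K + 1) / ρ)
    refine ⟨max K K', fun f hd hf ↦ ?_⟩
    have h0 : (0 : ℂ) ∈ Metric.ball (0 : ℂ) ρ := Metric.mem_ball_self hρ
    have hd' : DifferentiableOn ℂ (dslope f 0) (Metric.ball 0 ρ) :=
      (Complex.differentiableOn_dslope (Metric.ball_mem_nhds 0 hρ)).mpr hd
    have hb : ∀ x ∈ Metric.ball (0 : ℂ) ρ, ‖dslope f 0 x‖ ≤ (2 * K + 1) / ρ := by
      intro x hx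
      refine Complex.norm_dslope_le_div_of_mapsTo_ball hd (fun z hz ↦ ?_) hx
      rw [mem_closedBall_iff_norm]
      have := norm_sub_le (f z) (f 0)
      linarith [hf z hz, hf 0 h0]
    obtain ⟨c, g, hc, hg, he⟩ := hK' (dslope f 0) hd' hb
    refine ⟨fun i ↦ if i = 0 then f 0 else c (i - 1), g, fun i hi ↦ ?_,
      fun x hx ↦ (hg x hx).trans (le_max_right _ _), fun x ↦ ?_⟩
    · dsimp only
      split_ifs with h
      · exact (hf 0 h0).trans (le_max_left _ _)
      · exact (hc (i - 1) (by omega)).trans (le_max_right _ _)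
    · have h1 : f x = f 0 + x * dslope f 0 x := by
        have := sub_smul_dslope f 0 x
        rw [sub_zero, smul_eq_mul] at this
        rw [this]; ring
      rw [h1, he x, Finset.sum_range_succ']
      simp only [Nat.succ_ne_zero, if_false, if_true, Nat.add_sub_cancel, pow_zero, mul_one]
      rw [mul_add, Finset.mul_sum, add_right_comm, add_comm (f 0)]
      congr 1
      congr 1
      · exact Finset.sum_congr rfl fun i _ ↦ by ring
      · ring

end Compactness

/-! ### The defining equations in Bethe form and their invariance. -/

section BetheEquations
variable (L : PeriodPair) {r n : ℕ} (p w : Fin r → ℂ)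

/-- The function `∑_i n_i ζ(a_μ - p_i) - ∑_{ν ≠ μ} ζ(a_μ - a_ν)`. The defining equations of the
generalized Lamé curve say that its values for all `μ` agree. -/
def ellipticBethe (a : Fin n → ℂ) (μ : Fin n) : ℂ :=
  ∑ i, w i * weierstrassZeta L (a μ - p i) -
    ∑ ν ∈ Finset.univ.erase μ, weierstrassZeta L (a μ - a ν)

lemma sum_ellipticBethe (a : Fin n → ℂ) : ∑ μ, ellipticBethe L p w a μ = zetaSum L p w a := by
  have h : ∑ μ, ∑ ν ∈ Finset.univ.erase μ, weierstrassZeta L (a μ - a ν) = 0 := by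
    have h1 := sum_erase_comm Finset.univ fun μ ν ↦ weierstrassZeta L (a μ - a ν)
    have h2 : ∑ μ, ∑ ν ∈ Finset.univ.erase μ, weierstrassZeta L (a ν - a μ) =
        -∑ μ, ∑ ν ∈ Finset.univ.erase μ, weierstrassZeta L (a μ - a ν) := by
      simp only [← Finset.sum_neg_distrib, ← weierstrassZeta_neg, neg_sub]
    rw [h2] at h1
    linear_combination h1 / 2
  simp only [ellipticBethe]
  rw [Finset.sum_sub_distrib, h, sub_zero, zetaSum]

variable {w}

/-- The hypothesis on `∑ w i` is what turns the defining equation into a comparison of one Bethe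
value with the mean of all of them. -/
lemma lameEq_eq (hsum : ∑ i, w i = (n : ℂ)) (a : Fin n → ℂ) (μ : Fin n) :
    lameEq L p w a μ = zetaSum L p w a - n * ellipticBethe L p w a μ := by
  have h1 : lameEq L p w a μ = ∑ ν ∈ Finset.univ.erase μ,
      ((∑ i, w i) * weierstrassZeta L (a μ - a ν) - ∑ i, w i * weierstrassZeta L (a μ - p i) +
        ∑ i, w i * weierstrassZeta L (a ν - p i)) := by
    rw [lameEq, Finset.sum_comm]
    refine Finset.sum_congr rfl fun ν _ ↦ ?_
    rw [Finset.sum_mul, ← Finset.sum_sub_distrib, ← Finset.sum_add_distrib]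
    exact Finset.sum_congr rfl fun i _ ↦ by ring
  have h2 : zetaSum L p w a = ∑ i, w i * weierstrassZeta L (a μ - p i) +
      ∑ ν ∈ Finset.univ.erase μ, ∑ i, w i * weierstrassZeta L (a ν - p i) :=
    (Finset.add_sum_erase _ _ (Finset.mem_univ μ)).symm
  have h3 : ((Finset.univ.erase μ).card : ℂ) = n - 1 := by
    rw [Finset.card_erase_of_mem (Finset.mem_univ μ), Finset.card_univ, Fintype.card_fin,
      Nat.cast_sub (by have := μ.pos; omega), Nat.cast_one]
  rw [h1, hsum, Finset.sum_add_distrib, Finset.sum_sub_distrib, ← Finset.mul_sum, h2,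
    ellipticBethe, Finset.sum_const, nsmul_eq_mul, h3]
  ring

lemma isAnsatz_iff (hsum : ∑ i, w i = (n : ℂ)) (a : Fin n → ℂ) (h : ℂ) :
    IsAnsatz L p w a h ↔ (∀ μ ν, μ ≠ ν → a μ - a ν ∉ L.lattice) ∧
      (∀ μ i, a μ - p i ∉ L.lattice) ∧ ∀ μ, ellipticBethe L p w a μ = h := by
  rw [IsAnsatz]
  refine and_congr_right fun _ ↦ and_congr_right fun _ ↦ ⟨fun ⟨h1, h2⟩ μ ↦ ?_, fun h1 ↦ ?_⟩
  · have h3 := h1 μ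
    rw [lameEq_eq L p hsum, ← h2, ← mul_sub, mul_eq_zero, sub_eq_zero] at h3
    exact (h3.resolve_left (by exact_mod_cast μ.pos.ne')).symm
  · have h2 : (n : ℂ) * h = zetaSum L p w a := by
      rw [← sum_ellipticBethe]
      simp [h1]
    exact ⟨fun μ ↦ by rw [lameEq_eq L p hsum, h1 μ, h2, sub_self], h2⟩

lemma weierstrassZeta_add_of_eq {z z' : ℂ} (hz : z ∉ L.lattice) (ω : L.lattice)
    (h : z' = z + ω) : weierstrassZeta L z' = weierstrassZeta L z + quasiPeriodHom L ω := by
  rw [h, weierstrassZeta_add_coe L hz]; rfl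

/-- Translation adds `n η(ω_μ)` through the `p_i`, as the weights sum to `n`, and subtracts `n
η(ω_μ) - ∑ η(ω_ν)` through the pairs. What remains is the same shift for every `μ`. -/
lemma IsAnsatz.move (hsum : ∑ i, w i = (n : ℂ)) {a : Fin n → ℂ} {h : ℂ}
    (ha : IsAnsatz L p w a h) (σ : Equiv.Perm (Fin n)) (ω : Fin n → L.lattice) :
    IsAnsatz L p w (fun μ ↦ a (σ μ) + ω μ) (h + ∑ μ, quasiPeriodHom L (ω μ)) := by
  rw [isAnsatz_iff L p hsum] at ha ⊢
  obtain ⟨h1, h2, h3⟩ := ha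
  refine ⟨fun μ ν hne hmem ↦ ?_, fun μ i hmem ↦ ?_, fun μ ↦ ?_⟩
  · refine h1 (σ μ) (σ ν) (by simpa using hne) ?_
    have := L.lattice.sub_mem hmem (ω μ - ω ν).2
    convert this using 1
    push_cast
    ring
  · refine h2 (σ μ) i ?_
    have := L.lattice.sub_mem hmem (ω μ).2
    convert this using 1
    ring
  · rw [← h3 (σ μ)]
    have e1 (i : Fin r) : weierstrassZeta L (a (σ μ) + ω μ - p i) =
        weierstrassZeta L (a (σ μ) - p i) + quasiPeriodHom L (ω μ) :=
      weierstrassZeta_add_of_eq L (h2 _ i) _ (by ring)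
    have e2 (ν : Fin n) (hν : ν ∈ Finset.univ.erase μ) :
        weierstrassZeta L (a (σ μ) + ω μ - (a (σ ν) + ω ν)) =
        weierstrassZeta L (a (σ μ) - a (σ ν)) +
          (quasiPeriodHom L (ω μ) - quasiPeriodHom L (ω ν)) := by
      rw [← map_sub]
      refine weierstrassZeta_add_of_eq L (h1 _ _ ?_) _ (by push_cast; ring)
      simpa using (Finset.ne_of_mem_erase hν).symm
    have e3 : ∑ ν ∈ Finset.univ.erase (σ μ), weierstrassZeta L (a (σ μ) - a ν) =
        ∑ ν ∈ Finset.univ.erase μ, weierstrassZeta L (a (σ μ) - a (σ ν)) := by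
      refine (Finset.sum_equiv σ (fun ν ↦ ?_) fun _ _ ↦ rfl).symm
      simp
    have e4 : ∑ ν ∈ Finset.univ.erase μ, (quasiPeriodHom L (ω μ) - quasiPeriodHom L (ω ν)) =
        n * quasiPeriodHom L (ω μ) - ∑ ν, quasiPeriodHom L (ω ν) := by
      have := Finset.add_sum_erase Finset.univ
        (fun ν ↦ quasiPeriodHom L (ω μ) - quasiPeriodHom L (ω ν)) (Finset.mem_univ μ)
      rw [sub_self, zero_add] at this
      rw [this, Finset.sum_sub_distrib]
      simp
    rw [ellipticBethe, ellipticBethe, Finset.sum_congr rfl e2, Finset.sum_add_distrib, e4, e3]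
    simp only [e1, mul_add, Finset.sum_add_distrib]
    rw [← Finset.sum_mul, hsum]
    ring

end BetheEquations

/-! ### The ambient space as an orbit space, with the chart `(a, u)`, `u = 1 / h`. -/

section AmbientSpace
variable (L : PeriodPair) {r n : ℕ}

/-- The action of a permutation and of lattice translations on `ℂⁿ × ℙ¹`. -/
def move (σ : Equiv.Perm (Fin n)) (ω : Fin n → L.lattice)
    (x : (Fin n → ℂ) × OnePoint ℂ) : (Fin n → ℂ) × OnePoint ℂ :=
  (fun μ ↦ x.1 (σ μ) + ω μ, OnePoint.map (fun h ↦ h + ∑ μ, quasiPeriodHom L (ω μ)) x.2)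

lemma map_add_map_add (c c' : ℂ) (h : OnePoint ℂ) :
    OnePoint.map (fun h ↦ h + c') (OnePoint.map (fun h ↦ h + c) h) =
      OnePoint.map (fun h ↦ h + (c + c')) h := by
  induction h using OnePoint.rec with
  | infty => rfl
  | coe h => simp [add_assoc]

lemma map_add_zero (h : OnePoint ℂ) : OnePoint.map (fun h ↦ h + 0) h = h := by
  induction h using OnePoint.rec with
  | infty => rfl
  | coe h => simp

lemma move_move (σ σ' : Equiv.Perm (Fin n)) (ω ω' : Fin n → L.lattice)
    (x : (Fin n → ℂ) × OnePoint ℂ) :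
    move L σ' ω' (move L σ ω x) = move L (σ * σ') (fun μ ↦ ω (σ' μ) + ω' μ) x := by
  refine Prod.ext ?_ ?_
  · ext μ
    simp [move, add_assoc]
  · simp only [move, map_add_map_add, map_add, Finset.sum_add_distrib]
    rw [Equiv.sum_comp σ' fun μ ↦ quasiPeriodHom L (ω μ)]

lemma move_one_zero (x : (Fin n → ℂ) × OnePoint ℂ) : move L 1 0 x = x := by
  refine Prod.ext ?_ ?_
  · ext μ
    simp [move]
  · simp only [move, Pi.zero_apply, map_zero, Finset.sum_const_zero, map_add_zero]

lemma exists_move_move_eq (σ : Equiv.Perm (Fin n)) (ω : Fin n → L.lattice) :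
    ∃ σ' ω', ∀ x, move L σ' ω' (move L σ ω x) = x := by
  refine ⟨σ⁻¹, fun μ ↦ -ω (σ⁻¹ μ), fun x ↦ ?_⟩
  rw [move_move, mul_inv_cancel]
  convert move_one_zero L x using 2
  ext μ
  simp

lemma continuous_move (σ : Equiv.Perm (Fin n)) (ω : Fin n → L.lattice) :
    Continuous (move L σ ω) := by
  refine Continuous.prodMk (by fun_prop) ((OnePoint.continuous_map (by fun_prop) ?_).comp
    continuous_snd)
  rw [coclosedCompact_eq_cocompact]
  exact (Homeomorph.addRight (∑ μ, quasiPeriodHom L (ω μ))).isClosedEmbedding.tendsto_cocompact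

lemma mk_move (σ : Equiv.Perm (Fin n)) (ω : Fin n → L.lattice)
    (x : (Fin n → ℂ) × OnePoint ℂ) :
    Quot.mk (AmbientRel L n) (move L σ ω x) = Quot.mk (AmbientRel L n) x := by
  have key (s : Finset (Fin n)) : Quot.mk (AmbientRel L n)
      (move L σ (fun μ ↦ if μ ∈ s then ω μ else 0) x) = Quot.mk (AmbientRel L n) x := by
    induction s using Finset.induction_on with
    | empty =>
      refine Eq.trans ?_ (Quot.sound (AmbientRel.perm x.1 x.2 σ)).symm
      congr 1
      refine Prod.ext ?_ ?_
      · ext μ; simp [move]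
      · simp only [move, Finset.notMem_empty, if_false, map_zero, Finset.sum_const_zero,
          map_add_zero]
    | insert i s hi ih =>
      rw [← ih]
      symm
      have := AmbientRel.shift (L := L)
        (move L σ (fun μ ↦ if μ ∈ s then ω μ else 0) x).1
        (move L σ (fun μ ↦ if μ ∈ s then ω μ else 0) x).2 i (ω i)
      refine (Quot.sound this).trans ?_
      congr 1
      refine Prod.ext ?_ ?_
      · ext μ
        by_cases h : μ = i
        · subst h
          simp [move, hi]
        · simp [move, h]
      · simp only [move]
        rw [← quasiPeriodHom_apply, map_add_map_add]
        congr 2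
        ext h
        congr 1
        rw [← Finset.add_sum_erase _ _ (Finset.mem_univ i),
          ← Finset.add_sum_erase (a := i) Finset.univ
            (fun μ ↦ quasiPeriodHom L (if μ ∈ insert i s then ω μ else 0)) (Finset.mem_univ i)]
        simp only [hi, if_false, map_zero, zero_add, Finset.mem_insert_self, if_true]
        rw [add_comm]
        congr 1
        refine Finset.sum_congr rfl fun μ hμ ↦ ?_
        simp [Finset.ne_of_mem_erase hμ]
  simpa using key Finset.univ

/-- The moves contain the generating relations and are closed under composition and inversion, so
the generated equivalence is the orbit relation. -/
lemma quot_mk_eq_iff (x y : (Fin n → ℂ) × OnePoint ℂ) :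
    Quot.mk (AmbientRel L n) x = Quot.mk (AmbientRel L n) y ↔ ∃ σ ω, y = move L σ ω x := by
  constructor
  · intro h
    rw [Quot.eq] at h
    induction h with
    | rel x y h =>
      cases h with
      | perm a h s =>
        refine ⟨s, 0, Prod.ext ?_ ?_⟩
        · ext μ; simp [move]
        · simp only [move, Pi.zero_apply, map_zero, Finset.sum_const_zero, map_add_zero]
      | shift a h i ω =>
        refine ⟨1, Pi.single i ω, Prod.ext ?_ ?_⟩
        · ext μ
          by_cases hμ : μ = i
          · subst hμ; simp [move]
          · simp [move, hμ]
        · simp only [move]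
          rw [Finset.sum_eq_single_of_mem i (Finset.mem_univ i) fun μ _ hμ ↦ by
            rw [Pi.single_eq_of_ne hμ, map_zero]]
          simp
    | refl x => exact ⟨1, 0, (move_one_zero L x).symm⟩
    | symm x y _ ih =>
      obtain ⟨σ, ω, rfl⟩ := ih
      obtain ⟨σ', ω', h⟩ := exists_move_move_eq L σ ω
      exact ⟨σ', ω', (h x).symm⟩
    | trans x y z _ _ ih1 ih2 =>
      obtain ⟨σ, ω, rfl⟩ := ih1
      obtain ⟨σ', ω', rfl⟩ := ih2
      exact ⟨_, _, move_move L σ σ' ω ω' x⟩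
  · rintro ⟨σ, ω, rfl⟩
    exact (mk_move L σ ω x).symm

/-- The saturation of an open set is a union of its preimages under the continuous moves. -/
lemma isOpenMap_quot_mk : IsOpenMap (Quot.mk (AmbientRel L n)) := by
  intro V hV
  rw [← isQuotientMap_quot_mk.isOpen_preimage]
  have : Quot.mk (AmbientRel L n) ⁻¹' (Quot.mk (AmbientRel L n) '' V) =
      ⋃ σ, ⋃ ω, move L σ ω ⁻¹' V := by
    ext x
    simp only [Set.mem_preimage, Set.mem_image, Set.mem_iUnion]
    constructor
    · rintro ⟨y, hy, h⟩
      obtain ⟨σ, ω, rfl⟩ := (quot_mk_eq_iff L x y).mp h.symm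
      exact ⟨σ, ω, hy⟩
    · rintro ⟨σ, ω, h⟩
      exact ⟨_, h, mk_move L σ ω x⟩
  rw [this]
  exact isOpen_iUnion fun σ ↦ isOpen_iUnion fun ω ↦ hV.preimage (continuous_move L σ ω)

lemma invPoint_zero : invPoint 0 = OnePoint.infty := if_pos rfl

lemma invPoint_of_ne {u : ℂ} (hu : u ≠ 0) : invPoint u = ((u⁻¹ : ℂ) : OnePoint ℂ) := if_neg hu

lemma invPoint_eq_infty_iff {u : ℂ} : invPoint u = OnePoint.infty ↔ u = 0 := by
  by_cases hu : u = 0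
  · simp [hu, invPoint_zero]
  · simp [hu, invPoint_of_ne hu]

lemma map_invPoint_nhds (u : ℂ) : map invPoint (𝓝 u) = 𝓝 (invPoint u) := by
  by_cases hu : u = 0
  · subst hu
    rw [invPoint_zero, OnePoint.nhds_infty_eq, coclosedCompact_eq_cocompact,
      ← Metric.cobounded_eq_cocompact, ← Filter.inv_nhdsNE_zero, ← nhdsNE_sup_pure, Filter.map_sup, map_pure,
      invPoint_zero]
    congr 1
    rw [← Filter.map_inv, Filter.map_map]
    refine Filter.map_congr ?_
    filter_upwards [self_mem_nhdsWithin] with x hx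
    exact invPoint_of_ne hx
  · rw [invPoint_of_ne hu, OnePoint.nhds_coe_eq, nhds_inv₀ hu, ← Filter.map_inv, Filter.map_map]
    refine Filter.map_congr ?_
    filter_upwards [isOpen_ne.mem_nhds hu] with x hx
    exact invPoint_of_ne hx

lemma continuous_invPoint : Continuous invPoint :=
  continuous_iff_continuousAt.mpr fun u ↦ (map_invPoint_nhds u).le

lemma isOpenMap_invPoint : IsOpenMap invPoint :=
  IsOpenMap.of_nhds_le fun u ↦ (map_invPoint_nhds u).ge

lemma continuous_arcPoint : Continuous (arcPoint L (n := n)) :=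
  continuous_quot_mk.comp (continuous_fst.prodMk (continuous_invPoint.comp continuous_snd))

lemma isOpenMap_arcPoint : IsOpenMap (arcPoint L (n := n)) :=
  (isOpenMap_quot_mk L).comp (IsOpenMap.id.prodMap isOpenMap_invPoint)

variable (p : Fin r → ℂ) {w : Fin r → ℂ}

lemma mk_coe_mem_curve_iff (hsum : ∑ i, w i = (n : ℂ)) {a : Fin n → ℂ} {h : ℂ} :
    mk L a h ∈ curve L n p w ↔ IsAnsatz L p w a h := by
  refine ⟨fun ⟨a', h', ha, he⟩ ↦ ?_, fun ha ↦ ⟨a, h, ha, rfl⟩⟩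
  obtain ⟨σ, ω, hm⟩ := (quot_mk_eq_iff L _ _).mp he.symm
  have h1 := congrArg Prod.fst hm
  have h2 := congrArg Prod.snd hm
  simp only [move, OnePoint.map_some, OnePoint.coe_eq_coe] at h1 h2
  rw [h1, h2]
  exact ha.move L p hsum σ ω

lemma mk_infty_notMem_curve {a : Fin n → ℂ} : mk L a OnePoint.infty ∉ curve L n p w := by
  rintro ⟨a', h', -, he⟩
  obtain ⟨σ, ω, hm⟩ := (quot_mk_eq_iff L _ _).mp he
  have h2 := congrArg Prod.snd hm
  simp [move] at h2

/-- The ansatz data in the coordinates `(a, u)`, `u = 1 / h`. -/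
def ansatzSet (p w : Fin r → ℂ) (n : ℕ) : Set ((Fin n → ℂ) × ℂ) :=
  {x | x.2 ≠ 0 ∧ IsAnsatz L p w x.1 x.2⁻¹}

lemma arcPoint_mem_curve_iff (hsum : ∑ i, w i = (n : ℂ)) {x : (Fin n → ℂ) × ℂ} :
    arcPoint L x ∈ curve L n p w ↔ x ∈ ansatzSet L p w n := by
  rw [arcPoint, ansatzSet, Set.mem_ofPred_eq]
  by_cases hx : x.2 = 0
  · simp [hx, invPoint_zero, mk_infty_notMem_curve]
  · simp [hx, invPoint_of_ne hx, mk_coe_mem_curve_iff L p hsum]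

/-- Continuous open maps pull closures back to closures, so the closure of the curve can be studied
in the coordinates `(a, u)`. -/
lemma arcPoint_mem_compactCurve_iff (hsum : ∑ i, w i = (n : ℂ)) {x : (Fin n → ℂ) × ℂ} :
    arcPoint L x ∈ compactCurve L n p w ↔ x ∈ closure (ansatzSet L p w n) := by
  have h1 : arcPoint L ⁻¹' curve L n p w = ansatzSet L p w n :=
    Set.ext fun x ↦ arcPoint_mem_curve_iff L p hsum
  rw [← h1, ← (isOpenMap_arcPoint L).preimage_closure_eq_closure_preimage (continuous_arcPoint L)]
  rfl

end AmbientSpace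

/-! ### The rescaled equations near a point over the `p_i`. -/

section LocalEquations
variable (L : PeriodPair) {r n : ℕ} (p w : Fin r → ℂ) (k : Fin r → ℕ) (hk : ∑ i, k i = n)

/-- The regular part at `z = p_j` of the Bethe equations for points `a` near
`(k_1 p_1, …, k_r p_r)`. -/
def betheReg (j : Fin r) (x : (Fin n → ℂ) × ℂ) : ℂ :=
  w j * zetaReg L (x.2 - p j) + ∑ i ∈ Finset.univ.erase j, w i * weierstrassZeta L (x.2 - p i) -
    ∑ ν ∈ blockSet k hk j, zetaReg L (x.2 - x.1 ν) -
    ∑ ν ∈ (blockSet k hk j)ᶜ, weierstrassZeta L (x.2 - x.1 ν)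

lemma ellipticBethe_eq (a : Fin n → ℂ) (μ : Fin n) : ellipticBethe L p w a μ =
    blockBethe w k hk (a - multiPoint p k hk) μ + betheReg L p w k hk (block k hk μ) (a, a μ) := by
  set j := block k hk μ with hj
  have hμ : μ ∈ blockSet k hk j := by simp [hj]
  have e1 : ∑ i, w i * weierstrassZeta L (a μ - p i) = w j / (a μ - p j) +
      w j * zetaReg L (a μ - p j) +
      ∑ i ∈ Finset.univ.erase j, w i * weierstrassZeta L (a μ - p i) := by
    rw [← Finset.add_sum_erase _ _ (Finset.mem_univ j), weierstrassZeta_eq]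
    ring
  have e2 : ∑ ν ∈ Finset.univ.erase μ, weierstrassZeta L (a μ - a ν) =
      ∑ ν ∈ (blockSet k hk j).erase μ, 1 / (a μ - a ν) +
      ∑ ν ∈ blockSet k hk j, zetaReg L (a μ - a ν) +
      ∑ ν ∈ (blockSet k hk j)ᶜ, weierstrassZeta L (a μ - a ν) := by
    have h1 : Finset.univ.erase μ = (blockSet k hk j).erase μ ∪ (blockSet k hk j)ᶜ := by
      ext ν
      by_cases hν : ν = μ
      · subst hν; simpa using hμ
      · simp only [Finset.mem_erase, Finset.mem_univ, Finset.mem_union, Finset.mem_compl, hν, ne_eq,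
          not_false_eq_true, true_and, true_iff]
        tauto
    have h2 : Disjoint ((blockSet k hk j).erase μ) (blockSet k hk j)ᶜ :=
      Finset.disjoint_left.mpr fun ν h h' ↦
        Finset.mem_compl.mp h' (Finset.mem_of_mem_erase h)
    -- The regular parts may be summed over the whole block, because the added diagonal term is
    -- `zetaReg L 0 = 0`.
    rw [h1, Finset.sum_union h2, ← Finset.add_sum_erase (blockSet k hk j) (fun ν ↦
      zetaReg L (a μ - a ν)) hμ, sub_self, zetaReg_zero, zero_add, ← Finset.sum_add_distrib]
    congr 1
    exact Finset.sum_congr rfl fun ν _ ↦ weierstrassZeta_eq L _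
  have e3 : blockBethe w k hk (a - multiPoint p k hk) μ = w j / (a μ - p j) -
      ∑ ν ∈ (blockSet k hk j).erase μ, 1 / (a μ - a ν) := by
    rw [blockBethe, bethe]
    congr 1
    refine Finset.sum_congr rfl fun ν hν ↦ ?_
    have hν' : block k hk ν = block k hk μ := mem_blockSet.mp (Finset.mem_of_mem_erase hν)
    simp only [Pi.sub_apply, multiPoint, hν', sub_sub_sub_cancel_right]
  rw [ellipticBethe, betheReg, e1, e2, e3]
  ring

lemma blockBethe_smul (u : ℂ) (y : Fin n → ℂ) (μ : Fin n) :
    blockBethe w k hk (u • y) μ = u⁻¹ * blockBethe w k hk y μ := by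
  simp only [blockBethe, bethe, Pi.smul_apply, smul_eq_mul, ← mul_sub]
  rw [mul_sub, Finset.mul_sum]
  congr 1
  · rw [mul_comm u, ← div_div, div_eq_inv_mul]
  · exact Finset.sum_congr rfl fun ν _ ↦ by rw [one_div, mul_inv, one_div]

/-- The Bethe equations in the coordinates `(u, y)` with `a = (k_1 p_1, …, k_r p_r) + u y`,
multiplied by `u`. -/
def scaledBethe (x : ℂ × (Fin n → ℂ)) (μ : Fin n) : ℂ :=
  blockBethe w k hk x.2 μ + x.1 * betheReg L p w k hk (block k hk μ)
    (multiPoint p k hk + x.1 • x.2, p (block k hk μ) + x.1 * x.2 μ)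

lemma mul_ellipticBethe {u : ℂ} (hu : u ≠ 0) (y : Fin n → ℂ) (μ : Fin n) :
    u * ellipticBethe L p w (multiPoint p k hk + u • y) μ = scaledBethe L p w k hk (u, y) μ := by
  rw [ellipticBethe_eq L p w k hk, add_sub_cancel_left, blockBethe_smul, mul_add, ← mul_assoc,
    mul_inv_cancel₀ hu, one_mul]
  rfl

variable {p}

lemma analyticAt_betheReg (hp : ∀ i j, i ≠ j → p i - p j ∉ L.lattice) (j : Fin r) :
    AnalyticAt ℂ (betheReg L p w k hk j) (multiPoint p k hk, p j) := by
  have hfst (ν : Fin n) : AnalyticAt ℂ (fun x : (Fin n → ℂ) × ℂ ↦ x.2 - x.1 ν)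
      (multiPoint p k hk, p j) :=
    analyticAt_snd.sub ((ContinuousLinearMap.proj (R := ℂ) (φ := fun _ : Fin n ↦ ℂ) ν).analyticAt
      _ |>.comp analyticAt_fst)
  have hsnd (i : Fin r) : AnalyticAt ℂ (fun x : (Fin n → ℂ) × ℂ ↦ x.2 - p i)
      (multiPoint p k hk, p j) := analyticAt_snd.sub analyticAt_const
  refine AnalyticAt.sub (AnalyticAt.sub (AnalyticAt.add ?_ ?_) ?_) ?_
  · refine analyticAt_const.mul (AnalyticAt.fun_comp (analyticAt_zetaReg L ?_) (hsnd j))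
    simp
  · refine Finset.analyticAt_fun_sum _ fun i hi ↦ analyticAt_const.mul
      (AnalyticAt.fun_comp (analyticAt_weierstrassZeta L ?_) (hsnd i))
    exact hp _ _ (Finset.ne_of_mem_erase hi).symm
  · refine Finset.analyticAt_fun_sum _ fun ν hν ↦
      AnalyticAt.fun_comp (analyticAt_zetaReg L ?_) (hfst ν)
    simp [multiPoint, mem_blockSet.mp hν]
  · refine Finset.analyticAt_fun_sum _ fun ν hν ↦
      AnalyticAt.fun_comp (analyticAt_weierstrassZeta L ?_) (hfst ν)
    refine hp _ _ fun h ↦ ?_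
    simp [h] at hν

lemma analyticAt_scaledBethe (hp : ∀ i j, i ≠ j → p i - p j ∉ L.lattice) {b : Fin n → ℂ}
    (h0 : ∀ μ, b μ ≠ 0) (hb : ∀ μ ν, μ ≠ ν → block k hk μ = block k hk ν → b μ ≠ b ν) :
    AnalyticAt ℂ (scaledBethe L p w k hk) (0, b) := by
  rw [analyticAt_pi_iff]
  intro μ
  have hcoord (ν : Fin n) : AnalyticAt ℂ (fun x : ℂ × (Fin n → ℂ) ↦ x.2 ν) (0, b) :=
    (ContinuousLinearMap.proj (R := ℂ) (φ := fun _ : Fin n ↦ ℂ) ν).analyticAt _ |>.comp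
      analyticAt_snd
  refine AnalyticAt.add (AnalyticAt.sub ?_ ?_) (analyticAt_fst.mul ?_)
  · exact analyticAt_const.div (hcoord μ) (h0 μ)
  · refine Finset.analyticAt_fun_sum _ fun ν hν ↦
      analyticAt_const.div ((hcoord μ).sub (hcoord ν)) ?_
    exact sub_ne_zero.mpr (hb μ ν (Finset.ne_of_mem_erase hν).symm
      (mem_blockSet.mp (Finset.mem_of_mem_erase hν)).symm)
  · refine AnalyticAt.fun_comp_of_eq (analyticAt_betheReg L w k hk hp (block k hk μ))
      ((analyticAt_const.add (analyticAt_fst.smul analyticAt_snd)).prod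
      (analyticAt_const.add (analyticAt_fst.mul (hcoord μ)))) ?_
    simp

lemma scaledBethe_zero (y : Fin n → ℂ) (μ : Fin n) :
    scaledBethe L p w k hk (0, y) μ = blockBethe w k hk y μ := by
  simp [scaledBethe]

/-- The derivative of `blockBethe` in the direction `v`. -/
def blockBetheDeriv (b v : Fin n → ℂ) (μ : Fin n) : ℂ :=
  betheDeriv (blockSet k hk (block k hk μ)) (w (block k hk μ)) b v μ

lemma hasDerivAt_blockBethe {b : Fin n → ℂ}
    (h0 : ∀ μ, b μ ≠ 0) (hb : ∀ μ ν, μ ≠ ν → block k hk μ = block k hk ν → b μ ≠ b ν)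
    (v : Fin n → ℂ) (μ : Fin n) :
    HasDerivAt (fun s : ℂ ↦ blockBethe w k hk (b + s • v) μ) (blockBetheDeriv w k hk b v μ) 0 := by
  have hl (ν : Fin n) : HasDerivAt (fun s : ℂ ↦ (b + s • v) ν) (v ν) 0 := by
    simpa using ((hasDerivAt_id (0 : ℂ)).mul_const (v ν)).const_add (b ν)
  have h1 := ((hl μ).inv (by simpa using h0 μ)).const_mul (w (block k hk μ))
  have h2 := h1.sub (HasDerivAt.fun_sum (u := (blockSet k hk (block k hk μ)).erase μ)
    fun ν hν ↦ ((hl μ).sub (hl ν)).inv (by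
      simpa using sub_ne_zero.mpr (hb μ ν (Finset.ne_of_mem_erase hν).symm
        (mem_blockSet.mp (Finset.mem_of_mem_erase hν)).symm)))
  refine (h2.congr_of_eventuallyEq (.of_forall fun s ↦ ?_)).congr_deriv ?_
  · simp [blockBethe, bethe, div_eq_mul_inv]
  · simp only [blockBetheDeriv, betheDeriv, zero_smul, add_zero, Pi.sub_apply]
    rw [sub_eq_add_neg, ← Finset.sum_neg_distrib]
    congr 1
    · ring
    · exact Finset.sum_congr rfl fun ν _ ↦ by ring

/-- On the slice `u = 0` only the rational part remains, so differentiating along lines in that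
slice suffices. -/
lemma fderiv_scaledBethe (hp : ∀ i j, i ≠ j → p i - p j ∉ L.lattice) {b : Fin n → ℂ}
    (h0 : ∀ μ, b μ ≠ 0) (hb : ∀ μ ν, μ ≠ ν → block k hk μ = block k hk ν → b μ ≠ b ν)
    (v : Fin n → ℂ) :
    fderiv ℂ (scaledBethe L p w k hk) (0, b) (0, v) = blockBetheDeriv w k hk b v := by
  have hF := (analyticAt_scaledBethe L w k hk hp h0 hb).differentiableAt.hasFDerivAt
  have hl : HasDerivAt (fun s : ℂ ↦ ((0 : ℂ), b + s • v)) (0, v) 0 := by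
    refine (hasDerivAt_const _ _).prodMk ?_
    simpa using ((hasDerivAt_id (0 : ℂ)).smul_const v).const_add b
  have h1 := hF.comp_hasDerivAt_of_eq (0 : ℂ) hl (by simp)
  have h2 : HasDerivAt (fun s : ℂ ↦ scaledBethe L p w k hk (0, b + s • v))
      (blockBetheDeriv w k hk b v) 0 := by
    rw [hasDerivAt_pi]
    intro μ
    simp only [scaledBethe_zero]
    exact hasDerivAt_blockBethe w k hk h0 hb v μ
  exact h1.unique h2

end LocalEquations

/-! ### Existence and uniqueness of the local branch; necessity of admissibility. -/

section LocalBranch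
variable (L : PeriodPair) {r n : ℕ} {p w : Fin r → ℂ} {k : Fin r → ℕ} {hk : ∑ i, k i = n}

lemma blockBetheDeriv_injective {κ : ℂ} (hκ : κ ≠ 0) {b : Fin n → ℂ} (h0 : ∀ μ, b μ ≠ 0)
    (hb : ∀ μ ν, μ ≠ ν → block k hk μ = block k hk ν → b μ ≠ b ν)
    (hβ : ∀ μ, blockBethe w k hk b μ = κ) {v : Fin n → ℂ}
    (hv : ∀ μ, blockBetheDeriv w k hk b v μ = 0) : v = 0 := by
  ext μ
  refine betheDeriv_injective (s := blockSet k hk (block k hk μ)) (w := w (block k hk μ))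
    (injOn_blockSet hb _) (fun ν _ ↦ h0 ν) hκ (fun ν hν ↦ ?_) (fun ν hν ↦ ?_) μ (by simp)
  · rw [← hβ ν, blockBethe, mem_blockSet.mp hν]
  · have := hv ν
    rwa [blockBetheDeriv, mem_blockSet.mp hν] at this

lemma blockBetheDeriv_add (b v v' : Fin n → ℂ) (μ : Fin n) : blockBetheDeriv w k hk b (v + v') μ =
    blockBetheDeriv w k hk b v μ + blockBetheDeriv w k hk b v' μ := by
  simp only [blockBetheDeriv, betheDeriv, Pi.add_apply]
  rw [add_add_add_comm, ← Finset.sum_add_distrib, mul_add]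
  congr 1
  exact Finset.sum_congr rfl fun ν _ ↦ by ring

lemma blockBetheDeriv_smul (c : ℂ) (b v : Fin n → ℂ) (μ : Fin n) :
    blockBetheDeriv w k hk b (c • v) μ = c * blockBetheDeriv w k hk b v μ := by
  simp only [blockBetheDeriv, betheDeriv, Pi.smul_apply, smul_eq_mul]
  rw [mul_add, Finset.mul_sum]
  congr 1
  · ring
  · exact Finset.sum_congr rfl fun ν _ ↦ by ring

/-- `blockBetheDeriv` as a linear map. -/
def blockBetheDerivLin (w : Fin r → ℂ) (k : Fin r → ℕ) (hk : ∑ i, k i = n) (b : Fin n → ℂ) :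
    (Fin n → ℂ) →ₗ[ℂ] (Fin n → ℂ) where
  toFun v := blockBetheDeriv w k hk b v
  map_add' v v' := funext fun μ ↦ blockBetheDeriv_add b v v' μ
  map_smul' c v := funext fun μ ↦ blockBetheDeriv_smul c b v μ

lemma exists_blockBetheDeriv_equiv {κ : ℂ} (hκ : κ ≠ 0) {b : Fin n → ℂ} (h0 : ∀ μ, b μ ≠ 0)
    (hb : ∀ μ ν, μ ≠ ν → block k hk μ = block k hk ν → b μ ≠ b ν)
    (hβ : ∀ μ, blockBethe w k hk b μ = κ) :
    ∃ e : (Fin n → ℂ) ≃ₗ[ℂ] (Fin n → ℂ), ∀ v, e v = blockBetheDeriv w k hk b v := by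
  refine ⟨LinearEquiv.ofInjectiveEndo (blockBetheDerivLin w k hk b) ?_, fun v ↦ rfl⟩
  rw [injective_iff_map_eq_zero]
  exact fun v hv ↦ blockBetheDeriv_injective hκ h0 hb hβ fun μ ↦ congrFun hv μ

/-- The implicit function theorem for the rescaled Bethe equations. -/
lemma exists_branch (hp : ∀ i j, i ≠ j → p i - p j ∉ L.lattice) (hadm : Admissible w k)
    {b : Fin n → ℂ} (hb : IsLaguerreSystem w k hk 1 b) :
    ∃ Y : ℂ → Fin n → ℂ, AnalyticAt ℂ Y 0 ∧ Y 0 = b ∧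
      (∀ᶠ u in 𝓝 (0 : ℂ), ∀ μ, scaledBethe L p w k hk (u, Y u) μ = 1) ∧
      ∀ᶠ x in 𝓝 ((0 : ℂ), b), (∀ μ, scaledBethe L p w k hk x μ = 1) → Y x.1 = x.2 := by
  obtain ⟨h0, hinj, hβ⟩ := (isLaguerreSystem_iff_blockBethe hadm one_ne_zero).mp hb
  rw [one_div_one] at hβ
  have han := analyticAt_scaledBethe L w k hk hp h0 hinj
  have hcd : ContDiffAt ℂ ⊤ (scaledBethe L p w k hk) (0, b) := han.contDiffAt
  have hinv : (fderiv ℂ (scaledBethe L p w k hk) (0, b) ∘L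
      .inr ℂ ℂ (Fin n → ℂ)).IsInvertible := by
    obtain ⟨e, he⟩ := exists_blockBetheDeriv_equiv one_ne_zero h0 hinj hβ
    refine ⟨e.toContinuousLinearEquiv, ?_⟩
    ext1 v
    simp only [ContinuousLinearMap.comp_apply, ContinuousLinearMap.inr_apply]
    rw [fderiv_scaledBethe L w k hk hp h0 hinj, ← he]
    rfl
  have hval (μ : Fin n) : scaledBethe L p w k hk (0, b) μ = 1 := by
    rw [scaledBethe_zero, hβ]
  refine ⟨hcd.implicitFunction (by simp) hinv, ?_, ?_, ?_, ?_⟩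
  · exact (hcd.contDiffAt_implicitFunction (by simp) hinv).analyticAt
  · exact hcd.implicitFunction_apply_self (by simp) hinv
  · filter_upwards [hcd.eventually_apply_implicitFunction (by simp) hinv] with u hu μ
    rw [hu, hval]
  · filter_upwards [hcd.eventually_apply_eq_iff_implicitFunction (by simp) hinv] with x hx h
    exact hx.mp (funext fun μ ↦ by rw [h, hval])

lemma eventually_mul_notMem_lattice {d : ℂ → ℂ} (hd : ContinuousAt d 0) (h0 : d 0 ≠ 0) :
    ∀ᶠ u in 𝓝[≠] (0 : ℂ), u * d u ∉ L.lattice := by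
  have h1 : Tendsto (fun u ↦ u * d u) (𝓝[≠] 0) (𝓝 0) := by
    have : ContinuousAt (fun u ↦ u * d u) 0 := continuousAt_id.mul hd
    simpa [ContinuousAt] using this.tendsto.mono_left nhdsWithin_le_nhds
  filter_upwards [h1.eventually (L.compl_lattice_sdiff_singleton_mem_nhds 0),
    (hd.eventually_ne h0).filter_mono nhdsWithin_le_nhds, self_mem_nhdsWithin] with u h2 h3 h4 h5
  exact h2 ⟨h5, by simpa using ⟨h4, h3⟩⟩

lemma eventually_notMem_lattice {d : ℂ → ℂ} (hd : ContinuousAt d 0) (h0 : d 0 ∉ L.lattice) :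
    ∀ᶠ u in 𝓝[≠] (0 : ℂ), d u ∉ L.lattice :=
  (hd.eventually (L.isClosed_lattice.isOpen_compl.mem_nhds h0)).filter_mono nhdsWithin_le_nhds

/-- Within a block the differences are `u` times a quantity with nonzero limit, and `0` is isolated
in the lattice; across blocks they tend to some `p i - p j`, which avoids the closed lattice. -/
lemma eventually_mem_ansatzSet (hp : ∀ i j, i ≠ j → p i - p j ∉ L.lattice)
    (hsum : ∑ i, w i = (n : ℂ)) {Y : ℂ → Fin n → ℂ} (hY : ContinuousAt Y 0)
    (h0 : ∀ μ, Y 0 μ ≠ 0)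
    (hinj : ∀ μ ν, μ ≠ ν → block k hk μ = block k hk ν → Y 0 μ ≠ Y 0 ν)
    (heq : ∀ᶠ u in 𝓝 (0 : ℂ), ∀ μ, scaledBethe L p w k hk (u, Y u) μ = 1) :
    ∀ᶠ u in 𝓝[≠] (0 : ℂ), (multiPoint p k hk + u • Y u, u) ∈ ansatzSet L p w n := by
  have hYc (μ : Fin n) : ContinuousAt (fun u ↦ Y u μ) 0 := continuousAt_pi.mp hY μ
  have hac (μ : Fin n) : ContinuousAt (fun u ↦ p (block k hk μ) + u * Y u μ) 0 :=
    continuousAt_const.add (continuousAt_id.mul (hYc μ))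
  have e1 : ∀ᶠ u in 𝓝[≠] (0 : ℂ), ∀ μ ν, μ ≠ ν →
      (p (block k hk μ) + u * Y u μ) - (p (block k hk ν) + u * Y u ν) ∉ L.lattice := by
    simp only [eventually_all]
    intro μ ν hne
    by_cases hbl : block k hk μ = block k hk ν
    · filter_upwards [eventually_mul_notMem_lattice L ((hYc μ).sub (hYc ν))
        (sub_ne_zero.mpr (hinj μ ν hne hbl))] with u hu
      convert hu using 2
      rw [hbl]
      simp only [Pi.sub_apply]
      ring
    · refine eventually_notMem_lattice L ((hac μ).sub (hac ν)) ?_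
      simpa using hp _ _ hbl
  have e2 : ∀ᶠ u in 𝓝[≠] (0 : ℂ), ∀ μ i, (p (block k hk μ) + u * Y u μ) - p i ∉ L.lattice := by
    simp only [eventually_all]
    intro μ i
    by_cases hbl : block k hk μ = i
    · subst hbl
      simpa using eventually_mul_notMem_lattice L (hYc μ) (h0 μ)
    · refine eventually_notMem_lattice L ((hac μ).sub continuousAt_const) ?_
      simpa using hp _ _ hbl
  filter_upwards [e1, e2, heq.filter_mono nhdsWithin_le_nhds, self_mem_nhdsWithin]
    with u h1 h2 h3 h4
  have hu : u ≠ 0 := h4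
  refine ⟨hu, (isAnsatz_iff L p hsum _ _).mpr ⟨h1, h2, fun μ ↦ ?_⟩⟩
  have := h3 μ
  rw [← mul_ellipticBethe L p w k hk hu] at this
  exact eq_inv_of_mul_eq_one_right this

variable {L}

lemma IsAnsatz.scaledBethe_eq_one (hsum : ∑ i, w i = (n : ℂ)) {x : (Fin n → ℂ) × ℂ}
    (hx : x ∈ ansatzSet L p w n) (μ : Fin n) :
    scaledBethe L p w k hk (x.2, x.2⁻¹ • (x.1 - multiPoint p k hk)) μ = 1 := by
  obtain ⟨hu, ha⟩ := hx
  rw [← mul_ellipticBethe L p w k hk hu, smul_smul, mul_inv_cancel₀ hu, one_smul,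
    add_sub_cancel, ((isAnsatz_iff L p hsum _ _).mp ha).2.2 μ, mul_inv_cancel₀ hu]

lemma blockBethe_scaled (hsum : ∑ i, w i = (n : ℂ)) {x : (Fin n → ℂ) × ℂ}
    (hx : x ∈ ansatzSet L p w n) (μ : Fin n) :
    blockBethe w k hk (x.2⁻¹ • (x.1 - multiPoint p k hk)) μ =
      1 - x.2 * betheReg L p w k hk (block k hk μ) (x.1, x.1 μ) := by
  have h1 := IsAnsatz.scaledBethe_eq_one (k := k) (hk := hk) hsum hx μ
  have hu := hx.1
  rw [scaledBethe, smul_smul, mul_inv_cancel₀ hu, one_smul, add_sub_cancel] at h1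
  rw [← h1]
  simp only [Pi.smul_apply, smul_eq_mul, ← mul_assoc, mul_inv_cancel₀ hu, one_mul, Pi.sub_apply,
    multiPoint, add_sub_cancel]
  ring

lemma scaled_ne_zero {x : (Fin n → ℂ) × ℂ} (hx : x ∈ ansatzSet L p w n) (μ : Fin n) :
    (x.2⁻¹ • (x.1 - multiPoint p k hk)) μ ≠ 0 := by
  refine mul_ne_zero (inv_ne_zero hx.1) fun h ↦ hx.2.2.1 μ (block k hk μ) ?_
  rw [show x.1 μ - p (block k hk μ) = 0 from h]
  exact L.lattice.zero_mem

lemma scaled_injOn {x : (Fin n → ℂ) × ℂ} (hx : x ∈ ansatzSet L p w n) (j : Fin r) :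
    Set.InjOn (x.2⁻¹ • (x.1 - multiPoint p k hk)) (blockSet k hk j) := by
  intro μ hμ ν hν h
  by_contra hne
  have h1 := mul_left_cancel₀ (inv_ne_zero hx.1) h
  simp only [Finset.mem_coe, mem_blockSet] at hμ hν
  simp only [Pi.sub_apply, multiPoint, hμ, hν, sub_left_inj] at h1
  exact hx.2.1 μ ν hne (by rw [h1, sub_self]; exact L.lattice.zero_mem)

variable (L) in
lemma continuousAt_betheReg (hp : ∀ i j, i ≠ j → p i - p j ∉ L.lattice) (μ : Fin n) :
    ContinuousAt (fun x : (Fin n → ℂ) × ℂ ↦ betheReg L p w k hk (block k hk μ) (x.1, x.1 μ))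
      (multiPoint p k hk, 0) := by
  have h1 : ContinuousAt (fun x : (Fin n → ℂ) × ℂ ↦ (x.1, x.1 μ)) (multiPoint p k hk, 0) := by
    fun_prop
  exact ContinuousAt.comp_of_eq
    (analyticAt_betheReg L w k hk hp (block k hk μ)).continuousAt h1 rfl

/-- The regular part enters with the factor `u` and disappears in the limit, so the rational
compactness statement applies block by block. Admissibility is not needed here. -/
lemma exists_tendsto_scaled (hp : ∀ i j, i ≠ j → p i - p j ∉ L.lattice)
    (hsum : ∑ i, w i = (n : ℂ)) (U : Ultrafilter ((Fin n → ℂ) × ℂ))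
    (hU : (U : Filter ((Fin n → ℂ) × ℂ)) ≤ 𝓝 (multiPoint p k hk, (0 : ℂ)))
    (hUa : ∀ᶠ x in (U : Filter ((Fin n → ℂ) × ℂ)), x ∈ ansatzSet L p w n) :
    ∃ z : Fin n → ℂ, Tendsto (fun x : (Fin n → ℂ) × ℂ ↦ x.2⁻¹ • (x.1 - multiPoint p k hk)) U (𝓝 z) ∧
      IsLaguerreSystem w k hk 1 z := by
  have hβ (μ : Fin n) : Tendsto (fun x : (Fin n → ℂ) × ℂ ↦
      blockBethe w k hk (x.2⁻¹ • (x.1 - multiPoint p k hk)) μ) U (𝓝 1) := by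
    have h1 : Tendsto (fun x : (Fin n → ℂ) × ℂ ↦
        1 - x.2 * betheReg L p w k hk (block k hk μ) (x.1, x.1 μ)) U (𝓝 1) := by
      have h2 := (continuousAt_const (y := (1 : ℂ))).sub
        (continuousAt_snd.mul (continuousAt_betheReg L (w := w) (k := k) (hk := hk) hp μ))
      have h3 : Tendsto (fun x : (Fin n → ℂ) × ℂ ↦
          1 - x.2 * betheReg L p w k hk (block k hk μ) (x.1, x.1 μ)) U
          (𝓝 (1 - 0 * betheReg L p w k hk (block k hk μ)
            (multiPoint p k hk, multiPoint p k hk μ))) := h2.tendsto.mono_left hU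
      rwa [zero_mul, sub_zero] at h3
    refine h1.congr' ?_
    filter_upwards [hUa] with x hx
    exact (blockBethe_scaled hsum hx μ).symm
  have h1 (j : Fin r) := exists_tendsto_of_bethe U (s := blockSet k hk j) (w := w j)
    (y := fun x : (Fin n → ℂ) × ℂ ↦ x.2⁻¹ • (x.1 - multiPoint p k hk))
    (hUa.mono fun x hx ↦ scaled_injOn hx j) (hUa.mono fun x hx μ _ ↦ scaled_ne_zero hx μ)
    (fun μ hμ ↦ by
      have := hβ μ
      simpa only [blockBethe, mem_blockSet.mp hμ] using this)
  choose z hz hP using h1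
  refine ⟨fun μ ↦ z (block k hk μ) μ, tendsto_pi_nhds.mpr fun μ ↦ hz _ μ (by simp), ?_⟩
  rw [isLaguerreSystem_iff one_ne_zero]
  intro j
  have := hP j
  rw [card_blockSet] at this
  rw [one_div_one, ← this]
  congr 1
  refine Finset.prod_congr rfl fun μ hμ ↦ ?_
  simp only [mem_blockSet.mp hμ]

/-- Suppose `2 * w j = d < k j`. The Bethe sums of the rescaled block are `1 - u f(u y_μ)` with one
function `f` for the whole block. Its Taylor expansion to order `d` gives coefficients common to all
`μ` and a remainder divisible by `y_μ ^ d`, the situation ruled out by `false_of_bethe_resonance`.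
-/
lemma admissible_of_mem_closure (hp : ∀ i j, i ≠ j → p i - p j ∉ L.lattice)
    (hsum : ∑ i, w i = (n : ℂ))
    (h : (multiPoint p k hk, (0 : ℂ)) ∈ closure (ansatzSet L p w n)) : Admissible w k := by
  intro j d hd
  by_contra! hlt
  obtain ⟨U, hUa, hU⟩ := mem_closure_iff_ultrafilter.mp h
  have hUa' : ∀ᶠ x in (U : Filter ((Fin n → ℂ) × ℂ)), x ∈ ansatzSet L p w n := hUa
  obtain ⟨z, hz, -⟩ := exists_tendsto_scaled hp hsum U hU hUa'
  have han := analyticAt_betheReg L w k hk hp j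
  set f : (Fin n → ℂ) × ℂ → ℂ → ℂ := fun x t ↦ betheReg L p w k hk j (x.1, p j + t) with hf
  set K : ℝ := ‖betheReg L p w k hk j (multiPoint p k hk, p j)‖ + 1
  have hev : ∀ᶠ x in 𝓝 (multiPoint p k hk, p j), AnalyticAt ℂ (betheReg L p w k hk j) x ∧
      ‖betheReg L p w k hk j x‖ ≤ K :=
    han.eventually_analyticAt.and ((han.continuousAt.norm.eventually_lt
      continuousAt_const (lt_add_one _)).mono fun x hx ↦ hx.le)
  rw [nhds_prod_eq] at hev
  obtain ⟨pa, hpa, pb, hpb, hpab⟩ := eventually_prod_iff.mp hev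
  obtain ⟨ρ, hρ, hball⟩ := Metric.eventually_nhds_iff_ball.mp hpb
  have hgood : ∀ᶠ x in (U : Filter ((Fin n → ℂ) × ℂ)), ∀ t ∈ Metric.ball (0 : ℂ) ρ,
      DifferentiableAt ℂ (f x) t ∧ ‖f x t‖ ≤ K := by
    have h1 : Tendsto (fun x : (Fin n → ℂ) × ℂ ↦ x.1) U (𝓝 (multiPoint p k hk)) :=
      continuousAt_fst.tendsto.mono_left hU
    filter_upwards [h1.eventually hpa] with x hx t ht
    have h2 := hpab hx (hball (p j + t) (by simpa using ht))
    exact ⟨DifferentiableAt.comp (f := fun t ↦ (x.1, p j + t)) t h2.1.differentiableAt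
      ((differentiableAt_const _).prodMk (differentiableAt_id.const_add _)), h2.2⟩
  -- `f x` varies with the point `x`, so the bound on its Taylor data must be uniform for the powers
  -- of `u` to make them small.
  obtain ⟨K', hK'⟩ := exists_taylor_bound hρ (K := K) d
  have hex (x : (Fin n → ℂ) × ℂ) : ∃ (c : ℕ → ℂ) (g : ℂ → ℂ),
      (∀ t ∈ Metric.ball (0 : ℂ) ρ, DifferentiableAt ℂ (f x) t ∧ ‖f x t‖ ≤ K) →
      (∀ i < d, ‖c i‖ ≤ K') ∧ (∀ t ∈ Metric.ball (0 : ℂ) ρ, ‖g t‖ ≤ K') ∧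
        ∀ t, f x t = ∑ i ∈ Finset.range d, c i * t ^ i + g t * t ^ d := by
    by_cases hx : ∀ t ∈ Metric.ball (0 : ℂ) ρ, DifferentiableAt ℂ (f x) t ∧ ‖f x t‖ ≤ K
    · obtain ⟨c, g, h⟩ := hK' (f x) (fun t ht ↦ (hx t ht).1.differentiableWithinAt)
        fun t ht ↦ (hx t ht).2
      exact ⟨c, g, fun _ ↦ h⟩
    · exact ⟨0, 0, fun h ↦ absurd h hx⟩
  choose c g hcg using hex
  have hu : Tendsto (fun x : (Fin n → ℂ) × ℂ ↦ x.2) U (𝓝 0) :=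
    continuousAt_snd.tendsto.mono_left hU
  have hpow (i : ℕ) : Tendsto (fun x : (Fin n → ℂ) × ℂ ↦ x.2 ^ (i + 1)) U (𝓝 0) := by
    simpa using hu.pow (i + 1)
  have hbdd {F : (Fin n → ℂ) × ℂ → ℂ} (hF : ∀ᶠ x in (U : Filter ((Fin n → ℂ) × ℂ)), ‖F x‖ ≤ K') (i : ℕ) :
      Tendsto (fun x ↦ x.2 ^ (i + 1) * F x) U (𝓝 0) :=
    (hpow i).zero_mul_isBoundedUnder_le (isBoundedUnder_of_eventually_le hF)
  have hxμ (μ : Fin n) (hμ : μ ∈ blockSet k hk j) : ∀ᶠ x in (U : Filter ((Fin n → ℂ) × ℂ)),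
      x.1 μ - p j ∈ Metric.ball (0 : ℂ) ρ := by
    have h1 : Tendsto (fun x : (Fin n → ℂ) × ℂ ↦ x.1 μ - p j) U (𝓝 0) := by
      have h2 : ContinuousAt (fun x : (Fin n → ℂ) × ℂ ↦ x.1 μ - p j) (multiPoint p k hk, 0) := by
        fun_prop
      have h3 := h2.tendsto.mono_left hU
      simpa [multiPoint, mem_blockSet.mp hμ] using h3
    exact h1.eventually (Metric.ball_mem_nhds 0 hρ)
  refine false_of_bethe_resonance (l := (U : Filter ((Fin n → ℂ) × ℂ))) hd
    (s := blockSet k hk j) (by rwa [card_blockSet])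
    (y := fun x : (Fin n → ℂ) × ℂ ↦ x.2⁻¹ • (x.1 - multiPoint p k hk))
    (hUa'.mono fun x hx ↦ scaled_injOn hx j) (hUa'.mono fun x hx μ _ ↦ scaled_ne_zero hx μ)
    (fun μ _ ↦ (tendsto_pi_nhds.mp hz μ).isBigO_one ℝ)
    (ε := fun i x ↦ x.2 ^ (i + 1) * c x i) (fun i hi ↦ hbdd ?_ i)
    (ρ := fun μ x ↦ x.2 ^ (d + 1) * g x (x.1 μ - p j)) (fun μ hμ ↦ hbdd ?_ d) ?_
  · filter_upwards [hgood] with x hx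
    exact (hcg x hx).1 i hi
  · filter_upwards [hgood, hxμ μ hμ] with x hx hxμ
    exact (hcg x hx).2.1 _ hxμ
  · filter_upwards [hgood, hUa'] with x hx hxa μ hμ
    have h1 := blockBethe_scaled (k := k) (hk := hk) hsum hxa μ
    have hj := mem_blockSet.mp hμ
    rw [blockBethe, hj] at h1
    have h2 := (hcg x hx).2.2 (x.1 μ - p j)
    simp only [hf, add_sub_cancel] at h2
    have h3 : x.1 μ - p j = x.2 * (x.2⁻¹ • (x.1 - multiPoint p k hk)) μ := by
      simp only [Pi.smul_apply, smul_eq_mul, ← mul_assoc, mul_inv_cancel₀ hxa.1, one_mul,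
        Pi.sub_apply, multiPoint, hj]
    rw [h1, h2, mul_add, Finset.mul_sum, ← sub_sub]
    congr 1
    · congr 1
      refine Finset.sum_congr rfl fun i _ ↦ ?_
      rw [h3, mul_pow]; ring
    · nth_rewrite 2 [h3]
      rw [mul_pow]; ring

/-- Every ansatz near `(k_1 p_1, …, k_r p_r, ∞)` lies on the branch, up to a permutation. -/
lemma eventually_eq_branch (hp : ∀ i j, i ≠ j → p i - p j ∉ L.lattice)
    (hsum : ∑ i, w i = (n : ℂ)) (hadm : Admissible w k) {b : Fin n → ℂ}
    (hb : IsLaguerreSystem w k hk 1 b) {Y : ℂ → Fin n → ℂ}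
    (hY : ∀ᶠ x in 𝓝 ((0 : ℂ), b), (∀ μ, scaledBethe L p w k hk x μ = 1) → Y x.1 = x.2) :
    ∀ᶠ x in 𝓝 (multiPoint p k hk, (0 : ℂ)), x ∈ ansatzSet L p w n →
      ∃ σ : Equiv.Perm (Fin n), (∀ μ, block k hk (σ μ) = block k hk μ) ∧
        x.1 = (multiPoint p k hk + x.2 • Y x.2) ∘ σ := by
  by_contra hcon
  obtain ⟨U, hUs, hU⟩ := mem_closure_iff_ultrafilter.mp
    (mem_closure_iff_frequently.mpr (not_eventually.mp hcon))
  have hUa : ∀ᶠ x in (U : Filter ((Fin n → ℂ) × ℂ)), x ∈ ansatzSet L p w n :=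
    mem_of_superset hUs fun x hx ↦ (Classical.not_imp.mp hx).1
  have hUn : ∀ᶠ x in (U : Filter ((Fin n → ℂ) × ℂ)), ¬∃ σ : Equiv.Perm (Fin n),
      (∀ μ, block k hk (σ μ) = block k hk μ) ∧ x.1 = (multiPoint p k hk + x.2 • Y x.2) ∘ σ :=
    mem_of_superset hUs fun x hx ↦ (Classical.not_imp.mp hx).2
  obtain ⟨z, hz, hzL⟩ := exists_tendsto_scaled hp hsum U hU hUa
  obtain ⟨σ, hσ, hσb⟩ := exists_perm_of_isLaguerreSystem hadm one_ne_zero hb hzL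
  have hσb' (μ : Fin n) : block k hk (σ.symm μ) = block k hk μ := by
    rw [← hσb (σ.symm μ), Equiv.apply_symm_apply]
  -- After reordering, the rescaled points converge to `b` itself, where the local uniqueness of the
  -- branch applies.
  have hlim : Tendsto (fun x : (Fin n → ℂ) × ℂ ↦
      (x.2, x.2⁻¹ • (x.1 ∘ σ.symm - multiPoint p k hk))) U (𝓝 (0, b)) := by
    refine Tendsto.prodMk_nhds (continuousAt_snd.tendsto.mono_left hU) (tendsto_pi_nhds.mpr
      fun μ ↦ ?_)
    have h1 := tendsto_pi_nhds.mp hz (σ.symm μ)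
    rw [hσ, Function.comp_apply, Equiv.apply_symm_apply] at h1
    refine h1.congr fun x ↦ ?_
    simp [multiPoint, hσb']
  obtain ⟨x, ⟨h1, h2⟩, h3⟩ := (((hlim.eventually hY).and hUa).and hUn).exists
  refine h3 ⟨σ, hσb, ?_⟩
  have h4 : (x.1 ∘ σ.symm, x.2) ∈ ansatzSet L p w n := by
    refine ⟨h2.1, ?_⟩
    have := h2.2.move L p hsum σ.symm 0
    simp only [Pi.zero_apply, ZeroMemClass.coe_zero, add_zero, map_zero,
      Finset.sum_const_zero] at this
    exact this
  have h5 := h1 fun μ ↦ IsAnsatz.scaledBethe_eq_one (k := k) (hk := hk) hsum h4 μ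
  simp only at h5
  rw [h5, smul_smul, mul_inv_cancel₀ h2.1, one_smul, add_sub_cancel]
  ext μ
  simp

end LocalBranch

/-! ### Injectivity, filling of a neighbourhood, and the reparametrization property. -/

section Branch
variable (L : PeriodPair) {r n : ℕ} {p w : Fin r → ℂ} {k : Fin r → ℕ} {hk : ∑ i, k i = n}

/-- The arc `u ↦ [(k_1 p_1, …, k_r p_r) + u Y(u), 1 / u]` in the coordinates `(a, u)`. -/
def branchArc (p : Fin r → ℂ) (k : Fin r → ℕ) (hk : ∑ i, k i = n) (Y : ℂ → Fin n → ℂ) (u : ℂ) :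
    (Fin n → ℂ) × ℂ :=
  (multiPoint p k hk + u • Y u, u)

lemma arcPoint_perm (a : Fin n → ℂ) (u : ℂ) (σ : Equiv.Perm (Fin n)) :
    arcPoint L (a ∘ σ, u) = arcPoint L (a, u) :=
  (Quot.sound (AmbientRel.perm a (invPoint u) σ)).symm

lemma branchArc_zero (Y : ℂ → Fin n → ℂ) : branchArc p k hk Y 0 = (multiPoint p k hk, 0) := by
  simp [branchArc]

lemma analyticAt_branchArc {Y : ℂ → Fin n → ℂ} {u : ℂ} (hY : AnalyticAt ℂ Y u) :
    AnalyticAt ℂ (branchArc p k hk Y) u :=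
  (analyticAt_const.add (analyticAt_id.smul hY)).prod analyticAt_id

lemma arcPoint_zero (a : Fin n → ℂ) : arcPoint L (a, 0) = mk L a OnePoint.infty := by
  rw [arcPoint, invPoint_zero]

lemma deriv_branchArc_fst {Y : ℂ → Fin n → ℂ} (hY : AnalyticAt ℂ Y 0) (μ : Fin n) :
    deriv (fun t ↦ (branchArc p k hk Y t).1 μ) 0 = Y 0 μ := by
  have h1 : HasDerivAt (fun u ↦ Y u μ) (deriv (fun u ↦ Y u μ) 0) 0 :=
    (differentiableAt_pi.mp hY.differentiableAt μ).hasDerivAt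
  have h2 := ((hasDerivAt_id (0 : ℂ)).mul h1).const_add (multiPoint p k hk μ)
  have h3 : HasDerivAt (fun t ↦ (branchArc p k hk Y t).1 μ) (Y 0 μ) 0 := by
    simpa [branchArc] using h2
  exact h3.deriv

/-- Near `0` no two coordinates of the arc differ by a nonzero lattice vector, so points with the
same class differ by a permutation alone. Then `h = 1 / t` is the same for both. -/
lemma injOn_arcPoint_branchArc (hp : ∀ i j, i ≠ j → p i - p j ∉ L.lattice)
    {Y : ℂ → Fin n → ℂ} (hY : ContinuousAt Y 0) :
    ∃ U ∈ 𝓝 (0 : ℂ), Set.InjOn (fun t ↦ arcPoint L (branchArc p k hk Y t)) U := by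
  set a : ℂ → Fin n → ℂ := fun t ↦ multiPoint p k hk + t • Y t with ha
  have hac (μ : Fin n) : ContinuousAt (fun t ↦ a t μ) 0 := by
    have : ContinuousAt a 0 := continuousAt_const.add (continuousAt_id.smul hY)
    exact continuousAt_pi.mp this μ
  have ha0 (μ : Fin n) : a 0 μ = p (block k hk μ) := by simp [ha, multiPoint]
  have hev : ∀ᶠ x : ℂ × ℂ in 𝓝 0 ×ˢ 𝓝 0, ∀ μ ν,
      a x.2 μ - a x.1 ν ∈ ((L.lattice : Set ℂ) \ {0})ᶜ := by
    rw [← nhds_prod_eq]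
    simp only [eventually_all]
    intro μ ν
    have h1 : ContinuousAt (fun x : ℂ × ℂ ↦ a x.2 μ - a x.1 ν) (0, 0) :=
      (ContinuousAt.comp_of_eq (g := fun t ↦ a t μ) (hac μ) continuousAt_snd rfl).sub
        (ContinuousAt.comp_of_eq (g := fun t ↦ a t ν) (hac ν) continuousAt_fst rfl)
    refine h1.eventually (L.isOpen_compl_lattice_sdiff.mem_nhds ?_)
    rintro ⟨h2, h3⟩
    simp only [ha0] at h2 h3
    by_cases hb : block k hk μ = block k hk ν
    · exact h3 (by simp [hb])
    · exact hp _ _ hb h2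
  obtain ⟨U, hU, hUU⟩ := eventually_prod_self_iff
    (r := fun t t' ↦ ∀ μ ν, a t' μ - a t ν ∈ ((L.lattice : Set ℂ) \ {0})ᶜ).mp hev
  refine ⟨U, hU, fun t ht t' ht' h ↦ ?_⟩
  obtain ⟨σ, ω, hm⟩ := (quot_mk_eq_iff L _ _).mp h
  have h1 := congrArg Prod.fst hm
  have h2 := congrArg Prod.snd hm
  have hω (μ : Fin n) : ω μ = 0 := by
    have h3 := congrFun h1 μ
    have h4 : a t' μ = a t (σ μ) + ω μ := h3
    have h5 := hUU t ht t' ht' μ (σ μ)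
    rw [h4, add_sub_cancel_left] at h5
    by_contra hne
    exact h5 ⟨(ω μ).2, by simpa using hne⟩
  simp only [move, hω, map_zero, Finset.sum_const_zero, map_add_zero, branchArc] at h2
  by_cases h0 : t = 0
  · rw [h0, invPoint_zero, invPoint_eq_infty_iff] at h2
    rw [h0, h2]
  · have h0' : t' ≠ 0 := fun h' ↦ h0 (by
      rw [h', invPoint_zero, eq_comm, invPoint_eq_infty_iff] at h2
      exact h2)
    rw [invPoint_of_ne h0, invPoint_of_ne h0', OnePoint.coe_eq_coe, inv_inj] at h2
    exact h2.symm

lemma image_branchArc_mem_nhdsWithin (hsum : ∑ i, w i = (n : ℂ)) {Y : ℂ → Fin n → ℂ}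
    (hY : AnalyticAt ℂ Y 0)
    (hev : ∀ᶠ x in 𝓝 (multiPoint p k hk, (0 : ℂ)), x ∈ ansatzSet L p w n →
      ∃ σ : Equiv.Perm (Fin n), (∀ μ, block k hk (σ μ) = block k hk μ) ∧
        x.1 = (multiPoint p k hk + x.2 • Y x.2) ∘ σ) {U : Set ℂ} (hU : U ∈ 𝓝 (0 : ℂ)) :
    (fun t ↦ arcPoint L (branchArc p k hk Y t)) '' U ∈
      𝓝[compactCurve L n p w] (mk L (multiPoint p k hk) OnePoint.infty) := by
  have hsnd : Tendsto (fun x : (Fin n → ℂ) × ℂ ↦ x.2) (𝓝 (multiPoint p k hk, 0)) (𝓝 0) :=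
    continuousAt_snd.tendsto
  obtain ⟨N, hN, hNo, hN0⟩ := eventually_nhds_iff.mp
    ((hev.and (hsnd.eventually hY.eventually_analyticAt)).and (hsnd.eventually hU))
  rw [mem_nhdsWithin]
  refine ⟨arcPoint L '' N, isOpenMap_arcPoint L N hNo, ⟨_, hN0, arcPoint_zero L _⟩, ?_⟩
  rintro _ ⟨⟨x, hx, rfl⟩, hxc⟩
  have hcl := (arcPoint_mem_compactCurve_iff L p hsum).mp hxc
  obtain ⟨⟨-, hYx⟩, hxU⟩ := hN x hx
  -- There are finitely many permutations, so being off all the permuted branches is an open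
  -- condition; it would then hold at nearby ansatz points.
  have hex : ∃ σ : Equiv.Perm (Fin n), x.1 = (multiPoint p k hk + x.2 • Y x.2) ∘ σ := by
    by_contra! hne
    have h1 (σ : Equiv.Perm (Fin n)) : ∀ᶠ z in 𝓝 x,
        z.1 ≠ (multiPoint p k hk + z.2 • Y z.2) ∘ σ := by
      have h2 : ContinuousAt (fun z : (Fin n → ℂ) × ℂ ↦
          z.1 - (multiPoint p k hk + z.2 • Y z.2) ∘ σ) x := by
        refine continuousAt_fst.sub ?_
        have h3 : ContinuousAt (fun z : (Fin n → ℂ) × ℂ ↦ multiPoint p k hk + z.2 • Y z.2) x :=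
          continuousAt_const.add (continuousAt_snd.smul
            (ContinuousAt.comp hYx.continuousAt continuousAt_snd))
        exact continuousAt_pi.mpr fun μ ↦ continuousAt_pi.mp h3 (σ μ)
      filter_upwards [h2.eventually_ne (sub_ne_zero.mpr (hne σ))] with z hz
      exact sub_ne_zero.mp hz
    obtain ⟨z, hz, hz1, hz2⟩ := ((mem_closure_iff_frequently.mp hcl).and_eventually
      ((eventually_all.mpr h1).and (hNo.mem_nhds hx))).exists
    obtain ⟨σ, -, hσ⟩ := (hN z hz2).1.1 hz
    exact hz1 σ hσ
  obtain ⟨σ, hσ⟩ := hex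
  refine ⟨x.2, hxU, ?_⟩
  have : x = ((multiPoint p k hk + x.2 • Y x.2) ∘ σ, x.2) := Prod.ext hσ rfl
  rw [this, arcPoint_perm]
  rfl

lemma exists_reparametrization (hsum : ∑ i, w i = (n : ℂ)) {Y : ℂ → Fin n → ℂ}
    (hY : AnalyticAt ℂ Y 0)
    (hev : ∀ᶠ x in 𝓝 (multiPoint p k hk, (0 : ℂ)), x ∈ ansatzSet L p w n →
      ∃ σ : Equiv.Perm (Fin n), (∀ μ, block k hk (σ μ) = block k hk μ) ∧
        x.1 = (multiPoint p k hk + x.2 • Y x.2) ∘ σ)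
    {d : ℂ → (Fin n → ℂ) × ℂ}
    (hd : IsArcAt L p w (mk L (multiPoint p k hk) OnePoint.infty) d) :
    ∃ φ : ℂ → ℂ, AnalyticAt ℂ φ 0 ∧ φ 0 = 0 ∧
      (∀ᶠ t in 𝓝 (0 : ℂ), arcPoint L (d t) = arcPoint L (branchArc p k hk Y (φ t))) ∧
      (deriv d 0 ≠ 0 → deriv φ 0 ≠ 0) := by
  obtain ⟨hda, hd0, hdc⟩ := hd
  obtain ⟨σ, ω, hm⟩ := (quot_mk_eq_iff L _ _).mp hd0
  have hm1 := congrArg Prod.fst hm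
  have hm2 := congrArg Prod.snd hm
  set η : ℂ := ∑ μ, quasiPeriodHom L (ω μ) with hη
  have hv0 : (d 0).2 = 0 := by
    rw [← invPoint_eq_infty_iff]
    cases h : invPoint (d 0).2 using OnePoint.rec with
    | infty => rfl
    | coe z => simp [move, h] at hm2
  have hv : AnalyticAt ℂ (fun t ↦ (d t).2) 0 := analyticAt_snd.fun_comp hda
  have hdμ (μ : Fin n) : AnalyticAt ℂ (fun t ↦ (d t).1 μ) 0 :=
    analyticAt_pi_iff.mp (analyticAt_fst.fun_comp hda) μ
  have hden : AnalyticAt ℂ (fun t ↦ 1 + η * (d t).2) 0 :=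
    analyticAt_const.add (analyticAt_const.mul hv)
  have hden0 : 1 + η * (d 0).2 ≠ 0 := by simp [hv0]
  -- A lattice translation replaces `h` by `h + η`, hence `v = 1 / h` by `v / (1 + η v)`.
  set φ : ℂ → ℂ := fun t ↦ (d t).2 / (1 + η * (d t).2) with hφ
  have hφa : AnalyticAt ℂ φ 0 := hv.div hden hden0
  have hφ0 : φ 0 = 0 := by simp [hφ, hv0]
  set e : ℂ → (Fin n → ℂ) × ℂ := fun t ↦ (fun μ ↦ (d t).1 (σ μ) + ω μ, φ t) with he
  have hea : AnalyticAt ℂ e 0 :=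
    (analyticAt_pi_iff.mpr fun μ ↦ (hdμ (σ μ)).add analyticAt_const).prod hφa
  have he0 : e 0 = (multiPoint p k hk, 0) := Prod.ext hm1.symm hφ0
  have hed : ∀ᶠ t in 𝓝 (0 : ℂ), arcPoint L (e t) = arcPoint L (d t) := by
    filter_upwards [hden.continuousAt.eventually_ne hden0] with t ht
    refine Eq.trans ?_ (mk_move L σ ω ((d t).1, invPoint (d t).2))
    rw [arcPoint, mk]
    congr 1
    refine Prod.ext rfl ?_
    simp only [move, he, hφ]
    by_cases h0 : (d t).2 = 0
    · simp [h0, invPoint_zero]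
    · rw [invPoint_of_ne h0, invPoint_of_ne (div_ne_zero h0 ht), OnePoint.map_some, ← hη]
      congr 1
      field_simp
  have hebr : ∀ᶠ t in 𝓝[≠] (0 : ℂ), ∃ τ : Equiv.Perm (Fin n),
      (∀ μ, block k hk (τ μ) = block k hk μ) ∧
        (e t).1 = (multiPoint p k hk + φ t • Y (φ t)) ∘ τ := by
    have h1 := hea.continuousAt.tendsto
    rw [he0] at h1
    filter_upwards [(h1.eventually hev).filter_mono nhdsWithin_le_nhds, hdc,
      hed.filter_mono nhdsWithin_le_nhds] with t h2 h3 h4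
    rw [← h4, arcPoint_mem_curve_iff L p hsum] at h3
    exact h2 h3
  refine ⟨φ, hφa, hφ0, ?_, fun hne hφ' ↦ hne ?_⟩
  · have h1 : ∀ᶠ t in 𝓝[≠] (0 : ℂ),
        arcPoint L (d t) = arcPoint L (branchArc p k hk Y (φ t)) := by
      filter_upwards [hed.filter_mono nhdsWithin_le_nhds, hebr] with t h1 ⟨τ, _, h2⟩
      have h3 : e t = ((multiPoint p k hk + φ t • Y (φ t)) ∘ τ, φ t) := Prod.ext h2 rfl
      rw [← h1, h3, arcPoint_perm]
      rfl
    rw [← nhdsNE_sup_pure, eventually_sup, eventually_pure]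
    refine ⟨h1, ?_⟩
    rw [hd0, hφ0, branchArc_zero, arcPoint_zero]
  · have hφd : HasDerivAt φ 0 0 := by
      have := hφa.differentiableAt.hasDerivAt
      rwa [hφ'] at this
    have hD := hda.differentiableAt.hasDerivAt
    set D := deriv d 0
    have hD1 : HasDerivAt (fun t ↦ (d t).1) D.1 0 := 
      (ContinuousLinearMap.fst ℂ (Fin n → ℂ) ℂ).hasFDerivAt.comp_hasDerivAt (0 : ℂ) hD
    have hD2 : HasDerivAt (fun t ↦ (d t).2) D.2 0 := 
      (ContinuousLinearMap.snd ℂ (Fin n → ℂ) ℂ).hasFDerivAt.comp_hasDerivAt (0 : ℂ) hD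
    have hs : D.2 = 0 := by
      have h1 := (hD2.div ((hD2.const_mul η).const_add 1) hden0).unique hφd
      simpa [hv0] using h1
    -- The permutation relating the arc to the branch may depend on `t`, so the branch formula is
    -- not differentiated. Instead the displacement is bounded by `‖φ‖ ‖Y ∘ φ‖`, which is `o(t)` if
    -- `φ'(0) = 0`.
    have hf (μ : Fin n) : D.1 (σ μ) = 0 := by
      have h1 : HasDerivAt (fun t ↦ (e t).1 μ) (D.1 (σ μ)) 0 :=
        (hasDerivAt_pi.mp hD1 (σ μ)).add_const _
      refine h1.unique ?_
      rw [hasDerivAt_iff_isLittleO] at hφd ⊢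
      simp only [hφ0, smul_zero, sub_zero] at hφd ⊢
      refine Asymptotics.IsBigO.trans_isLittleO ?_ hφd
      have hYφ : (fun t ↦ Y (φ t)) =O[𝓝 0] fun _ ↦ (1 : ℝ) := by
        have h2 : ContinuousAt (fun t ↦ Y (φ t)) 0 :=
          ContinuousAt.comp_of_eq hY.continuousAt hφa.continuousAt hφ0
        exact h2.tendsto.isBigO_one ℝ
      have h3 : (fun t ↦ (e t).1 μ - (e 0).1 μ) =O[𝓝 0] fun t ↦ ‖φ t‖ * ‖Y (φ t)‖ := by
        refine Asymptotics.IsBigO.of_bound 1 ?_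
        rw [← nhdsNE_sup_pure, eventually_sup, eventually_pure]
        refine ⟨?_, by simp [hφ0]⟩
        filter_upwards [hebr] with t ⟨τ, hτ, h4⟩
        rw [h4, he0]
        simp only [Function.comp_apply, Pi.add_apply, multiPoint, hτ, add_sub_cancel_left,
          Pi.smul_apply, smul_eq_mul, norm_mul, norm_norm, one_mul]
        exact mul_le_mul_of_nonneg_left (norm_le_pi_norm _ _) (norm_nonneg _)
      refine h3.trans ?_
      have h5 := (Asymptotics.isBigO_refl φ (𝓝 0)).norm_norm.mul hYφ.norm_left
      simp only [mul_one] at h5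
      exact h5.of_norm_right
    refine Prod.ext (funext fun μ ↦ ?_) hs
    simpa using hf (σ.symm μ)

end Branch

/-! ### The boundary points with `h = ∞`. -/

section BoundaryPoints
variable (L : PeriodPair) {r n : ℕ} {p w : Fin r → ℂ}

/-- At a boundary point with `h = ∞` all points lie over the `p_i`. -/
lemma exists_sub_mem_lattice_of_mem_closure (hsum : ∑ i, w i = (n : ℂ)) {a : Fin n → ℂ}
    (h : (a, (0 : ℂ)) ∈ closure (ansatzSet L p w n)) (μ : Fin n) :
    ∃ i, a μ - p i ∈ L.lattice := by
  classical
  by_contra! hcon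
  -- `Q` is the cluster of points congruent to `a μ`. In the sum of the Bethe values over `Q` the
  -- terms within `Q` cancel by oddness, and what is left is continuous at `a`.
  set Q : Finset (Fin n) := Finset.univ.filter fun ν ↦ a ν - a μ ∈ L.lattice with hQ
  have hmem {ν : Fin n} : ν ∈ Q ↔ a ν - a μ ∈ L.lattice := by simp [hQ]
  have hμQ : μ ∈ Q := by rw [hmem, sub_self]; exact L.lattice.zero_mem
  set B : (Fin n → ℂ) → ℂ := fun x ↦ ∑ ν ∈ Q, (∑ i, w i * weierstrassZeta L (x ν - p i) -
    ∑ ρ ∈ Qᶜ, weierstrassZeta L (x ν - x ρ)) with hB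
  have hBe (x : Fin n → ℂ) : ∑ ν ∈ Q, ellipticBethe L p w x ν = B x := by
    have h1 : ∑ ν ∈ Q, ∑ ρ ∈ Q.erase ν, weierstrassZeta L (x ν - x ρ) = 0 := by
      have h2 := sum_erase_comm Q fun ν ρ ↦ weierstrassZeta L (x ν - x ρ)
      have h3 : ∑ ν ∈ Q, ∑ ρ ∈ Q.erase ν, weierstrassZeta L (x ρ - x ν) =
          -∑ ν ∈ Q, ∑ ρ ∈ Q.erase ν, weierstrassZeta L (x ν - x ρ) := by
        simp only [← Finset.sum_neg_distrib, ← weierstrassZeta_neg, neg_sub]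
      rw [h3] at h2
      linear_combination h2 / 2
    have h2 (ν : Fin n) (hν : ν ∈ Q) : ∑ ρ ∈ Finset.univ.erase ν, weierstrassZeta L (x ν - x ρ) =
        ∑ ρ ∈ Q.erase ν, weierstrassZeta L (x ν - x ρ) +
          ∑ ρ ∈ Qᶜ, weierstrassZeta L (x ν - x ρ) := by
      rw [← Finset.sum_union]
      · congr 1
        ext ρ
        by_cases hρ : ρ = ν
        · subst hρ; simpa using hν
        · simp only [Finset.mem_erase, Finset.mem_univ, Finset.mem_union, Finset.mem_compl, hρ,
            ne_eq, not_false_eq_true, true_and, true_iff]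
          tauto
      · exact Finset.disjoint_left.mpr fun ρ h h' ↦
          Finset.mem_compl.mp h' (Finset.mem_of_mem_erase h)
    calc ∑ ν ∈ Q, ellipticBethe L p w x ν = ∑ ν ∈ Q, ((∑ i, w i * weierstrassZeta L (x ν - p i) -
          ∑ ρ ∈ Qᶜ, weierstrassZeta L (x ν - x ρ)) -
            ∑ ρ ∈ Q.erase ν, weierstrassZeta L (x ν - x ρ)) :=
          Finset.sum_congr rfl fun ν hν ↦ by rw [ellipticBethe, h2 ν hν]; ring
      _ = B x := by rw [Finset.sum_sub_distrib, h1, sub_zero]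
  have hBc : ContinuousAt B a := by
    have hcoord (ν : Fin n) : ContinuousAt (fun x : Fin n → ℂ ↦ x ν) a :=
      (continuous_apply ν).continuousAt
    refine tendsto_finsetSum _ fun ν hν ↦ ContinuousAt.sub ?_ ?_
    · refine tendsto_finsetSum _ fun i _ ↦ continuousAt_const.mul ?_
      refine ContinuousAt.comp (g := weierstrassZeta L) ?_ ((hcoord ν).sub continuousAt_const)
      refine (analyticAt_weierstrassZeta L fun h' ↦ hcon i ?_).continuousAt
      have := L.lattice.sub_mem h' (hmem.mp hν)
      simpa using this
    · refine tendsto_finsetSum _ fun ρ hρ ↦ ?_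
      refine ContinuousAt.comp (g := weierstrassZeta L) ?_ ((hcoord ν).sub (hcoord ρ))
      refine (analyticAt_weierstrassZeta L fun h' ↦ Finset.mem_compl.mp hρ (hmem.mpr ?_)).continuousAt
      have := L.lattice.sub_mem (hmem.mp hν) h'
      simpa using this
  have hne : (𝓝[ansatzSet L p w n] (a, (0 : ℂ))).NeBot := mem_closure_iff_nhdsWithin_neBot.mp h
  have h1 : Tendsto (fun x : (Fin n → ℂ) × ℂ ↦ x.2 * B x.1) (𝓝[ansatzSet L p w n] (a, 0))
      (𝓝 (0 * B a)) := by
    have h2 : ContinuousAt (fun x : (Fin n → ℂ) × ℂ ↦ x.2 * B x.1) (a, 0) :=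
      continuousAt_snd.mul (ContinuousAt.comp (g := B) hBc continuousAt_fst)
    exact h2.tendsto.mono_left nhdsWithin_le_nhds
  -- On the curve the same sum equals `Q.card * h`, so multiplication by `u = 1 / h` gives the
  -- constant `Q.card`, which must therefore be `0`.
  have h2 : Tendsto (fun x : (Fin n → ℂ) × ℂ ↦ x.2 * B x.1) (𝓝[ansatzSet L p w n] (a, 0))
      (𝓝 (Q.card : ℂ)) := by
    refine tendsto_const_nhds.congr' ?_
    filter_upwards [self_mem_nhdsWithin] with x hx
    rw [← hBe, Finset.sum_congr rfl fun ν _ ↦ ((isAnsatz_iff L p hsum _ _).mp hx.2).2.2 ν,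
      Finset.sum_const, nsmul_eq_mul, mul_comm, mul_assoc, inv_mul_cancel₀ hx.1, mul_one]
  have h3 := tendsto_nhds_unique h1 h2
  rw [zero_mul, eq_comm, Nat.cast_eq_zero, Finset.card_eq_zero] at h3
  rw [h3] at hμQ
  exact absurd hμQ (Finset.notMem_empty μ)

/-- With `k` the fibre cardinalities of `j`, the fibres of `j` and of `block` are equinumerous;
bijections between them assemble to `σ`. -/
lemma exists_perm_block_eq (j : Fin n → Fin r) : ∃ (k : Fin r → ℕ) (hk : ∑ i, k i = n)
    (σ : Equiv.Perm (Fin n)), ∀ μ, j (σ μ) = block k hk μ := by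
  classical
  have hk : ∑ i, (Finset.univ.filter fun μ ↦ j μ = i).card = n := by
    rw [← Finset.card_eq_sum_card_fiberwise fun μ _ ↦ Finset.mem_univ (j μ)]
    simp
  have e (i : Fin r) : Nonempty ({μ // block _ hk μ = i} ≃ {μ // j μ = i}) := by
    refine ⟨Fintype.equivOfCardEq ?_⟩
    rw [Fintype.card_subtype, Fintype.card_subtype]
    exact card_blockSet (hk := hk) i
  exact ⟨_, hk, Equiv.ofFiberEquiv fun i ↦ (e i).some, fun μ ↦ Equiv.ofFiberEquiv_map _ μ⟩

lemma exists_admissible_of_mem_compactCurve (hp : ∀ i j, i ≠ j → p i - p j ∉ L.lattice)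
    (hsum : ∑ i, w i = (n : ℂ)) {a : Fin n → ℂ}
    (h : mk L a OnePoint.infty ∈ compactCurve L n p w) :
    ∃ (k : Fin r → ℕ) (hk : ∑ i, k i = n), Admissible w k ∧
      mk L a OnePoint.infty = mk L (multiPoint p k hk) OnePoint.infty := by
  have h1 := h
  rw [← arcPoint_zero, arcPoint_mem_compactCurve_iff L p hsum] at h1
  choose j hj using exists_sub_mem_lattice_of_mem_closure L hsum h1
  obtain ⟨k, hk, σ, hσ⟩ := exists_perm_block_eq j
  have he : mk L a OnePoint.infty = mk L (multiPoint p k hk) OnePoint.infty := by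
    refine (quot_mk_eq_iff L _ _).mpr
      ⟨σ, fun μ ↦ -⟨a (σ μ) - p (j (σ μ)), hj (σ μ)⟩, Prod.ext ?_ rfl⟩
    ext μ
    simp [move, multiPoint, hσ]
  refine ⟨k, hk, ?_, he⟩
  rw [he, ← arcPoint_zero, arcPoint_mem_compactCurve_iff L p hsum] at h
  exact admissible_of_mem_closure hp hsum h

lemma infinity_boundary_eq (hp : ∀ i j, i ≠ j → p i - p j ∉ L.lattice)
    (hsum : ∑ i, w i = (n : ℂ)) :
    (compactCurve L n p w \ curve L n p w) ∩ infinityDivisor L n =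
      {x | ∃ (k : Fin r → ℕ) (hk : ∑ i, k i = n), Admissible w k ∧
        x = mk L (multiPoint p k hk) OnePoint.infty} := by
  ext x
  constructor
  · rintro ⟨⟨hx, -⟩, a, rfl⟩
    exact exists_admissible_of_mem_compactCurve L hp hsum hx
  · rintro ⟨k, hk, hadm, rfl⟩
    refine ⟨⟨?_, mk_infty_notMem_curve L p⟩, _, rfl⟩
    obtain ⟨b, hb⟩ := exists_isLaguerreSystem w k hk
    obtain ⟨Y, hY, hY0, heq, -⟩ := exists_branch L hp hadm hb
    obtain ⟨h0, hinj, -⟩ := (isLaguerreSystem_iff_blockBethe hadm one_ne_zero).mp hb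
    rw [← hY0] at h0 hinj
    rw [← arcPoint_zero, arcPoint_mem_compactCurve_iff L p hsum]
    refine mem_closure_of_tendsto ?_
      (eventually_mem_ansatzSet L hp hsum hY.continuousAt h0 hinj heq)
    have := (analyticAt_branchArc (p := p) (k := k) (hk := hk) hY).continuousAt.tendsto
    rw [branchArc_zero] at this
    exact this.mono_left nhdsWithin_le_nhds

end BoundaryPoints

/-! ### Orders of vanishing of analytic functions. -/

section Orders

lemma AnalyticAt.exists_eq_pow_mul_of_isBigO {f : ℂ → ℂ} (hf : AnalyticAt ℂ f 0) {N : ℕ}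
    (h : f =O[𝓝[≠] 0] fun t ↦ t ^ N) :
    ∃ g : ℂ → ℂ, AnalyticAt ℂ g 0 ∧ ∀ᶠ t in 𝓝[≠] (0 : ℂ), f t = t ^ N * g t := by
  induction N with
  | zero => exact ⟨f, hf, by simp⟩
  | succ N ih =>
    have hlt : (fun t : ℂ ↦ t ^ (N + 1)) =O[𝓝[≠] 0] fun t ↦ t ^ N := by
      have h1 : (fun t : ℂ ↦ t) =O[𝓝[≠] 0] fun _ ↦ (1 : ℂ) :=
        (tendsto_id.mono_left nhdsWithin_le_nhds : Tendsto id (𝓝[≠] (0 : ℂ)) (𝓝 0)).isBigO_one ℂ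
      simpa [pow_succ] using (Asymptotics.isBigO_refl (fun t : ℂ ↦ t ^ N) _).mul h1
    obtain ⟨g, hg, hfg⟩ := ih (h.trans hlt)
    have hgO : g =O[𝓝[≠] 0] fun t ↦ t := by
      obtain ⟨C, hC⟩ := h.bound
      refine Asymptotics.IsBigO.of_bound C ?_
      filter_upwards [hC, hfg, self_mem_nhdsWithin] with t h1 h2 h3
      rw [h2, norm_mul, pow_succ, norm_mul, mul_left_comm] at h1
      have h4 : 0 < ‖t ^ N‖ := norm_pos_iff.mpr (pow_ne_zero _ h3)
      exact le_of_mul_le_mul_left h1 h4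
    have hg0 : g 0 = 0 := by
      have h1 : Tendsto g (𝓝[≠] 0) (𝓝 0) :=
        hgO.trans_tendsto (tendsto_id.mono_left nhdsWithin_le_nhds)
      exact tendsto_nhds_unique (hg.continuousAt.tendsto.mono_left nhdsWithin_le_nhds) h1
    have hg' : (1 : ℕ∞) ≤ analyticOrderAt g 0 := by
      rw [Order.one_le_iff_ne_zero, hg.analyticOrderAt_ne_zero]
      exact hg0
    obtain ⟨q, hq, hgq⟩ := (natCast_le_analyticOrderAt hg (n := 1)).mp (by exact_mod_cast hg')
    refine ⟨q, hq, ?_⟩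
    filter_upwards [hfg, hgq.filter_mono nhdsWithin_le_nhds] with t h1 h2
    rw [h1, h2]
    simp only [sub_zero, pow_one, smul_eq_mul]
    ring

/-- Analyticity leaves no growth between consecutive powers: a function which is `o(t ^ N)` is
already `O(t ^ (N + 1))`. -/
lemma AnalyticAt.isBigO_pow_succ_iff {f : ℂ → ℂ} (hf : AnalyticAt ℂ f 0) {N : ℕ} {e : ℂ}
    (h : (fun t ↦ f t - e * t ^ N) =o[𝓝[≠] 0] fun t ↦ t ^ N) :
    f =O[𝓝[≠] 0] (fun t ↦ t ^ (N + 1)) ↔ e = 0 := by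
  have hsucc : (fun t : ℂ ↦ t ^ (N + 1)) =o[𝓝[≠] 0] fun t ↦ t ^ N := by
    have h1 : (fun t : ℂ ↦ t) =o[𝓝[≠] 0] fun _ ↦ (1 : ℂ) :=
      (Asymptotics.isLittleO_one_iff ℂ).mpr (tendsto_id.mono_left nhdsWithin_le_nhds)
    simpa [pow_succ] using (Asymptotics.isBigO_refl (fun t : ℂ ↦ t ^ N) _).mul_isLittleO h1
  constructor
  · intro hO
    have h1 := (hO.trans_isLittleO hsucc).sub h
    simp only [sub_sub_cancel] at h1
    by_contra he
    refine Asymptotics.isLittleO_irrefl (f'' := fun t : ℂ ↦ t ^ N) (l := 𝓝[≠] 0) ?_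
      ((Asymptotics.isLittleO_const_mul_left_iff he).mp h1)
    refine Eventually.frequently ?_
    filter_upwards [self_mem_nhdsWithin] with t ht
    exact pow_ne_zero _ ht
  · rintro rfl
    simp only [zero_mul, sub_zero] at h
    obtain ⟨g, hg, hfg⟩ := exists_eq_pow_mul_of_isBigO hf h.isBigO
    have hg0 : g 0 = 0 := by
      have h1 : Tendsto g (𝓝[≠] 0) (𝓝 0) := by
        refine h.tendsto_div_nhds_zero.congr' ?_
        filter_upwards [hfg, self_mem_nhdsWithin] with t h1 h2
        rw [h1, mul_div_cancel_left₀ _ (pow_ne_zero _ h2)]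
      exact tendsto_nhds_unique (hg.continuousAt.tendsto.mono_left nhdsWithin_le_nhds) h1
    have hgO : g =O[𝓝[≠] 0] fun t ↦ t := by
      have := hg.differentiableAt.isBigO_sub
      simp only [hg0, sub_zero] at this
      exact this.mono nhdsWithin_le_nhds
    have h2 := (Asymptotics.isBigO_refl (fun t : ℂ ↦ t ^ N) (𝓝[≠] 0)).mul hgO
    simp only [← pow_succ] at h2
    exact h2.congr' (hfg.mono fun t ht ↦ ht.symm) .rfl

end Orders

/-! ### The inductive construction of the coefficients. -/

section Coefficients
variable (L : PeriodPair) {r n : ℕ} {p w : Fin r → ℂ} {k : Fin r → ℕ} {hk : ∑ i, k i = n}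

/-- The differences of the rescaled Bethe equations and their mean, multiplied by `n`. -/
def betheGap (p w : Fin r → ℂ) (k : Fin r → ℕ) (hk : ∑ i, k i = n) (x : ℂ × (Fin n → ℂ))
    (μ : Fin n) : ℂ :=
  ∑ ν, scaledBethe L p w k hk x ν - n * scaledBethe L p w k hk x μ

lemma mul_lameEq (hsum : ∑ i, w i = (n : ℂ)) {u : ℂ} (hu : u ≠ 0) (y : Fin n → ℂ) (μ : Fin n) :
    u * lameEq L p w (multiPoint p k hk + u • y) μ = betheGap L p w k hk (u, y) μ := by
  simp only [betheGap, ← mul_ellipticBethe L p w k hk hu]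
  rw [lameEq_eq L p hsum, ← sum_ellipticBethe, mul_sub, Finset.mul_sum]
  ring

/-- `a(t) = (k_1 p_1, …, k_r p_r) + t y(t)` for the polynomial arc `a`. -/
def scaledArc (α : ℕ → Fin n → ℂ) (m : ℕ) (t : ℂ) : Fin n → ℂ :=
  fun μ ↦ ∑ i ∈ Finset.range m, α (i + 1) μ * t ^ i

lemma truncatedArc_eq (α : ℕ → Fin n → ℂ) (m : ℕ) (t : ℂ) :
    truncatedArc p k hk α m t = multiPoint p k hk + t • scaledArc α m t := by
  ext μ
  simp only [truncatedArc, Pi.add_apply, Pi.smul_apply, scaledArc, smul_eq_mul, Finset.mul_sum]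
  congr 1
  rw [← Finset.Ico_add_one_right_eq_Icc, Finset.sum_Ico_eq_sum_range]
  refine Finset.sum_congr (by simp) fun i _ ↦ ?_
  rw [add_comm 1 i]
  ring

lemma scaledArc_zero (α : ℕ → Fin n → ℂ) (m : ℕ) : scaledArc α (m + 1) 0 = α 1 := by
  ext μ
  simp [scaledArc, Finset.sum_range_succ']

lemma analyticAt_scaledArc (α : ℕ → Fin n → ℂ) (m : ℕ) : AnalyticAt ℂ (scaledArc α m) 0 :=
  analyticAt_pi_iff.mpr fun _ ↦ Finset.analyticAt_fun_sum _ fun _ _ ↦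
    analyticAt_const.mul (analyticAt_id.pow _)

lemma solvesToOrder_iff (hsum : ∑ i, w i = (n : ℂ)) (m : ℕ) (α : ℕ → Fin n → ℂ) :
    SolvesToOrder L p w k hk m α ↔ (∀ μ, α 1 μ ≠ 0) ∧
      (∀ μ ν, μ ≠ ν → block k hk μ = block k hk ν → α 1 μ ≠ α 1 ν) ∧
      ∀ μ, (fun t ↦ betheGap L p w k hk (t, scaledArc α (m + 1) t) μ) =O[𝓝[≠] (0 : ℂ)]
        fun t ↦ t ^ (m + 1) := by
  refine and_congr_right fun _ ↦ and_congr_right fun _ ↦ forall_congr' fun μ ↦ ?_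
  have h1 : (fun t ↦ betheGap L p w k hk (t, scaledArc α (m + 1) t) μ) =ᶠ[𝓝[≠] (0 : ℂ)]
      fun t ↦ t * lameEq L p w (truncatedArc p k hk α (m + 1) t) μ := by
    filter_upwards [self_mem_nhdsWithin] with t ht
    rw [truncatedArc_eq, mul_lameEq L hsum ht]
  rw [Asymptotics.isBigO_congr h1 .rfl]
  constructor
  · intro h
    simpa only [pow_succ'] using (Asymptotics.isBigO_refl (fun t : ℂ ↦ t) _).mul h
  · intro h
    obtain ⟨C, hC⟩ := h.bound
    refine Asymptotics.IsBigO.of_bound C ?_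
    filter_upwards [hC, self_mem_nhdsWithin] with t h2 h3
    rw [norm_mul, pow_succ', norm_mul, mul_left_comm] at h2
    exact le_of_mul_le_mul_left h2 (norm_pos_iff.mpr h3)

lemma analyticAt_betheGap (hp : ∀ i j, i ≠ j → p i - p j ∉ L.lattice) {b : Fin n → ℂ}
    (h0 : ∀ μ, b μ ≠ 0) (hb : ∀ μ ν, μ ≠ ν → block k hk μ = block k hk ν → b μ ≠ b ν)
    (μ : Fin n) : AnalyticAt ℂ (fun x ↦ betheGap L p w k hk x μ) (0, b) := by
  have h := analyticAt_pi_iff.mp (analyticAt_scaledBethe L w k hk hp h0 hb)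
  exact (Finset.analyticAt_fun_sum _ fun ν _ ↦ h ν).sub (analyticAt_const.mul (h μ))

lemma analyticAt_betheGap_scaledArc (hp : ∀ i j, i ≠ j → p i - p j ∉ L.lattice)
    {α : ℕ → Fin n → ℂ} (h0 : ∀ μ, α 1 μ ≠ 0)
    (hb : ∀ μ ν, μ ≠ ν → block k hk μ = block k hk ν → α 1 μ ≠ α 1 ν) (m : ℕ) (μ : Fin n) :
    AnalyticAt ℂ (fun t ↦ betheGap L p w k hk (t, scaledArc α (m + 1) t) μ) 0 :=
  AnalyticAt.fun_comp_of_eq (analyticAt_betheGap L hp h0 hb μ)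
    (analyticAt_id.prod (analyticAt_scaledArc α (m + 1))) (by simp [scaledArc_zero])

lemma fderiv_betheGap (hp : ∀ i j, i ≠ j → p i - p j ∉ L.lattice) {b : Fin n → ℂ}
    (h0 : ∀ μ, b μ ≠ 0) (hb : ∀ μ ν, μ ≠ ν → block k hk μ = block k hk ν → b μ ≠ b ν)
    (v : Fin n → ℂ) (μ : Fin n) :
    fderiv ℂ (fun x ↦ betheGap L p w k hk x μ) (0, b) (0, v) =
      ∑ ν, blockBetheDeriv w k hk b v ν - n * blockBetheDeriv w k hk b v μ := by
  have hF := (analyticAt_scaledBethe L w k hk hp h0 hb).differentiableAt.hasFDerivAt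
  have hFμ := hasFDerivAt_pi'.mp hF
  have h1 := (HasFDerivAt.fun_sum (u := Finset.univ) fun ν _ ↦ hFμ ν).sub
    ((hFμ μ).const_mul (n : ℂ))
  have h2 : fderiv ℂ (fun x ↦ betheGap L p w k hk x μ) (0, b) = _ := h1.fderiv
  rw [h2]
  simp [fderiv_scaledBethe L w k hk hp h0 hb]

/-- A vector with vanishing lowest-order gaps has equal Bethe sums. -/
lemma betheGap_eq_zero_iff {b : Fin n → ℂ} (hn : n ≠ 0) :
    (∀ μ, betheGap L p w k hk (0, b) μ = 0) ↔ ∃ κ, ∀ μ, blockBethe w k hk b μ = κ := by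
  have hn' : (n : ℂ) ≠ 0 := Nat.cast_ne_zero.mpr hn
  simp only [betheGap, scaledBethe_zero]
  constructor
  · intro h
    refine ⟨(∑ ν, blockBethe w k hk b ν) / n, fun μ ↦ ?_⟩
    rw [eq_div_iff hn', mul_comm]
    exact (sub_eq_zero.mp (h μ)).symm
  · rintro ⟨κ, h⟩ μ
    simp [h]

lemma blockBethe_ne_zero (hadm : Admissible w k) {κ : ℂ} {b : Fin n → ℂ} (h0 : ∀ μ, b μ ≠ 0)
    (hb : ∀ μ ν, μ ≠ ν → block k hk μ = block k hk ν → b μ ≠ b ν)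
    (hβ : ∀ μ, blockBethe w k hk b μ = κ) (hn : n ≠ 0) : κ ≠ 0 := by
  obtain ⟨μ⟩ : Nonempty (Fin n) := ⟨⟨0, Nat.pos_of_ne_zero hn⟩⟩
  refine bethe_ne_zero (s := blockSet k hk (block k hk μ)) (w := w (block k hk μ)) (b := b)
    ⟨μ, by simp⟩ ?_ (injOn_blockSet hb _) (fun ν _ ↦ h0 ν) fun ν hν ↦ ?_
  · rw [card_blockSet]
    exact hadm _
  · rw [← hβ ν, blockBethe, mem_blockSet.mp hν]

variable {L}

lemma SolvesToOrder.betheGap_eq_zero (hp : ∀ i j, i ≠ j → p i - p j ∉ L.lattice)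
    (hsum : ∑ i, w i = (n : ℂ)) {m : ℕ} {α : ℕ → Fin n → ℂ}
    (h : SolvesToOrder L p w k hk m α) (μ : Fin n) : betheGap L p w k hk (0, α 1) μ = 0 := by
  obtain ⟨h0, hb, hO⟩ := (solvesToOrder_iff L hsum m α).mp h
  have h1 := (analyticAt_betheGap_scaledArc L (w := w) hp h0 hb m μ).continuousAt.tendsto
  simp only [scaledArc_zero] at h1
  refine tendsto_nhds_unique (h1.mono_left nhdsWithin_le_nhds) ((hO μ).trans_tendsto ?_)
  have h2 : Tendsto (fun t : ℂ ↦ t ^ (m + 1)) (𝓝 0) (𝓝 (0 ^ (m + 1))) :=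
    tendsto_id.pow (m + 1)
  rw [zero_pow m.succ_ne_zero] at h2
  exact h2.mono_left nhdsWithin_le_nhds

variable (L)

/-- The lowest order of the inductive construction. -/
lemma solvesToOrder_zero_iff (hp : ∀ i j, i ≠ j → p i - p j ∉ L.lattice)
    (hsum : ∑ i, w i = (n : ℂ)) (hadm : Admissible w k) (b : Fin n → ℂ) :
    SolvesToOrder L p w k hk 0 (fun _ ↦ b) ↔ ∃ c : ℂ, c ≠ 0 ∧ IsLaguerreSystem w k hk c b := by
  rcases eq_or_ne n 0 with hn | hn
  · subst hn
    refine ⟨fun _ ↦ ⟨1, one_ne_zero, (isLaguerreSystem_iff_blockBethe hadm one_ne_zero).mpr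
      ⟨fun μ ↦ μ.elim0, fun μ ↦ μ.elim0, fun μ ↦ μ.elim0⟩⟩,
      fun _ ↦ ⟨fun μ ↦ μ.elim0, fun μ ↦ μ.elim0, fun μ ↦ μ.elim0⟩⟩
  constructor
  · intro h
    obtain ⟨κ, hκ⟩ := (betheGap_eq_zero_iff L (p := p) hn).mp (h.betheGap_eq_zero hp hsum)
    -- The scaling factor is the inverse of the common Bethe value, which admissibility keeps
    -- nonzero.
    have hκ0 := blockBethe_ne_zero hadm h.1 h.2.1 hκ hn
    refine ⟨1 / κ, one_div_ne_zero hκ0,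
      (isLaguerreSystem_iff_blockBethe hadm (one_div_ne_zero hκ0)).mpr ⟨h.1, h.2.1, ?_⟩⟩
    rwa [one_div_one_div]
  · rintro ⟨c, hc, h⟩
    obtain ⟨h0, hb, hβ⟩ := (isLaguerreSystem_iff_blockBethe hadm hc).mp h
    refine (solvesToOrder_iff L hsum 0 _).mpr ⟨h0, hb, fun μ ↦ ?_⟩
    have h1 := (analyticAt_betheGap_scaledArc L (w := w) (α := fun _ ↦ b) hp h0 hb 0
      μ).differentiableAt.isBigO_sub
    simp only [scaledArc_zero, (betheGap_eq_zero_iff L (p := p) hn).mpr ⟨_, hβ⟩ μ, sub_zero,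
      zero_add] at h1
    simp only [zero_add, pow_one]
    exact h1.mono nhdsWithin_le_nhds

/-- The step of the inductive construction. -/
lemma exists_solvesToOrder_succ (hp : ∀ i j, i ≠ j → p i - p j ∉ L.lattice)
    (hsum : ∑ i, w i = (n : ℂ)) (hadm : Admissible w k) (m : ℕ) (α : ℕ → Fin n → ℂ)
    (hα : SolvesToOrder L p w k hk m α) :
    ∃ v₀ : Fin n → ℂ, {v | SolvesToOrder L p w k hk (m + 1) (Function.update α (m + 2) v)} =
      {v | ∃ s : ℂ, v = v₀ + s • α 1} := by
  rcases eq_or_ne n 0 with hn | hn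
  · subst hn
    refine ⟨0, Set.ext fun v ↦ ⟨fun _ ↦ ⟨0, Subsingleton.elim _ _⟩,
      fun _ ↦ ⟨fun μ ↦ μ.elim0, fun μ ↦ μ.elim0, fun μ ↦ μ.elim0⟩⟩⟩
  have hn' : (n : ℂ) ≠ 0 := Nat.cast_ne_zero.mpr hn
  obtain ⟨h0, hb, hO⟩ := (solvesToOrder_iff L hsum m α).mp hα
  obtain ⟨κ, hκ⟩ := (betheGap_eq_zero_iff L (p := p) hn).mp (hα.betheGap_eq_zero hp hsum)
  have hκ0 := blockBethe_ne_zero hadm h0 hb hκ hn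
  obtain ⟨M, hM⟩ := exists_blockBetheDeriv_equiv hκ0 h0 hb hκ
  -- By Euler's identity the leading coefficients span the directions that `M` sends to constant
  -- vectors. This is the one-parameter freedom at every order.
  have hMα : M (α 1) = fun _ ↦ -κ := by
    rw [hM]
    ext μ
    rw [← hκ μ]
    exact betheDeriv_self (injOn_blockSet hb _) (by simp) (h0 μ)
  -- the coefficient of the next order along the given arc
  have he (μ : Fin n) : ∃ e : ℂ, (fun t ↦ betheGap L p w k hk (t, scaledArc α (m + 1) t) μ -
      e * t ^ (m + 1)) =o[𝓝[≠] 0] fun t ↦ t ^ (m + 1) := by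
    obtain ⟨g, hg, hfg⟩ := AnalyticAt.exists_eq_pow_mul_of_isBigO
      (analyticAt_betheGap_scaledArc L (w := w) hp h0 hb m μ) (hO μ)
    refine ⟨g 0, ?_⟩
    have h1 : (fun t ↦ g t - g 0) =o[𝓝[≠] 0] fun _ ↦ (1 : ℂ) := by
      have h3 : Tendsto (fun t ↦ g t - g 0) (𝓝[≠] 0) (𝓝 (g 0 - g 0)) :=
        (hg.continuousAt.tendsto.mono_left nhdsWithin_le_nhds).sub tendsto_const_nhds
      rw [sub_self] at h3
      exact (Asymptotics.isLittleO_one_iff ℂ).mpr h3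
    have h2 := (Asymptotics.isBigO_refl (fun t : ℂ ↦ t ^ (m + 1)) (𝓝[≠] 0)).mul_isLittleO h1
    simp only [mul_one] at h2
    refine h2.congr' ?_ .rfl
    filter_upwards [hfg] with t ht
    rw [ht]; ring
  choose e he using he
  -- The gaps sum to zero identically, hence so do their next coefficients. This is the solvability
  -- condition for the linear system at the next order.
  have hesum : ∑ μ, e μ = 0 := by
    have h1 : (fun t : ℂ ↦ ∑ μ, (betheGap L p w k hk (t, scaledArc α (m + 1) t) μ -
        e μ * t ^ (m + 1))) =o[𝓝[≠] 0] fun t ↦ t ^ (m + 1) :=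
      Asymptotics.IsLittleO.fun_sum fun μ _ ↦ he μ
    have h2 : ∀ t : ℂ, ∑ μ, (betheGap L p w k hk (t, scaledArc α (m + 1) t) μ -
        e μ * t ^ (m + 1)) = 0 - (∑ μ, e μ) * t ^ (m + 1) := by
      intro t
      rw [Finset.sum_sub_distrib, Finset.sum_mul]
      congr 1
      simp only [betheGap, Finset.sum_sub_distrib, ← Finset.mul_sum]
      simp
    simp only [h2] at h1
    exact (AnalyticAt.isBigO_pow_succ_iff (f := fun _ ↦ 0) analyticAt_const h1).mp
      (Asymptotics.isBigO_zero _ _)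
  have hnext (v : Fin n → ℂ) (t : ℂ) :
      scaledArc (Function.update α (m + 2) v) (m + 1 + 1) t =
        scaledArc α (m + 1) t + t ^ (m + 1) • v := by
    ext μ
    simp only [scaledArc, Pi.add_apply, Pi.smul_apply, smul_eq_mul]
    rw [Finset.sum_range_succ, Function.update_self, mul_comm (v μ)]
    congr 1
    refine Finset.sum_congr rfl fun i hi ↦ ?_
    rw [Function.update_of_ne]
    have := Finset.mem_range.mp hi
    omega
  have hone (v : Fin n → ℂ) : Function.update α (m + 2) v 1 = α 1 :=
    Function.update_of_ne (by omega) _ _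
  have key (v : Fin n → ℂ) :
      SolvesToOrder L p w k hk (m + 1) (Function.update α (m + 2) v) ↔
        ∀ μ, e μ + (∑ ν, M v ν - n * M v μ) = 0 := by
    rw [solvesToOrder_iff L hsum, hone]
    simp only [h0, ne_eq, not_false_eq_true, implies_true, true_and]
    rw [and_iff_right fun μ ν hne hbl ↦ hb μ ν hne hbl]
    refine forall_congr' fun μ ↦ ?_
    have han := analyticAt_betheGap_scaledArc L (p := p) (w := w) (k := k) (hk := hk)
      (α := Function.update α (m + 2) v) hp (by rwa [hone]) (by rwa [hone]) (m + 1) μ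
    refine AnalyticAt.isBigO_pow_succ_iff han ?_
    -- Both arcs move with `t`, so strict differentiability at `(0, α 1)` is needed to extract the
    -- linear effect of the added term `t ^ (m + 1) • v`.
    have hst := ((analyticAt_betheGap L (p := p) (w := w) hp h0 hb μ).hasStrictFDerivAt).isLittleO
    have hlim : Tendsto (fun t : ℂ ↦ ((t, scaledArc α (m + 1) t + t ^ (m + 1) • v),
        (t, scaledArc α (m + 1) t))) (𝓝[≠] 0) (𝓝 (((0 : ℂ), α 1), ((0 : ℂ), α 1))) := by
      have h1 : ContinuousAt (fun t : ℂ ↦ ((t, scaledArc α (m + 1) t + t ^ (m + 1) • v),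
        (t, scaledArc α (m + 1) t))) 0 := by
        have := (analyticAt_scaledArc α (m + 1)).continuousAt
        fun_prop
      have h2 := h1.tendsto
      simp only [scaledArc_zero, zero_pow m.succ_ne_zero, zero_smul, add_zero] at h2
      exact h2.mono_left nhdsWithin_le_nhds
    have h1 := hst.comp_tendsto hlim
    have h2 : (fun t : ℂ ↦ (t, scaledArc α (m + 1) t + t ^ (m + 1) • v) -
        (t, scaledArc α (m + 1) t)) =O[𝓝[≠] 0] fun t ↦ t ^ (m + 1) := by
      have h3 : (fun t : ℂ ↦ (t, scaledArc α (m + 1) t + t ^ (m + 1) • v) -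
          (t, scaledArc α (m + 1) t)) = fun t ↦ t ^ (m + 1) • ((0 : ℂ), v) := by
        ext t <;> simp
      rw [h3]
      refine Asymptotics.IsBigO.of_bound ‖((0 : ℂ), v)‖ (.of_forall fun t ↦ ?_)
      rw [norm_smul, mul_comm]
    have h3 := (h1.trans_isBigO h2).add (he μ)
    refine h3.congr_left fun t ↦ ?_
    have h4 : (t, scaledArc α (m + 1) t + t ^ (m + 1) • v) - (t, scaledArc α (m + 1) t) =
        t ^ (m + 1) • ((0 : ℂ), v) := by
      ext <;> simp
    simp only [Function.comp_apply]
    rw [h4, map_smul, fderiv_betheGap L hp h0 hb, hnext, hM, smul_eq_mul]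
    ring
  -- The condition determines `M v` as `e / n` up to a constant vector, and constants are the images
  -- of multiples of `α 1`.
  refine ⟨M.symm fun μ ↦ e μ / n, Set.ext fun v ↦ ?_⟩
  simp only [Set.mem_ofPred_eq, key]
  constructor
  · intro h
    refine ⟨-((∑ ν, M v ν) / n) / κ, M.injective ?_⟩
    rw [map_add, map_smul, LinearEquiv.apply_symm_apply, hMα]
    ext μ
    have := h μ
    simp only [Pi.add_apply, Pi.smul_apply, smul_eq_mul]
    field_simp
    linear_combination -this
  · rintro ⟨s, rfl⟩ μ
    rw [map_add, map_smul, LinearEquiv.apply_symm_apply, hMα]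
    simp only [Pi.add_apply, Pi.smul_apply, smul_eq_mul, Finset.sum_add_distrib]
    rw [← Finset.sum_div, hesum]
    simp
    field_simp
    ring

end Coefficients

end LameCurve

end

theorem theorem3p9 (τ : UpperHalfPlane) {r n : ℕ} (p w : Fin r → ℂ)
    (hp : ∀ i j, i ≠ j → p i - p j ∉ (LameCurve.periods τ).lattice)
    (hw : ∀ i, w i ≠ 0) (hsum : ∑ i, w i = (n : ℂ)) :
    -- the boundary points with `h = ∞`
    ((LameCurve.compactCurve (LameCurve.periods τ) n p w \
          LameCurve.curve (LameCurve.periods τ) n p w) ∩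
        LameCurve.infinityDivisor (LameCurve.periods τ) n =
      {x | ∃ (k : Fin r → ℕ) (hk : ∑ i, k i = n), LameCurve.Admissible w k ∧
        x = LameCurve.mk (LameCurve.periods τ) (LameCurve.multiPoint p k hk) OnePoint.infty}) ∧
    ∀ (k : Fin r → ℕ) (hk : ∑ i, k i = n), LameCurve.Admissible w k →
      -- the local branch
      (∃ c : ℂ → (Fin n → ℂ) × ℂ,
        LameCurve.IsArcAt (LameCurve.periods τ) p w
          (LameCurve.mk (LameCurve.periods τ) (LameCurve.multiPoint p k hk) OnePoint.infty) c ∧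
        c 0 = (LameCurve.multiPoint p k hk, 0) ∧
        -- `1/h` is a local coordinate, and the linear coefficients are roots of Laguerre polynomials
        deriv (fun t => (c t).2) 0 ≠ 0 ∧
        (∀ μ, deriv (fun t => (c t).1 μ) 0 ≠ 0) ∧
        LameCurve.IsLaguerreSystem w k hk (deriv (fun t => (c t).2) 0)
          (fun μ => deriv (fun t => (c t).1 μ) 0) ∧
        -- the arc is injective near `0` and fills a neighbourhood of the point in the curve
        (∃ U ∈ 𝓝 (0 : ℂ),
          Set.InjOn (fun t => LameCurve.arcPoint (LameCurve.periods τ) (c t)) U) ∧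
        (∀ U ∈ 𝓝 (0 : ℂ),
          (fun t => LameCurve.arcPoint (LameCurve.periods τ) (c t)) '' U ∈
            𝓝[LameCurve.compactCurve (LameCurve.periods τ) n p w]
              (LameCurve.mk (LameCurve.periods τ) (LameCurve.multiPoint p k hk)
                OnePoint.infty)) ∧
        -- every other arc through the point is a reparametrization
        (∀ d : ℂ → (Fin n → ℂ) × ℂ,
          LameCurve.IsArcAt (LameCurve.periods τ) p w
            (LameCurve.mk (LameCurve.periods τ) (LameCurve.multiPoint p k hk) OnePoint.infty) d →
          ∃ φ : ℂ → ℂ, AnalyticAt ℂ φ 0 ∧ φ 0 = 0 ∧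
            (∀ᶠ t in 𝓝 (0 : ℂ), LameCurve.arcPoint (LameCurve.periods τ) (d t) =
              LameCurve.arcPoint (LameCurve.periods τ) (c (φ t))) ∧
            (deriv d 0 ≠ 0 → deriv φ 0 ≠ 0))) ∧
      -- the inductive construction of the coefficients: the lowest order
      (∀ b : Fin n → ℂ,
        LameCurve.SolvesToOrder (LameCurve.periods τ) p w k hk 0 (fun _ => b) ↔
          ∃ c : ℂ, c ≠ 0 ∧ LameCurve.IsLaguerreSystem w k hk c b) ∧
      -- the inductive construction of the coefficients: from each order to the next
      (∀ (m : ℕ) (α : ℕ → Fin n → ℂ),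
        LameCurve.SolvesToOrder (LameCurve.periods τ) p w k hk m α →
        ∃ v₀ : Fin n → ℂ,
          {v | LameCurve.SolvesToOrder (LameCurve.periods τ) p w k hk (m + 1)
            (Function.update α (m + 2) v)} = {v | ∃ s : ℂ, v = v₀ + s • α 1}) := by
  refine ⟨LameCurve.infinity_boundary_eq _ hp hsum, fun k hk hadm ↦
    ⟨?_, fun b ↦ LameCurve.solvesToOrder_zero_iff _ hp hsum hadm b,
      fun m α hα ↦ LameCurve.exists_solvesToOrder_succ _ hp hsum hadm m α hα⟩⟩
  obtain ⟨b, hb⟩ := LameCurve.exists_isLaguerreSystem w k hk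
  obtain ⟨Y, hY, hY0, heq, huniq⟩ := LameCurve.exists_branch _ hp hadm hb
  obtain ⟨h0, hinj, -⟩ := (LameCurve.isLaguerreSystem_iff_blockBethe hadm one_ne_zero).mp hb
  have hev := LameCurve.eventually_eq_branch hp hsum hadm hb huniq
  subst hY0
  -- The branch is parametrized by `u = 1 / h` itself, which gives the scaling factor `c = 1` and
  -- makes `Y 0` the vector of linear coefficients.
  have hu : deriv (fun t ↦ (LameCurve.branchArc p k hk Y t).2) 0 = 1 := deriv_id 0
  refine ⟨LameCurve.branchArc p k hk Y, ⟨LameCurve.analyticAt_branchArc hY, ?_, ?_⟩,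
    LameCurve.branchArc_zero Y, ?_, ?_, ?_, LameCurve.injOn_arcPoint_branchArc _ hp hY.continuousAt,
    fun U hU ↦ LameCurve.image_branchArc_mem_nhdsWithin _ hsum hY hev hU,
    fun d hd ↦ LameCurve.exists_reparametrization _ hsum hY hev hd⟩
  · rw [LameCurve.branchArc_zero, LameCurve.arcPoint_zero]
  · exact (LameCurve.eventually_mem_ansatzSet _ hp hsum hY.continuousAt h0 hinj heq).mono
      fun t ht ↦ (LameCurve.arcPoint_mem_curve_iff _ p hsum).mpr ht
  · rw [hu]
    exact one_ne_zero
  · intro μ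
    rw [LameCurve.deriv_branchArc_fst hY]
    exact h0 μ
  · simp only [hu, LameCurve.deriv_branchArc_fst hY]
    exact hb
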